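/- Let $(M,g)$ be a connected compact smooth Riemannian manifold of dimension $n\ge 1$ with non-empty boundary $\partial M$. Let $d_g$ be the Riemannian distance, let $m_g=v_g/v_g(M)$ be the normalized Riemannian volume measure, and let $\lambda_1^D(M)$ be the first (smallest) Dirichlet eigenvalue of the Laplacian on $M$. For $\eta>0$, the boundary separation distance is $$\operatorname{BSep}\bigl((M,d_g,m_g);\eta\bigr):=\sup\bigl\{\, d_g(\Omega,\partial M)\ :\ \Omega\subseteq M \text{ Borel},\ m_g(\Omega)\ge\eta \,\bigr\},$$ where $d_g(\Omega,\partial M)=\inf\{d_g(x,y): x\in\Omega,\ y\in\partial M\}$, and $\operatorname{BSep}\bigl((M,d_g,m_g);\eta\bigr):=0$ if there is no such $\Omega$. Then, for every $0<\eta\le e$, $$\operatorname{BSep}\bigl((M,d_g,m_g);\eta\bigr)\ \le\ \frac{1}{\sqrt{\lambda_1^D(M)}}\,\log\frac{e}{\eta}.$$ -/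

import Mathlib

open Bundle MeasureTheory Set Filter Topology
open scoped ENNReal Manifold ContDiff

noncomputable section

/-! ### Boundary separation distance -/

/-- The distance `d(A, B) = inf {d(a, b) | a ∈ A, b ∈ B}` between two subsets. -/
def setDistance {X : Type*} [PseudoEMetricSpace X] (A B : Set X) : ℝ≥0∞ :=
  ⨅ a ∈ A, ⨅ b ∈ B, edist a b

/-- The minimum of the mutual distances of the sets `Ω α` and of their distances to `bd`.
Minima over an empty index set are `∞`, so for `k = 1` only the distance to `bd` counts. -/
def mutualDistance {X : Type*} [PseudoEMetricSpace X] (bd : Set X) {k : ℕ}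
    (Ω : Fin k → Set X) : ℝ≥0∞ :=
  min (⨅ (α : Fin k) (β : Fin k) (_ : α ≠ β), setDistance (Ω α) (Ω β))
    (⨅ α : Fin k, setDistance (Ω α) bd)

/-- The `(η₁, …, ηₖ)`-boundary separation distance of a metric measure space `(X, μ)` with
boundary `bd`: the supremum of `mutualDistance bd Ω` over all sequences of Borel sets with
`μ (Ω α) ≥ η α`. It is `0` if there is no such sequence (supremum of the empty set). -/
def boundarySeparationDistance {X : Type*} [PseudoEMetricSpace X] [MeasurableSpace X]
    (μ : Measure X) (bd : Set X) {k : ℕ} (η : Fin k → ℝ) : ℝ≥0∞ :=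
  ⨆ (Ω : Fin k → Set X)
    (_ : ∀ α, MeasurableSet (Ω α) ∧ ENNReal.ofReal (η α) ≤ μ (Ω α)), mutualDistance bd Ω

/-! ### Riemannian volume -/

section Riemannian

variable (n : ℕ) [NeZero n] (M : Type*) [TopologicalSpace M]
  [ChartedSpace (EuclideanHalfSpace n) M] [IsManifold (𝓡∂ n) ∞ M]
  [RiemannianBundle (fun x : M ↦ TangentSpace (𝓡∂ n) x)]

/-- The coordinate vector field `∂ᵢ` of the chart at `p`, at the point with coordinates `y`. -/
def coordVector (p : M) (y : EuclideanSpace ℝ (Fin n)) (i : Fin n) :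
    TangentSpace (𝓡∂ n) ((extChartAt (𝓡∂ n) p).symm y) :=
  mfderivWithin 𝓘(ℝ, EuclideanSpace ℝ (Fin n)) (𝓡∂ n) (extChartAt (𝓡∂ n) p).symm
    (range (𝓡∂ n)) y (EuclideanSpace.single i (1 : ℝ) : EuclideanSpace ℝ (Fin n))

/-- The matrix `gᵢⱼ = g(∂ᵢ, ∂ⱼ)` of the metric in the chart at `p`. -/
def metricMatrix (p : M) (y : EuclideanSpace ℝ (Fin n)) : Matrix (Fin n) (Fin n) ℝ :=
  Matrix.of fun i j ↦ inner ℝ (coordVector n M p y i) (coordVector n M p y j)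

variable [MeasurableSpace M]

/-- The Riemannian volume on the domain of the chart at `p` (and zero outside it): the image
of `√(det gᵢⱼ) dy` under the inverse of the chart. -/
def chartVolume (p : M) : Measure M :=
  ((volume.restrict (extChartAt (𝓡∂ n) p).target).withDensity
    fun y ↦ ENNReal.ofReal (Real.sqrt (metricMatrix n M p y).det)).map
      (extChartAt (𝓡∂ n) p).symm

/-- The Riemannian volume `v_g`: the least measure that is at least `√(det gᵢⱼ) dy` in each
chart. As these local measures agree on overlaps, this is the measure that is equal to
`√(det gᵢⱼ) dy` in each chart. -/
def riemannianVolume : Measure M := ⨆ p : M, chartVolume n M p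

/-- The normalized Riemannian volume `m_g = v_g / v_g(M)`. -/
def normalizedVolume : Measure M :=
  (riemannianVolume n M univ)⁻¹ • riemannianVolume n M

/-! ### Dirichlet eigenvalues of the Laplacian -/

variable {M}

/-- The Riemannian gradient: `g(∇φ, v) = dφ(v)` for all tangent vectors `v` at `x`. -/
def riemannianGradient (φ : M → ℝ) (x : M) : TangentSpace (𝓡∂ n) x :=
  haveI : FiniteDimensional ℝ (TangentSpace (𝓡∂ n) x) :=
    inferInstanceAs (FiniteDimensional ℝ (EuclideanSpace ℝ (Fin n)))
  haveI : CompleteSpace (TangentSpace (𝓡∂ n) x) := FiniteDimensional.complete ℝ _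
  (InnerProductSpace.toDual ℝ (TangentSpace (𝓡∂ n) x)).symm
    (mfderiv (𝓡∂ n) 𝓘(ℝ, ℝ) φ x)

/-- The Dirichlet form `∫ g(∇φ, ∇ψ) dv_g`. -/
def dirichletForm (φ ψ : M → ℝ) : ℝ :=
  ∫ x, inner ℝ (riemannianGradient n φ x) (riemannianGradient n ψ x) ∂(riemannianVolume n M)

/-- Test functions on a compact manifold with boundary: smooth functions whose support is a
(compact) subset of the interior. -/
def IsTestFunction (φ : M → ℝ) : Prop :=
  ContMDiff (𝓡∂ n) 𝓘(ℝ, ℝ) ∞ φ ∧ tsupport φ ⊆ (𝓡∂ n).interior M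

/-- The function `u` is in the Sobolev space `H¹₀(M)`, the completion of the test functions in
the norm `(∫ φ² + ∫ |∇φ|²)^(1/2)`, and `φ` is a sequence of test functions that converges to `u`
in `H¹₀(M)`: it is Cauchy in that norm and converges to `u` in `L²`. -/
structure TendstoSobolev (φ : ℕ → M → ℝ) (u : M → ℝ) : Prop where
  isTestFunction : ∀ k, IsTestFunction n (φ k)
  memLp : MemLp u 2 (riemannianVolume n M)
  tendsto_L2 : Tendsto (fun k ↦ eLpNorm (φ k - u) 2 (riemannianVolume n M)) atTop (𝓝 0)
  cauchy_energy :
    Tendsto (fun p : ℕ × ℕ ↦ dirichletForm n (φ p.1 - φ p.2) (φ p.1 - φ p.2)) atTop (𝓝 0)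

/-- The function `u` is an eigenfunction of the Dirichlet Laplacian for `Λ`, that is, a nonzero
weak solution of `-Δu = Λ u` in `M`, `u = 0` on `∂M`: one has `u ∈ H¹₀(M)`, `u ≠ 0`, and
`∫ g(∇u, ∇ψ) dv_g = Λ ∫ u ψ dv_g` for every test function `ψ`. Here `∫ g(∇u, ∇ψ) dv_g` is the
limit of `∫ g(∇φₖ, ∇ψ) dv_g` for test functions `φₖ` that converge to `u` in `H¹₀(M)`. -/
def IsDirichletEigenfunction (Λ : ℝ) (u : M → ℝ) : Prop :=
  ¬ u =ᵐ[riemannianVolume n M] 0 ∧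
  ∃ φ : ℕ → M → ℝ, TendstoSobolev n φ u ∧
    ∀ ψ : M → ℝ, IsTestFunction n ψ →
      Tendsto (fun k ↦ dirichletForm n (φ k) ψ) atTop
        (𝓝 (Λ * ∫ x, u x * ψ x ∂(riemannianVolume n M)))

variable (M)

/-- The first (smallest) Dirichlet eigenvalue of the Laplacian. -/
def firstDirichletEigenvalue : ℝ :=
  sInf {Λ : ℝ | ∃ u : M → ℝ, IsDirichletEigenfunction n Λ u}

end Riemannian

end

/-! Let `λ` be the first Dirichlet eigenvalue, `v` the volume, and let `Ω` have distance at least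
`D` from the boundary. The function to insert in the Rayleigh quotient is `φ = sinh (√λ · min (d(x,
∂M), D))`. A distance function has slope at most `1`, so `|∇φ|² ≤ λ cosh² = λ (1 + φ²)`, and `∇φ =
0` on `Ω`, where the truncated distance is constant. Hence `λ ∫ φ² ≤ ∫ |∇φ|² ≤ λ (v(Ωᶜ) + ∫_{Ωᶜ}
φ²)`. The integrals over `Ωᶜ` cancel, which leaves `sinh² (√λ D) v(Ω) ≤ v(Ωᶜ)`, that is, `cosh² (√λ
D) v(Ω) ≤ v(M)`. With `cosh t ≥ eᵗ / 2` and `v(Ω) ≥ η v(M)` this yields `√λ D ≤ log 2 + (1/2) log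
(1/η)`. Since `η ≤ 1` as soon as such an `Ω` exists, this is stronger than the claim, and the
surplus absorbs a fixed loss in the approximations below.

The truncated distance is not smooth. `LipschitzWith.exists_smooth_approx` replaces it by a smooth
function of slope at most `κ`, for any `κ > 1`: it mollifies in charts, where the metric is nearly
constant, and glues with a partition of unity. Composing with a smooth cutoff and `sinh` gives the
test function of `exists_isTestFunction_gradientSq_le`, and `cosh_sq_mul_volume_le` is the resulting
concentration inequality.

The eigenvalue is defined as an infimum of weak eigenvalues, so the Rayleigh inequality has to be
proved, together with `λ > 0`; this is `firstDirichletEigenvalue_pos_and_mul_integral_sq_le`. The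
infimum `R` of the Rayleigh quotient is attained by a weak eigenvector (`exists_rayleigh_minimizer`)
and bounds all weak eigenvalues from below (`le_of_weak_eigenvector`), so `λ = R`. Attainment needs
Rellich compactness, obtained from `exists_sq_le_energy_add_sum`: up to a small multiple of the
energy, finitely many averages control the `L²` norm. Positivity is the Poincaré inequality
`exists_poincare`, where connectedness and the non-empty boundary enter. Both reduce to Euclidean
estimates on balls, because a test function in a chart, extended by zero, stays `C¹` across the
boundary of the half-space. The volume, a supremum of chart measures, becomes computable by
`restrict_riemannianVolume`. -/

noncomputable section

/-! ### Integral estimates in a finite-dimensional vector space -/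

section Euclidean

theorem sq_lintegral_le_measure_mul {α : Type*} [MeasurableSpace α] (μ : Measure α) {u : α → ℝ≥0∞}
    (hu : AEMeasurable u μ) : (∫⁻ x, u x ∂μ) ^ 2 ≤ μ univ * ∫⁻ x, u x ^ 2 ∂μ := by
  have h := ENNReal.lintegral_mul_le_Lp_mul_Lq μ (p := 2) (q := 2)
    (by constructor <;> norm_num) (f := fun _ ↦ 1) (g := u) aemeasurable_const hu
  simp only [Pi.mul_apply, one_mul] at h
  calc (∫⁻ x, u x ∂μ) ^ 2
      ≤ ((∫⁻ _, (1 : ℝ≥0∞) ^ (2 : ℝ) ∂μ) ^ (1 / (2 : ℝ))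
          * (∫⁻ x, u x ^ (2 : ℝ) ∂μ) ^ (1 / (2 : ℝ))) ^ 2 := by gcongr
    _ = μ univ * ∫⁻ x, u x ^ 2 ∂μ := by
      rw [mul_pow, ← ENNReal.rpow_natCast, ← ENNReal.rpow_natCast, ← ENNReal.rpow_mul,
        ← ENNReal.rpow_mul]
      simp

theorem enorm_setAverage_sq_le {α : Type*} [MeasurableSpace α] (μ : Measure α) {s : Set α}
    (h0 : μ s ≠ 0) (ht : μ s ≠ ⊤) {u : α → ℝ} (hu : AEMeasurable u (μ.restrict s)) :
    ‖⨍ x in s, u x ∂μ‖ₑ ^ 2 ≤ (μ s)⁻¹ * ∫⁻ x in s, ‖u x‖ₑ ^ 2 ∂μ := by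
  have e : ‖(μ.real s)⁻¹‖ₑ = (μ s)⁻¹ := by
    have hpos := ENNReal.toReal_pos h0 ht
    rw [measureReal_def, enorm_inv hpos.ne', Real.enorm_eq_ofReal hpos.le,
      ENNReal.ofReal_toReal ht]
  rw [setAverage_eq, enorm_smul, mul_pow, e]
  calc (μ s)⁻¹ ^ 2 * ‖∫ x in s, u x ∂μ‖ₑ ^ 2
      ≤ (μ s)⁻¹ ^ 2 * (∫⁻ x in s, ‖u x‖ₑ ∂μ) ^ 2 := by
        gcongr; exact enorm_integral_le_lintegral_enorm _
    _ ≤ (μ s)⁻¹ ^ 2 * (μ s * ∫⁻ x in s, ‖u x‖ₑ ^ 2 ∂μ) := by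
        gcongr
        have := sq_lintegral_le_measure_mul (μ.restrict s) (u := fun x ↦ ‖u x‖ₑ) hu.enorm
        rwa [Measure.restrict_apply_univ] at this
    _ = (μ s)⁻¹ * ∫⁻ x in s, ‖u x‖ₑ ^ 2 ∂μ := by
        rw [← mul_assoc, pow_two, mul_assoc (μ s)⁻¹, ENNReal.inv_mul_cancel h0 ht, mul_one]

theorem enorm_add_sq_le (a b : ℝ) :
    ‖a + b‖ₑ ^ 2 ≤ 2 * ‖a‖ₑ ^ 2 + 2 * ‖b‖ₑ ^ 2 := by
  have h := ENNReal.rpow_add_le_mul_rpow_add_rpow ‖a‖ₑ ‖b‖ₑ (p := 2) (by norm_num)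
  have e : (2 : ℝ) - 1 = 1 := by norm_num
  rw [e, ENNReal.rpow_one] at h
  rw [← mul_add]
  refine le_trans ?_ (by simpa only [ENNReal.rpow_two] using h)
  gcongr
  exact enorm_add_le a b

theorem setLIntegral_ball_eq_add {E : Type*} [NormedAddCommGroup E]
    [MeasurableSpace E] [BorelSpace E]
    [SecondCountableTopology E] (μ : Measure E)
    [μ.IsAddLeftInvariant] (F : E → ℝ≥0∞) (x : E) (s : ℝ) :
    ∫⁻ y in Metric.ball x s, F y ∂μ = ∫⁻ h in Metric.ball (0 : E) s, F (x + h) ∂μ := by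
  rw [← lintegral_indicator Metric.isOpen_ball.measurableSet,
    ← lintegral_indicator Metric.isOpen_ball.measurableSet, ← lintegral_add_left_eq_self _ x]
  congr 1 with h
  simp [indicator]

variable {E : Type*} [NormedAddCommGroup E] [NormedSpace ℝ E]

/-- Fundamental theorem of calculus along the segment from `x` to `x + h`, then Cauchy–Schwarz in
the parameter `t`. -/
theorem enorm_add_sub_sq_le_lintegral_fderiv {f : E → ℝ} {s : Set E} (hs : IsOpen s)
    (hc : Convex ℝ s) (hf : ContDiffOn ℝ 1 f s) {x h : E} (hx : x ∈ s) (hxh : x + h ∈ s) :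
    ‖f (x + h) - f x‖ₑ ^ 2 ≤
      ‖h‖ₑ ^ 2 * ∫⁻ t in Icc (0 : ℝ) 1, ‖fderiv ℝ f (x + t • h)‖ₑ ^ 2 := by
  have hmem : ∀ t ∈ Icc (0 : ℝ) 1, x + t • h ∈ s := fun t ht ↦ by
    have := hc.add_smul_mem hx hxh ht
    simpa using this
  have hline : ContDiff ℝ 1 fun t : ℝ ↦ x + t • h := by fun_prop
  have hg : ContDiffOn ℝ 1 (fun t : ℝ ↦ f (x + t • h)) (Icc 0 1) :=
    hf.comp hline.contDiffOn hmem
  have h1 := enorm_sub_le_lintegral_deriv_of_contDiffOn_Icc hg zero_le_one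
  simp only [one_smul, zero_smul, add_zero] at h1
  have hD : ContinuousOn (fun t : ℝ ↦ fderiv ℝ f (x + t • h)) (Icc 0 1) :=
    (hf.continuousOn_fderiv_of_isOpen hs le_rfl).comp hline.continuous.continuousOn hmem
  have h2 : ∫⁻ t in Icc (0 : ℝ) 1, ‖deriv (fun t : ℝ ↦ f (x + t • h)) t‖ₑ
      ≤ ∫⁻ t in Icc (0 : ℝ) 1, ‖h‖ₑ * ‖fderiv ℝ f (x + t • h)‖ₑ := by
    refine setLIntegral_mono' measurableSet_Icc fun t ht ↦ ?_
    have hd : HasFDerivAt f (fderiv ℝ f (x + t • h)) (x + t • h) :=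
      ((hf.differentiableOn one_ne_zero).differentiableAt
        (hs.mem_nhds (hmem t ht))).hasFDerivAt
    have hl : HasDerivAt (fun t : ℝ ↦ x + t • h) h t := by
      simpa using ((hasDerivAt_id t).smul_const h).const_add x
    have := hd.comp_hasDerivAt t hl
    have e := this.deriv
    simp only [Function.comp_def] at e
    rw [e, mul_comm]
    exact ContinuousLinearMap.le_opENorm _ _
  have hm : AEMeasurable (fun t : ℝ ↦ ‖fderiv ℝ f (x + t • h)‖ₑ)
      (volume.restrict (Icc (0 : ℝ) 1)) :=
    (hD.enorm).aemeasurable measurableSet_Icc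
  calc ‖f (x + h) - f x‖ₑ ^ 2
      ≤ (∫⁻ t in Icc (0 : ℝ) 1, ‖h‖ₑ * ‖fderiv ℝ f (x + t • h)‖ₑ) ^ 2 := by
        gcongr; exact h1.trans h2
    _ = ‖h‖ₑ ^ 2 * (∫⁻ t in Icc (0 : ℝ) 1, ‖fderiv ℝ f (x + t • h)‖ₑ) ^ 2 := by
        rw [lintegral_const_mul' _ _ enorm_ne_top, mul_pow]
    _ ≤ _ := by
        gcongr
        refine (sq_lintegral_le_measure_mul _ hm).trans ?_
        simp

variable [MeasurableSpace E] [BorelSpace E] [FiniteDimensional ℝ E]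
  (μ : Measure E) [μ.IsAddHaarMeasure]

/-- Integrate the bound on segments over the ball and exchange the integrals. For each `t`, the ball
translated by `t • h` stays in the ball of radius `3 * r`, so translation invariance finishes; this
is the origin of the factor `3` in the radii. -/
theorem lintegral_ball_add_sub_sq_le {f : E → ℝ} {x₀ : E} {r : ℝ}
    (hf : ContDiffOn ℝ 1 f (Metric.ball x₀ (3 * r))) {h : E} (hh : ‖h‖ ≤ 2 * r) :
    ∫⁻ x in Metric.ball x₀ r, ‖f (x + h) - f x‖ₑ ^ 2 ∂μ ≤
      ‖h‖ₑ ^ 2 * ∫⁻ x in Metric.ball x₀ (3 * r), ‖fderiv ℝ f x‖ₑ ^ 2 ∂μ := by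
  have hmeas : Measurable fun x : E ↦ ‖fderiv ℝ f x‖ₑ ^ 2 :=
    (measurable_fderiv ℝ f).enorm.pow_const 2
  have hin : ∀ x ∈ Metric.ball x₀ r, ∀ t ∈ Icc (0 : ℝ) 1, x + t • h ∈ Metric.ball x₀ (3 * r) := by
    intro x hx t ht
    rw [Metric.mem_ball, dist_eq_norm] at hx ⊢
    have h1 : ‖t • h‖ ≤ 2 * r := by
      rw [norm_smul, Real.norm_of_nonneg ht.1]
      nlinarith [norm_nonneg h, ht.2]
    calc ‖x + t • h - x₀‖ = ‖(x - x₀) + t • h‖ := by congr 1; abel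
      _ ≤ ‖x - x₀‖ + ‖t • h‖ := norm_add_le _ _
      _ < 3 * r := by linarith
  calc ∫⁻ x in Metric.ball x₀ r, ‖f (x + h) - f x‖ₑ ^ 2 ∂μ
      ≤ ∫⁻ x in Metric.ball x₀ r,
          (‖h‖ₑ ^ 2 * ∫⁻ t in Icc (0 : ℝ) 1, ‖fderiv ℝ f (x + t • h)‖ₑ ^ 2) ∂μ := by
        refine setLIntegral_mono' Metric.isOpen_ball.measurableSet fun x hx ↦ ?_
        refine enorm_add_sub_sq_le_lintegral_fderiv Metric.isOpen_ball (convex_ball _ _) hf ?_ ?_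
        · simpa using hin x hx 0 (by simp)
        · simpa using hin x hx 1 (by simp)
    _ = ‖h‖ₑ ^ 2 * ∫⁻ t in Icc (0 : ℝ) 1, (∫⁻ x in Metric.ball x₀ r,
          ‖fderiv ℝ f (x + t • h)‖ₑ ^ 2 ∂μ) := by
        rw [lintegral_const_mul' _ _ (by simp), lintegral_lintegral_swap]
        refine Measurable.aemeasurable ?_
        exact hmeas.comp (by fun_prop : Measurable fun p : E × ℝ ↦ p.1 + p.2 • h)
    _ ≤ ‖h‖ₑ ^ 2 * ∫⁻ _ in Icc (0 : ℝ) 1, (∫⁻ x in Metric.ball x₀ (3 * r),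
          ‖fderiv ℝ f x‖ₑ ^ 2 ∂μ) := by
        gcongr ‖h‖ₑ ^ 2 * ?_
        refine setLIntegral_mono' measurableSet_Icc fun t ht ↦ ?_
        rw [← lintegral_indicator Metric.isOpen_ball.measurableSet,
          ← lintegral_indicator Metric.isOpen_ball.measurableSet,
          ← lintegral_add_right_eq_self ((Metric.ball x₀ (3 * r)).indicator _) (t • h)]
        refine lintegral_mono fun x ↦ ?_
        by_cases hx : x ∈ Metric.ball x₀ r
        · rw [indicator_of_mem hx, indicator_of_mem (hin x hx t ht)]
        · rw [indicator_of_notMem hx]; exact zero_le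
    _ = _ := by simp

/-- A Poincaré inequality for differences at distance less than `s`. -/
theorem lintegral_ball_lintegral_ball_sub_sq_le {f : E → ℝ} (hfm : Measurable f) {x₀ : E} {r : ℝ}
    (hf : ContDiffOn ℝ 1 f (Metric.ball x₀ (3 * r))) {s : ℝ} (hs : s ≤ 2 * r) :
    ∫⁻ x in Metric.ball x₀ r, ∫⁻ y in Metric.ball x s, ‖f y - f x‖ₑ ^ 2 ∂μ ∂μ ≤
      μ (Metric.ball 0 s) * ENNReal.ofReal s ^ 2 *
        ∫⁻ x in Metric.ball x₀ (3 * r), ‖fderiv ℝ f x‖ₑ ^ 2 ∂μ := by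
  simp_rw [fun x ↦ setLIntegral_ball_eq_add μ (fun y ↦ ‖f y - f x‖ₑ ^ 2) x s]
  rw [lintegral_lintegral_swap]
  · calc ∫⁻ h in Metric.ball (0 : E) s, ∫⁻ x in Metric.ball x₀ r, ‖f (x + h) - f x‖ₑ ^ 2 ∂μ ∂μ
        ≤ ∫⁻ _ in Metric.ball (0 : E) s, ENNReal.ofReal s ^ 2 *
            ∫⁻ x in Metric.ball x₀ (3 * r), ‖fderiv ℝ f x‖ₑ ^ 2 ∂μ ∂μ := by
          refine setLIntegral_mono' Metric.isOpen_ball.measurableSet fun h hh ↦ ?_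
          have hh' : ‖h‖ < s := by simpa using hh
          refine (lintegral_ball_add_sub_sq_le μ hf (hh'.le.trans hs)).trans ?_
          gcongr
          rw [← ofReal_norm]
          exact ENNReal.ofReal_le_ofReal hh'.le
      _ = _ := by
          rw [lintegral_const, Measure.restrict_apply_univ]; ring
  · refine Measurable.aemeasurable ?_
    refine Measurable.pow_const (Measurable.enorm ?_) 2
    exact (hfm.comp (by fun_prop : Measurable fun p : E × E ↦ p.1 + p.2)).sub
      (hfm.comp measurable_fst)

theorem lintegral_ball_sub_sq_le {f : E → ℝ} (hfm : Measurable f) {x₀ : E} {r : ℝ}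
    (hf : ContDiffOn ℝ 1 f (Metric.ball x₀ (3 * r))) :
    ∫⁻ x in Metric.ball x₀ r, ∫⁻ y in Metric.ball x₀ r, ‖f y - f x‖ₑ ^ 2 ∂μ ∂μ ≤
      μ (Metric.ball 0 (2 * r)) * ENNReal.ofReal (2 * r) ^ 2 *
        ∫⁻ x in Metric.ball x₀ (3 * r), ‖fderiv ℝ f x‖ₑ ^ 2 ∂μ := by
  refine le_trans ?_ (lintegral_ball_lintegral_ball_sub_sq_le μ hfm hf le_rfl)
  refine setLIntegral_mono' Metric.isOpen_ball.measurableSet fun x hx ↦ ?_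
  refine lintegral_mono_set fun y hy ↦ ?_
  rw [Metric.mem_ball] at *
  linarith [dist_triangle_right y x x₀]

omit [NormedSpace ℝ E] [BorelSpace E] [FiniteDimensional ℝ E] [μ.IsAddHaarMeasure] in
-- Average `|f x|² ≤ 2 |f y|² + 2 |f y - f x|²` over `y ∈ W`, then integrate in `x`. This spreads an
-- `L²` bound from any part of the ball to the whole ball, at the cost of differences.
theorem measure_mul_lintegral_ball_sq_le {f : E → ℝ} (hfm : Measurable f) {x₀ : E} {r : ℝ}
    {W : Set E} (hWr : W ⊆ Metric.ball x₀ r) :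
    μ W * ∫⁻ x in Metric.ball x₀ r, ‖f x‖ₑ ^ 2 ∂μ ≤
      2 * μ (Metric.ball x₀ r) * ∫⁻ y in W, ‖f y‖ₑ ^ 2 ∂μ +
      2 * ∫⁻ x in Metric.ball x₀ r, ∫⁻ y in Metric.ball x₀ r, ‖f y - f x‖ₑ ^ 2 ∂μ ∂μ := by
  have hm : Measurable fun x ↦ ‖f x‖ₑ ^ 2 := hfm.enorm.pow_const 2
  have hpt : ∀ x, μ W * ‖f x‖ₑ ^ 2 ≤ 2 * ∫⁻ y in W, ‖f y‖ₑ ^ 2 ∂μ +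
      2 * ∫⁻ y in Metric.ball x₀ r, ‖f y - f x‖ₑ ^ 2 ∂μ := by
    intro x
    calc μ W * ‖f x‖ₑ ^ 2 = ∫⁻ _ in W, ‖f x‖ₑ ^ 2 ∂μ := by simp [mul_comm]
      _ ≤ ∫⁻ y in W, (2 * ‖f y‖ₑ ^ 2 + 2 * ‖f y - f x‖ₑ ^ 2) ∂μ := by
          refine lintegral_mono fun y ↦ ?_
          have h := enorm_add_sq_le (f y) (f x - f y)
          rwa [add_sub_cancel, enorm_sub_rev (f x)] at h
      _ = 2 * ∫⁻ y in W, ‖f y‖ₑ ^ 2 ∂μ + 2 * ∫⁻ y in W, ‖f y - f x‖ₑ ^ 2 ∂μ := by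
          rw [lintegral_add_left (hm.const_mul 2), lintegral_const_mul' _ _ (by simp),
            lintegral_const_mul' _ _ (by simp)]
      _ ≤ _ := by gcongr
  calc μ W * ∫⁻ x in Metric.ball x₀ r, ‖f x‖ₑ ^ 2 ∂μ
      = ∫⁻ x in Metric.ball x₀ r, μ W * ‖f x‖ₑ ^ 2 ∂μ := by rw [lintegral_const_mul _ hm]
    _ ≤ ∫⁻ x in Metric.ball x₀ r, (2 * ∫⁻ y in W, ‖f y‖ₑ ^ 2 ∂μ +
          2 * ∫⁻ y in Metric.ball x₀ r, ‖f y - f x‖ₑ ^ 2 ∂μ) ∂μ := lintegral_mono hpt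
    _ = _ := by
        rw [lintegral_add_left measurable_const, lintegral_const, Measure.restrict_apply_univ,
          lintegral_const_mul' _ _ (by simp)]
        ring

/-- The `L²` norm on a ball is controlled by finitely many averages over small balls and a small
multiple of the energy. -/
theorem lintegral_ball_sq_le_sum_average {f : E → ℝ} (hfm : Measurable f) {x₀ : E} {r : ℝ}
    (hf : ContDiffOn ℝ 1 f (Metric.ball x₀ (3 * r)))
    (hfi : IntegrableOn f (Metric.ball x₀ (3 * r)) μ) {δ : ℝ} (hδ : 0 < δ) (hδr : δ ≤ r)
    (t : Finset E) (ht : ∀ c ∈ t, c ∈ Metric.ball x₀ r)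
    (hcov : Metric.ball x₀ r ⊆ ⋃ c ∈ t, Metric.ball c δ) :
    ∫⁻ x in Metric.ball x₀ r, ‖f x‖ₑ ^ 2 ∂μ ≤
      2 * μ (Metric.ball x₀ r) * ∑ c ∈ t, ‖⨍ y in Metric.ball c δ, f y ∂μ‖ₑ ^ 2 +
      ENNReal.ofReal (8 * 2 ^ Module.finrank ℝ E * δ ^ 2) *
        ∫⁻ x in Metric.ball x₀ (3 * r), ‖fderiv ℝ f x‖ₑ ^ 2 ∂μ := by
  set V := μ (Metric.ball (0 : E) δ) with hV
  have hV0 : V ≠ 0 := (Metric.measure_ball_pos μ _ hδ).ne'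
  have hVt : V ≠ ⊤ := measure_ball_lt_top.ne
  have hVc : ∀ c : E, μ (Metric.ball c δ) = V := fun c ↦ Measure.addHaar_ball_center μ c δ
  set S := ∑ c ∈ t, ‖⨍ y in Metric.ball c δ, f y ∂μ‖ₑ ^ 2 with hS
  -- Compare `f x` with its average over a ball of the cover that contains `x`. That ball lies in
  -- `Metric.ball x (2 * δ)`, so the error is a mean of differences at distance less than `2 * δ`.
  have hpt : ∀ x ∈ Metric.ball x₀ r, ‖f x‖ₑ ^ 2 ≤
      2 * S + 2 * V⁻¹ * ∫⁻ y in Metric.ball x (2 * δ), ‖f y - f x‖ₑ ^ 2 ∂μ := by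
    intro x hx
    obtain ⟨c, hct, hxc⟩ : ∃ c ∈ t, x ∈ Metric.ball c δ := by simpa using hcov hx
    set a := ⨍ y in Metric.ball c δ, f y ∂μ with ha
    have hsub : Metric.ball c δ ⊆ Metric.ball x₀ (3 * r) := by
      refine Metric.ball_subset_ball' ?_
      have := Metric.mem_ball.1 (ht c hct)
      linarith
    have hsub2 : Metric.ball c δ ⊆ Metric.ball x (2 * δ) := by
      refine Metric.ball_subset_ball' ?_
      rw [Metric.mem_ball, dist_comm] at hxc
      linarith
    have hci : IntegrableOn f (Metric.ball c δ) μ := hfi.mono_set hsub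
    have hne : μ (Metric.ball c δ) ≠ 0 := by rw [hVc]; exact hV0
    have hnt : μ (Metric.ball c δ) ≠ ⊤ := by rw [hVc]; exact hVt
    have e1 : a - f x = ⨍ y in Metric.ball c δ, (f y - f x) ∂μ := by
      rw [setAverage_eq, integral_sub hci (integrableOn_const hnt),
        smul_sub, ha, setAverage_eq, setIntegral_const, smul_smul]
      rw [inv_mul_cancel₀, one_smul]
      rw [measureReal_def]
      exact (ENNReal.toReal_pos hne hnt).ne'
    have e2 : ‖a - f x‖ₑ ^ 2 ≤ V⁻¹ * ∫⁻ y in Metric.ball x (2 * δ), ‖f y - f x‖ₑ ^ 2 ∂μ := by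
      rw [e1]
      refine (enorm_setAverage_sq_le μ hne hnt (hfm.sub_const _).aemeasurable).trans ?_
      rw [hVc]
      gcongr
    calc ‖f x‖ₑ ^ 2 = ‖a + (f x - a)‖ₑ ^ 2 := by congr 2; ring
      _ ≤ 2 * ‖a‖ₑ ^ 2 + 2 * ‖f x - a‖ₑ ^ 2 := enorm_add_sq_le _ _
      _ ≤ 2 * S + 2 * (V⁻¹ * ∫⁻ y in Metric.ball x (2 * δ), ‖f y - f x‖ₑ ^ 2 ∂μ) := by
          gcongr
          · exact Finset.single_le_sum
              (f := fun c ↦ ‖⨍ y in Metric.ball c δ, f y ∂μ‖ₑ ^ 2) (fun _ _ ↦ zero_le) hct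
          · rw [enorm_sub_rev]; exact e2
      _ = _ := by rw [mul_assoc]
  calc ∫⁻ x in Metric.ball x₀ r, ‖f x‖ₑ ^ 2 ∂μ
      ≤ ∫⁻ x in Metric.ball x₀ r,
          (2 * S + 2 * V⁻¹ * ∫⁻ y in Metric.ball x (2 * δ), ‖f y - f x‖ₑ ^ 2 ∂μ) ∂μ :=
        setLIntegral_mono' Metric.isOpen_ball.measurableSet hpt
    _ = 2 * S * μ (Metric.ball x₀ r) + 2 * V⁻¹ * ∫⁻ x in Metric.ball x₀ r,
          ∫⁻ y in Metric.ball x (2 * δ), ‖f y - f x‖ₑ ^ 2 ∂μ ∂μ := by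
        rw [lintegral_add_left measurable_const, lintegral_const, Measure.restrict_apply_univ,
          lintegral_const_mul' _ _ (ENNReal.mul_ne_top (by simp) (by simpa using hV0))]
    _ ≤ 2 * S * μ (Metric.ball x₀ r) + 2 * V⁻¹ * (μ (Metric.ball 0 (2 * δ)) *
          ENNReal.ofReal (2 * δ) ^ 2 *
          ∫⁻ x in Metric.ball x₀ (3 * r), ‖fderiv ℝ f x‖ₑ ^ 2 ∂μ) := by
        gcongr
        exact lintegral_ball_lintegral_ball_sub_sq_le μ hfm hf (by linarith)
    _ = _ := by
        -- Doubling the radius multiplies the volume by `2 ^ finrank`, so `V` cancels and `2 * 2 ^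
        -- finrank * (2 * δ) ^ 2` remains.
        have e : μ (Metric.ball (0 : E) (2 * δ)) =
            ENNReal.ofReal (2 ^ Module.finrank ℝ E) * V :=
          Measure.addHaar_ball_mul_of_pos μ 0 two_pos δ
        have e2 : 2 * V⁻¹ * (ENNReal.ofReal (2 ^ Module.finrank ℝ E) * V *
          ENNReal.ofReal (2 * δ) ^ 2) = ENNReal.ofReal (8 * 2 ^ Module.finrank ℝ E * δ ^ 2) := by
          calc _ = (V⁻¹ * V) * (2 * ENNReal.ofReal (2 ^ Module.finrank ℝ E) *
                ENNReal.ofReal (2 * δ) ^ 2) := by ring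
            _ = _ := by
              rw [ENNReal.inv_mul_cancel hV0 hVt, one_mul, ← ENNReal.ofReal_pow (by positivity),
                show (2 : ℝ≥0∞) = ENNReal.ofReal 2 by simp, ← ENNReal.ofReal_mul (by positivity),
                ← ENNReal.ofReal_mul (by positivity)]
              congr 1; ring
        rw [e, ← mul_assoc (2 * V⁻¹), e2]
        ring

end Euclidean


/-! ### Minimization of a Rayleigh quotient -/

section Rayleigh

variable {V H : Type*} [AddCommGroup V] [Module ℝ V] [NormedAddCommGroup H]
  [InnerProductSpace ℝ H] {Q : LinearMap.BilinForm ℝ V} {ι : V →ₗ[ℝ] H}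

/-- If bounded sequences for the form `Q` have subsequences that converge in `H`, then the infimum
`R` of the Rayleigh quotient is attained by a weak eigenvector. -/
theorem exists_rayleigh_minimizer (hsymm : ∀ a b, Q a b = Q b a) (hnonneg : ∀ a, 0 ≤ Q a a)
    (hcomp : ∀ (C : ℝ) (φ : ℕ → V), (∀ k, ‖ι (φ k)‖ ≤ C ∧ Q (φ k) (φ k) ≤ C) →
      ∃ (s : ℕ → ℕ) (u : H), StrictMono s ∧ Tendsto (fun k ↦ ι (φ (s k))) atTop (𝓝 u))
    (hne : ∃ v, ι v ≠ 0) :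
    ∃ (R : ℝ) (u : H) (φ : ℕ → V), ‖u‖ = 1 ∧ Tendsto (fun k ↦ ι (φ k)) atTop (𝓝 u) ∧
      Tendsto (fun k ↦ Q (φ k) (φ k)) atTop (𝓝 R) ∧
      Tendsto (fun p : ℕ × ℕ ↦ Q (φ p.1 - φ p.2) (φ p.1 - φ p.2)) atTop (𝓝 0) ∧
      (∀ ψ, Tendsto (fun k ↦ Q (φ k) ψ) atTop (𝓝 (R * inner ℝ u (ι ψ)))) ∧
      ∀ ψ, R * ‖ι ψ‖ ^ 2 ≤ Q ψ ψ := by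
  set S : Set ℝ := {q | ∃ v, ‖ι v‖ = 1 ∧ Q v v = q} with hS
  have hscale : ∀ v, ι v ≠ 0 → Q v v / ‖ι v‖ ^ 2 ∈ S := fun v hv ↦ by
    refine ⟨‖ι v‖⁻¹ • v, ?_, ?_⟩
    · rw [map_smul, norm_smul, norm_inv, norm_norm, inv_mul_cancel₀ (norm_ne_zero_iff.2 hv)]
    · simp only [map_smul, LinearMap.smul_apply, smul_eq_mul]; field_simp
  have hSne : S.Nonempty := hne.elim fun v hv ↦ ⟨_, hscale v hv⟩
  have hSbdd : BddBelow S := ⟨0, by rintro _ ⟨v, -, rfl⟩; exact hnonneg v⟩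
  set R := sInf S with hR
  have hray : ∀ ψ, R * ‖ι ψ‖ ^ 2 ≤ Q ψ ψ := fun ψ ↦ by
    by_cases h : ι ψ = 0
    · simpa [h] using hnonneg ψ
    · have := csInf_le hSbdd (hscale ψ h)
      rwa [le_div_iff₀ (by have := norm_pos_iff.2 h; positivity)] at this
  obtain ⟨q, -, hqR, hqS⟩ := exists_seq_tendsto_sInf hSne hSbdd
  choose φ₀ hφ₀n hφ₀q using hqS
  obtain ⟨C, hC⟩ := hqR.bddAbove_range
  obtain ⟨s, u, hs, hu⟩ := hcomp (max 1 C) φ₀ fun k ↦ ⟨by rw [hφ₀n]; exact le_max_left _ _,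
    by rw [hφ₀q]; exact (hC ⟨k, rfl⟩).trans (le_max_right _ _)⟩
  set φ := fun k ↦ φ₀ (s k) with hφ
  have hQ : Tendsto (fun k ↦ Q (φ k) (φ k)) atTop (𝓝 R) := by
    simp only [hφ, hφ₀q]
    exact hqR.comp hs.tendsto_atTop
  have hu1 : ‖u‖ = 1 :=
    tendsto_nhds_unique hu.norm (by simp only [hφ₀n]; exact tendsto_const_nhds)
  refine ⟨R, u, φ, hu1, hu, hQ, ?_, fun ψ ↦ ?_, hray⟩
  -- Parallelogram law, with `Q (a + b) (a + b)` bounded below by the Rayleigh quotient. Along the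
  -- minimizing sequence the right side tends to `2R + 2R - R ‖2u‖² = 0`.
  · have hpar : ∀ a b, Q (a - b) (a - b) ≤ 2 * Q a a + 2 * Q b b - R * ‖ι a + ι b‖ ^ 2 := by
      intro a b
      have := hray (a + b)
      rw [map_add] at this
      simp only [map_add, map_sub, LinearMap.add_apply, LinearMap.sub_apply] at this ⊢
      rw [hsymm b a] at *
      linarith
    have h1 : Tendsto (fun p : ℕ × ℕ ↦ p.1) atTop atTop := by
      rw [← prod_atTop_atTop_eq]; exact tendsto_fst
    have h2 : Tendsto (fun p : ℕ × ℕ ↦ p.2) atTop atTop := by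
      rw [← prod_atTop_atTop_eq]; exact tendsto_snd
    refine squeeze_zero (fun _ ↦ hnonneg _) (fun p ↦ hpar (φ p.1) (φ p.2)) ?_
    have h3 := (((hQ.comp h1).const_mul 2).add ((hQ.comp h2).const_mul 2)).sub
      ((((hu.comp h1).add (hu.comp h2)).norm.pow 2).const_mul R)
    convert! h3 using 2
    rw [← two_smul ℝ u, norm_smul, hu1]
    norm_num
    ring
  -- Cauchy–Schwarz for the nonnegative form `Q - R ⟨ι ·, ι ·⟩`. Its value on the minimizing
  -- sequence tends to `0`, so its pairing with a fixed `ψ` does too: this is the weak equation.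
  · have hcs : ∀ a b, (Q a b - R * inner ℝ (ι a) (ι b)) ^ 2 ≤
        (Q a a - R * ‖ι a‖ ^ 2) * (Q b b - R * ‖ι b‖ ^ 2) := by
      intro a b
      have hB := LinearMap.BilinForm.apply_mul_apply_le_of_forall_zero_le
        (Q - R • (innerₗ H).compl₁₂ ι ι) (fun x ↦ by
          have := hray x
          rw [← real_inner_self_eq_norm_sq] at this
          simpa using this) a b
      simp only [LinearMap.sub_apply, LinearMap.smul_apply, LinearMap.compl₁₂_apply,
        innerₗ_apply_apply, smul_eq_mul, real_inner_self_eq_norm_sq] at hB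
      rwa [hsymm b a, real_inner_comm (ι a) (ι b), ← pow_two] at hB
    have h0 : Tendsto (fun k ↦ (Q (φ k) ψ - R * inner ℝ (ι (φ k)) (ι ψ)) ^ 2) atTop (𝓝 0) := by
      refine squeeze_zero (fun _ ↦ sq_nonneg _) (fun k ↦ hcs (φ k) ψ) ?_
      have := (hQ.sub ((hu.norm.pow 2).const_mul R)).mul_const (Q ψ ψ - R * ‖ι ψ‖ ^ 2)
      convert! this using 2
      rw [hu1]; ring
    have h1 : Tendsto (fun k ↦ Q (φ k) ψ - R * inner ℝ (ι (φ k)) (ι ψ)) atTop (𝓝 0) := by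
      rw [tendsto_zero_iff_abs_tendsto_zero]
      have := (Real.continuous_sqrt.tendsto 0).comp h0
      simpa [Function.comp_def, Real.sqrt_sq_eq_abs] using this
    have h2 : Tendsto (fun k ↦ R * inner ℝ (ι (φ k)) (ι ψ)) atTop (𝓝 (R * inner ℝ u (ι ψ))) :=
      (hu.inner tendsto_const_nhds).const_mul R
    simpa using h1.add h2

/-- A lower bound of the Rayleigh quotient is a lower bound of the weak eigenvalues. -/
theorem le_of_weak_eigenvector (hsymm : ∀ a b, Q a b = Q b a) {R Λ : ℝ}
    (hray : ∀ ψ, R * ‖ι ψ‖ ^ 2 ≤ Q ψ ψ) {u : H} (hu : u ≠ 0) {φ : ℕ → V}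
    (hφu : Tendsto (fun k ↦ ι (φ k)) atTop (𝓝 u))
    (hφ : Tendsto (fun p : ℕ × ℕ ↦ Q (φ p.1 - φ p.2) (φ p.1 - φ p.2)) atTop (𝓝 0))
    (hweak : ∀ ψ, Tendsto (fun k ↦ Q (φ k) ψ) atTop (𝓝 (Λ * inner ℝ u (ι ψ)))) : R ≤ Λ := by
  -- For late indices `R ‖ι φₖ‖² + R ‖ι φₘ‖² ≤ Q φₖ φₖ + Q φₘ φₘ ≤ 2 Q φₖ φₘ + ε`. The limit in `k`
  -- comes first, with `φₘ` fixed as the vector tested in the weak equation; then `m` tends to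
  -- infinity.
  have key : ∀ ε > 0, 2 * (R * ‖u‖ ^ 2) ≤ 2 * (Λ * ‖u‖ ^ 2) + ε := by
    intro ε hε
    have h1 : ∀ᶠ p : ℕ × ℕ in atTop, Q (φ p.1 - φ p.2) (φ p.1 - φ p.2) ≤ ε :=
      hφ.eventually (eventually_le_nhds hε)
    rw [← prod_atTop_atTop_eq] at h1
    have h2 : ∀ᶠ m in atTop, R * ‖u‖ ^ 2 + R * ‖ι (φ m)‖ ^ 2 ≤
        2 * (Λ * inner ℝ u (ι (φ m))) + ε := by
      have h1' := (Filter.prod_comm (f := (atTop : Filter ℕ)) (g := (atTop : Filter ℕ))) ▸ h1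
      rw [eventually_map] at h1'
      filter_upwards [h1'.curry] with m hm
      refine le_of_tendsto_of_tendsto (((hφu.norm.pow 2).const_mul R).add_const _)
        (((hweak (φ m)).const_mul 2).add_const ε) ?_
      filter_upwards [hm] with k hk
      have ha := hray (φ k)
      have hb := hray (φ m)
      simp only [Prod.swap, map_sub, LinearMap.sub_apply] at hk
      rw [hsymm (φ m) (φ k)] at hk
      linarith
    have h3 := le_of_tendsto_of_tendsto (((hφu.norm.pow 2).const_mul R).const_add (R * ‖u‖ ^ 2))
      ((((tendsto_const_nhds.inner hφu).const_mul Λ).const_mul 2).add_const ε) h2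
    rw [real_inner_self_eq_norm_sq] at h3
    linarith
  have hu' : 0 < ‖u‖ ^ 2 := by have := norm_pos_iff.2 hu; positivity
  have := le_of_forall_pos_le_add key
  by_contra! h
  nlinarith

end Rayleigh


/-! ### The metric in a chart -/

/-- On the unit sphere `q y₀ v < κ * q y₀ v` is strict, so both inequalities persist near each `(y₀,
v)`. Compactness of the sphere makes the neighbourhood of `y₀` uniform in `v`, and homogeneity
extends the bounds to all vectors. -/
theorem exists_le_mul_of_continuousWithinAt {X E : Type*} [PseudoMetricSpace X]
    [NormedAddCommGroup E] [NormedSpace ℝ E] [FiniteDimensional ℝ E] {q : X → E → ℝ} {s : Set X}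
    {y₀ : X} (hy₀ : y₀ ∈ s) (hq : ∀ y (c : ℝ) v, q y (c • v) = c ^ 2 * q y v)
    (hcont : ∀ v, ContinuousWithinAt (fun z : X × E ↦ q z.1 z.2) (s ×ˢ univ) (y₀, v))
    (hpos : ∀ v, v ≠ 0 → 0 < q y₀ v) {κ : ℝ} (hκ : 1 < κ) :
    ∃ r > 0, ∀ y ∈ Metric.ball y₀ r ∩ s, ∀ v, q y v ≤ κ * q y₀ v ∧ q y₀ v ≤ κ * q y v := by
  have h0 : ∀ᶠ y in 𝓝 y₀, ∀ v ∈ Metric.sphere (0 : E) 1,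
      y ∈ s → q y v < κ * q y₀ v ∧ q y₀ v < κ * q y v := by
    refine (isCompact_sphere (0 : E) 1).eventually_forall_of_forall_eventually fun v hv ↦ ?_
    have hv0 : v ≠ 0 := by rintro rfl; simp at hv
    have hc0 : Tendsto (fun z : X × E ↦ q y₀ z.2) (𝓝[s ×ˢ univ] (y₀, v)) (𝓝 (q y₀ v)) := by
      have h1 : Tendsto (fun z : X × E ↦ (y₀, z.2)) (𝓝[s ×ˢ univ] (y₀, v))
          (𝓝[s ×ˢ univ] (y₀, v)) := by
        refine tendsto_nhdsWithin_iff.2 ⟨?_, Eventually.of_forall fun z ↦ by simp [hy₀]⟩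
        have : Continuous fun z : X × E ↦ (y₀, z.2) := by fun_prop
        exact (this.tendsto (y₀, v)).mono_left nhdsWithin_le_nhds
      exact (hcont v).tendsto.comp h1
    have hp := hpos v hv0
    have hlt : q y₀ v < κ * q y₀ v := by nlinarith
    have e1 := (hcont v).tendsto.eventually_lt (hc0.const_mul κ) hlt
    have e2 := hc0.eventually_lt ((hcont v).tendsto.const_mul κ) hlt
    filter_upwards [eventually_nhdsWithin_iff.1 (e1.and e2)] with z hz hzs
    exact hz ⟨hzs, mem_univ _⟩
  obtain ⟨r, hr, h⟩ := Metric.eventually_nhds_iff_ball.1 h0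
  refine ⟨r, hr, fun y hy v ↦ ?_⟩
  by_cases hv : v = 0
  · have hz : ∀ y, q y v = 0 := fun y ↦ by simpa [hv] using hq y 0 0
    simp [hz]
  · have hv' : 0 < ‖v‖ := norm_pos_iff.2 hv
    have h1 := h y hy.1 (‖v‖⁻¹ • v) (by simp [norm_smul, hv'.ne']) hy.2
    rw [hq, hq, mul_left_comm κ, mul_left_comm κ] at h1
    have hc : 0 < ‖v‖⁻¹ ^ 2 := by positivity
    exact ⟨(lt_of_mul_lt_mul_left h1.1 hc.le).le, (lt_of_mul_lt_mul_left h1.2 hc.le).le⟩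

section ChartMetric

variable (n : ℕ) [NeZero n] {M : Type*} [TopologicalSpace M]
  [ChartedSpace (EuclideanHalfSpace n) M]

/-- The derivative of the inverse of the chart at `p`. -/
def chartDeriv (p : M) (y : EuclideanSpace ℝ (Fin n)) :
    EuclideanSpace ℝ (Fin n) →L[ℝ] EuclideanSpace ℝ (Fin n) :=
  mfderivWithin 𝓘(ℝ, EuclideanSpace ℝ (Fin n)) (𝓡∂ n) (extChartAt (𝓡∂ n) p).symm
    (range (𝓡∂ n)) y

variable {n} in
theorem isInvertible_chartDeriv [IsManifold (𝓡∂ n) ∞ M] {p : M} {y : EuclideanSpace ℝ (Fin n)}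
    (hy : y ∈ (extChartAt (𝓡∂ n) p).target) : (chartDeriv n p y).IsInvertible :=
  isInvertible_mfderivWithin_extChartAt_symm hy

/-- The derivative of a function at `x`, as a linear form on the model space. -/
def modelDeriv (φ : M → ℝ) (x : M) : EuclideanSpace ℝ (Fin n) →L[ℝ] ℝ :=
  mfderiv (𝓡∂ n) 𝓘(ℝ, ℝ) φ x

variable {n} in
theorem fderivWithin_comp_extChartAt_symm [IsManifold (𝓡∂ n) ∞ M]
    {φ : M → ℝ} {p : M} {y : EuclideanSpace ℝ (Fin n)}
    (hy : y ∈ (extChartAt (𝓡∂ n) p).target)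
    (hφ : MDifferentiableAt (𝓡∂ n) 𝓘(ℝ, ℝ) φ ((extChartAt (𝓡∂ n) p).symm y))
    (v : EuclideanSpace ℝ (Fin n)) :
    fderivWithin ℝ (φ ∘ (extChartAt (𝓡∂ n) p).symm) (range (𝓡∂ n)) y v =
      modelDeriv n φ ((extChartAt (𝓡∂ n) p).symm y) (chartDeriv n p y v) := by
  rw [← mfderivWithin_eq_fderivWithin,
    mfderiv_comp_mfderivWithin _ hφ (mdifferentiableWithinAt_extChartAt_symm hy)]
  · rfl
  · exact ((𝓡∂ n).uniqueDiffOn y (extChartAt_target_subset_range p hy)).uniqueMDiffWithinAt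

variable {n} in
theorem continuousOn_fderivWithin_comp_extChartAt_symm [IsManifold (𝓡∂ n) ∞ M] {φ : M → ℝ}
    (hφ : ContMDiff (𝓡∂ n) 𝓘(ℝ, ℝ) ∞ φ) (p : M) :
    ContinuousOn (fderivWithin ℝ (φ ∘ (extChartAt (𝓡∂ n) p).symm) (range (𝓡∂ n)))
      (extChartAt (𝓡∂ n) p).target := by
  have h1 : ContDiffOn ℝ 1 (φ ∘ (extChartAt (𝓡∂ n) p).symm) (extChartAt (𝓡∂ n) p).target := by
    rw [← contMDiffOn_iff_contDiffOn]
    exact (hφ.of_le (by simp)).comp_contMDiffOn (contMDiffOn_extChartAt_symm p)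
  refine (h1.continuousOn_fderivWithin (uniqueDiffOn_extChartAt_target p) le_rfl).congr
    fun y hy ↦ ?_
  exact fderivWithin_of_mem_nhdsWithin (extChartAt_target_mem_nhdsWithin_of_mem hy)
    ((𝓡∂ n).uniqueDiffOn y (extChartAt_target_subset_range p hy))
    (h1.differentiableOn one_ne_zero y hy)

variable [RiemannianBundle (fun x : M ↦ TangentSpace (𝓡∂ n) x)]

/-- The inner product on the tangent space at `x`, as a bilinear form on the model space. -/
def metricForm (x : M) :
    EuclideanSpace ℝ (Fin n) →ₗ[ℝ] EuclideanSpace ℝ (Fin n) →ₗ[ℝ] ℝ :=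
  innerₗ (TangentSpace (𝓡∂ n) x)

/-- The metric in the chart at `p`, as a bilinear form depending on the coordinates. -/
def chartMetric (p : M) (y : EuclideanSpace ℝ (Fin n)) :
    EuclideanSpace ℝ (Fin n) →L[ℝ] EuclideanSpace ℝ (Fin n) →L[ℝ] ℝ :=
  LinearMap.toContinuousLinearMap ((LinearMap.toContinuousLinearMap : _ ≃ₗ[ℝ] _).toLinearMap ∘ₗ
    (metricForm n ((extChartAt (𝓡∂ n) p).symm y)).compl₁₂
      (chartDeriv n p y).toLinearMap (chartDeriv n p y).toLinearMap)

variable {n}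

theorem metricForm_eq_inner (x : M) (v w : TangentSpace (𝓡∂ n) x) :
    metricForm n x v w = inner ℝ v w := rfl

theorem metricForm_self_pos (x : M) {v : EuclideanSpace ℝ (Fin n)} (hv : v ≠ 0) :
    0 < metricForm n x v v :=
  real_inner_self_pos (F := TangentSpace (𝓡∂ n) x) |>.2 hv

theorem metricForm_comm (x : M) (v w : EuclideanSpace ℝ (Fin n)) :
    metricForm n x v w = metricForm n x w v :=
  real_inner_comm (F := TangentSpace (𝓡∂ n) x) _ _

theorem chartMetric_apply (p : M) (y v w : EuclideanSpace ℝ (Fin n)) :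
    chartMetric n p y v w = metricForm n ((extChartAt (𝓡∂ n) p).symm y)
      (chartDeriv n p y v) (chartDeriv n p y w) := rfl

theorem metricMatrix_apply (p : M) (y : EuclideanSpace ℝ (Fin n)) (i j : Fin n) :
    metricMatrix n M p y i j = chartMetric n p y (EuclideanSpace.single i 1)
      (EuclideanSpace.single j 1) := rfl

variable (n) in
/-- The Riemannian gradient, as a vector of the model space. -/
def gradientVector (φ : M → ℝ) (x : M) : EuclideanSpace ℝ (Fin n) :=
  riemannianGradient n φ x

theorem metricForm_gradientVector (φ : M → ℝ) (x : M) (v : EuclideanSpace ℝ (Fin n)) :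
    metricForm n x (gradientVector n φ x) v = modelDeriv n φ x v := by
  let : FiniteDimensional ℝ (TangentSpace (𝓡∂ n) x) :=
    inferInstanceAs (FiniteDimensional ℝ (EuclideanSpace ℝ (Fin n)))
  let : CompleteSpace (TangentSpace (𝓡∂ n) x) := FiniteDimensional.complete ℝ _
  exact InnerProductSpace.toDual_symm_apply (𝕜 := ℝ) (E := TangentSpace (𝓡∂ n) x) (x := v)
    (y := modelDeriv n φ x)

variable [IsManifold (𝓡∂ n) ∞ M]

theorem chartMetric_self_pos {p : M} {y v : EuclideanSpace ℝ (Fin n)}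
    (hy : y ∈ (extChartAt (𝓡∂ n) p).target) (hv : v ≠ 0) : 0 < chartMetric n p y v v :=
  metricForm_self_pos _ fun h ↦ hv <|
    (isInvertible_chartDeriv hy).injective (h.trans (map_zero _).symm)

theorem injective_chartMetric {p : M} {y : EuclideanSpace ℝ (Fin n)}
    (hy : y ∈ (extChartAt (𝓡∂ n) p).target) : Function.Injective (chartMetric n p y) := by
  refine (injective_iff_map_eq_zero _).2 fun v hv ↦ by_contra fun hne ↦ ?_
  have := chartMetric_self_pos hy hne
  rw [hv] at this
  exact lt_irrefl _ this

theorem isInvertible_chartMetric {p : M} {y : EuclideanSpace ℝ (Fin n)}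
    (hy : y ∈ (extChartAt (𝓡∂ n) p).target) : (chartMetric n p y).IsInvertible := by
  have hd : Module.finrank ℝ (EuclideanSpace ℝ (Fin n)) =
      Module.finrank ℝ (EuclideanSpace ℝ (Fin n) →L[ℝ] ℝ) := by
    rw [← (LinearMap.toContinuousLinearMap (𝕜 := ℝ) (E := EuclideanSpace ℝ (Fin n))
      (F' := ℝ)).finrank_eq]
    exact Subspace.dual_finrank_eq.symm
  exact ⟨(LinearEquiv.ofInjectiveOfFinrankEq (chartMetric n p y).toLinearMap
    (injective_chartMetric hy) hd).toContinuousLinearEquiv, by ext; rfl⟩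

/-- The coordinate formula `gⁱʲ ∂ᵢφ ∂ⱼψ`. The gradient is defined pointwise by duality; this form
shows that `g(∇φ, ∇ψ)` is continuous. -/
theorem metricForm_gradient_gradient {φ ψ : M → ℝ} {p : M} {y : EuclideanSpace ℝ (Fin n)}
    (hy : y ∈ (extChartAt (𝓡∂ n) p).target)
    (hφ : MDifferentiableAt (𝓡∂ n) 𝓘(ℝ, ℝ) φ ((extChartAt (𝓡∂ n) p).symm y))
    (hψ : MDifferentiableAt (𝓡∂ n) 𝓘(ℝ, ℝ) ψ ((extChartAt (𝓡∂ n) p).symm y)) :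
    metricForm n ((extChartAt (𝓡∂ n) p).symm y)
        (gradientVector n φ ((extChartAt (𝓡∂ n) p).symm y))
        (gradientVector n ψ ((extChartAt (𝓡∂ n) p).symm y)) =
      fderivWithin ℝ (φ ∘ (extChartAt (𝓡∂ n) p).symm) (range (𝓡∂ n)) y
        ((chartMetric n p y).inverse
          (fderivWithin ℝ (ψ ∘ (extChartAt (𝓡∂ n) p).symm) (range (𝓡∂ n)) y)) := by
  set x := (extChartAt (𝓡∂ n) p).symm y with hx
  obtain ⟨w, hw⟩ : ∃ w, chartDeriv n p y w = gradientVector n ψ x :=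
    (isInvertible_chartDeriv hy).surjective _
  have h1 : fderivWithin ℝ (ψ ∘ (extChartAt (𝓡∂ n) p).symm) (range (𝓡∂ n)) y =
      chartMetric n p y w := by
    ext v
    rw [fderivWithin_comp_extChartAt_symm hy hψ, chartMetric_apply, hw, metricForm_gradientVector]
  obtain ⟨e, he⟩ := isInvertible_chartMetric hy
  have h2 : (chartMetric n p y).inverse (chartMetric n p y w) = w := by
    rw [← he, ContinuousLinearMap.inverse_equiv]
    exact e.symm_apply_apply w
  rw [h1, h2, fderivWithin_comp_extChartAt_symm hy hφ, hw, metricForm_gradientVector]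

variable [IsContMDiffRiemannianBundle (𝓡∂ n) ∞ (EuclideanSpace ℝ (Fin n))
      (fun x : M ↦ TangentSpace (𝓡∂ n) x)]

theorem isContinuousRiemannianBundle_tangentSpace :
    IsContinuousRiemannianBundle (EuclideanSpace ℝ (Fin n))
      (fun x : M ↦ TangentSpace (𝓡∂ n) x) := by
  obtain ⟨g, hg, h⟩ := IsContMDiffRiemannianBundle.exists_contMDiff (IB := 𝓡∂ n) (n := ∞)
    (F := EuclideanSpace ℝ (Fin n)) (E := fun x : M ↦ TangentSpace (𝓡∂ n) x)
  exact ⟨g, hg.continuous, h⟩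

/-- The tangent map of the inverse chart makes each coordinate field a continuous map into the
tangent bundle, and the inner product of a continuous Riemannian bundle is continuous along such
maps. -/
theorem continuousOn_chartMetric (p : M) :
    ContinuousOn (chartMetric n p) (extChartAt (𝓡∂ n) p).target := by
  have : IsContinuousRiemannianBundle (EuclideanSpace ℝ (Fin n))
      (fun x : M ↦ TangentSpace (𝓡∂ n) x) := isContinuousRiemannianBundle_tangentSpace
  have hpush : ∀ v : EuclideanSpace ℝ (Fin n), ContinuousOn (fun y : EuclideanSpace ℝ (Fin n) ↦
      (⟨(extChartAt (𝓡∂ n) p).symm y, chartDeriv n p y v⟩ : TangentBundle (𝓡∂ n) M))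
      (extChartAt (𝓡∂ n) p).target := by
    intro v
    have hu : UniqueMDiffOn 𝓘(ℝ, EuclideanSpace ℝ (Fin n)) (extChartAt (𝓡∂ n) p).target :=
      (uniqueDiffOn_extChartAt_target p).uniqueMDiffOn
    have h1 := (contMDiffOn_extChartAt_symm (I := 𝓡∂ n) (n := 1) p).continuousOn_tangentMapWithin
      le_rfl hu
    have h2 : Continuous fun y : EuclideanSpace ℝ (Fin n) ↦
        (⟨y, v⟩ : TangentBundle 𝓘(ℝ, EuclideanSpace ℝ (Fin n)) (EuclideanSpace ℝ (Fin n))) :=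
      (tangentBundleModelSpaceHomeomorph 𝓘(ℝ, EuclideanSpace ℝ (Fin n))).symm.continuous.comp
        (by fun_prop : Continuous fun y : EuclideanSpace ℝ (Fin n) ↦ (y, v))
    refine (h1.comp h2.continuousOn fun y hy ↦ hy).congr fun y hy ↦ ?_
    simp only [tangentMapWithin, Function.comp_apply, chartDeriv]
    -- The tangent map differentiates within the chart target, `chartDeriv` within the whole
    -- half-space; unique differentiability identifies the two.
    rw [(mdifferentiableWithinAt_extChartAt_symm hy).mfderivWithin_mono (hu y hy)
      (extChartAt_target_subset_range p)]
    rfl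
  rw [continuousOn_clm_apply]
  intro v
  rw [continuousOn_clm_apply]
  intro w
  exact (hpush v).inner_bundle (hpush w)

/-- Near a point, the metric in a chart is nearly constant. -/
theorem exists_chartMetric_le_mul {p : M} {y₀ : EuclideanSpace ℝ (Fin n)}
    (hy₀ : y₀ ∈ (extChartAt (𝓡∂ n) p).target) {κ : ℝ} (hκ : 1 < κ) :
    ∃ r > 0, ∀ y ∈ Metric.ball y₀ r ∩ (extChartAt (𝓡∂ n) p).target, ∀ v,
      chartMetric n p y v v ≤ κ * chartMetric n p y₀ v v ∧
      chartMetric n p y₀ v v ≤ κ * chartMetric n p y v v :=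
  exists_le_mul_of_continuousWithinAt (q := fun y v ↦ chartMetric n p y v v) hy₀
    (fun y c v ↦ by simp only [map_smul, _root_.smul_apply, smul_eq_mul]; ring)
    (fun v ↦ by
      have h : ContinuousOn (fun z : EuclideanSpace ℝ (Fin n) × EuclideanSpace ℝ (Fin n) ↦
          chartMetric n p z.1) ((extChartAt (𝓡∂ n) p).target ×ˢ univ) :=
        (continuousOn_chartMetric p).comp continuousOn_fst fun z hz ↦ hz.1
      exact ((h.clm_apply continuousOn_snd).clm_apply continuousOn_snd) (y₀, v) ⟨hy₀, mem_univ _⟩)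
    (fun _ hv ↦ chartMetric_self_pos hy₀ hv) hκ

theorem continuousOn_inverse_chartMetric (p : M) :
    ContinuousOn (fun y ↦ (chartMetric n p y).inverse) (extChartAt (𝓡∂ n) p).target := by
  intro y hy
  obtain ⟨e, he⟩ := isInvertible_chartMetric hy
  have h := (contDiffAt_map_inverse (n := 0) e).continuousAt
  rw [he] at h
  exact h.comp_continuousWithinAt (continuousOn_chartMetric p y hy)

theorem continuous_metricForm_gradientVector {φ ψ : M → ℝ}
    (hφ : ContMDiff (𝓡∂ n) 𝓘(ℝ, ℝ) ∞ φ) (hψ : ContMDiff (𝓡∂ n) 𝓘(ℝ, ℝ) ∞ ψ) :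
    Continuous fun x ↦ metricForm n x (gradientVector n φ x) (gradientVector n ψ x) := by
  refine continuous_iff_continuousAt.2 fun p ↦ ?_
  have h1 : ContinuousOn (fun y ↦
      fderivWithin ℝ (φ ∘ (extChartAt (𝓡∂ n) p).symm) (range (𝓡∂ n)) y
        ((chartMetric n p y).inverse
          (fderivWithin ℝ (ψ ∘ (extChartAt (𝓡∂ n) p).symm) (range (𝓡∂ n)) y)))
      (extChartAt (𝓡∂ n) p).target :=
    (continuousOn_fderivWithin_comp_extChartAt_symm hφ p).clm_apply
      ((continuousOn_inverse_chartMetric p).clm_apply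
        (continuousOn_fderivWithin_comp_extChartAt_symm hψ p))
  have h2 := h1.comp (continuousOn_extChartAt p) (extChartAt (𝓡∂ n) p).mapsTo
  refine (h2.congr fun x hx ↦ ?_).continuousAt (extChartAt_source_mem_nhds p)
  have h3 := metricForm_gradient_gradient ((extChartAt (𝓡∂ n) p).map_source hx)
    (hφ.mdifferentiable (by simp) _) (hψ.mdifferentiable (by simp) _)
  rw [Function.comp_apply, ← h3, (extChartAt (𝓡∂ n) p).left_inv hx]

end ChartMetric


/-! ### The Riemannian volume -/

theorem ContinuousOn.measurableSet_inter_preimage {X Y : Type*} [TopologicalSpace X]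
    [MeasurableSpace X] [BorelSpace X] [TopologicalSpace Y] [MeasurableSpace Y]
    [BorelSpace Y] {f : X → Y} {s : Set X} (hf : ContinuousOn f s) (hs : MeasurableSet s)
    {A : Set Y} (hA : MeasurableSet A) : MeasurableSet (s ∩ f ⁻¹' A) := by
  have h : MeasurableSet (Subtype.val '' (s.domRestrict f ⁻¹' A) : Set X) :=
    MeasurableSet.subtype_image hs (hf.domRestrict.measurable hA)
  convert! h using 1
  ext x
  simp only [mem_inter_iff, mem_preimage, mem_image, Subtype.exists, exists_and_right,
    exists_eq_right, domRestrict_apply, exists_prop]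

section Volume

variable {n : ℕ} [NeZero n] {M : Type*} [TopologicalSpace M]
  [ChartedSpace (EuclideanHalfSpace n) M]

theorem measurableSet_extChartAt_target (p : M) :
    MeasurableSet (extChartAt (𝓡∂ n) p).target := by
  rw [extChartAt_target]
  exact (((chartAt _ p).open_target.preimage (𝓡∂ n).continuous_symm).measurableSet).inter
    (𝓡∂ n).isClosed_range.measurableSet

theorem measurableSet_target_inter_preimage (p : M)
    [MeasurableSpace M] [BorelSpace M] {A : Set M} (hA : MeasurableSet A) :
    MeasurableSet ((extChartAt (𝓡∂ n) p).target ∩ (extChartAt (𝓡∂ n) p).symm ⁻¹' A) :=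
  (continuousOn_extChartAt_symm p).measurableSet_inter_preimage
    (measurableSet_extChartAt_target p) hA

theorem aemeasurable_extChartAt_symm [MeasurableSpace M] [BorelSpace M] (p : M) :
    AEMeasurable (extChartAt (𝓡∂ n) p).symm
      (volume.restrict (extChartAt (𝓡∂ n) p).target) :=
  (continuousOn_extChartAt_symm p).aemeasurable (measurableSet_extChartAt_target p)

variable [RiemannianBundle (fun x : M ↦ TangentSpace (𝓡∂ n) x)]

theorem metricMatrix_eq_toMatrix (p : M) (y : EuclideanSpace ℝ (Fin n)) :
    metricMatrix n M p y = LinearMap.toMatrix₂ (EuclideanSpace.basisFun (Fin n) ℝ).toBasis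
      (EuclideanSpace.basisFun (Fin n) ℝ).toBasis
      ((metricForm n ((extChartAt (𝓡∂ n) p).symm y)).compl₁₂
        (chartDeriv n p y).toLinearMap (chartDeriv n p y).toLinearMap) := by
  ext i j
  rw [metricMatrix_apply, LinearMap.toMatrix₂_apply, chartMetric_apply]
  simp

variable [IsManifold (𝓡∂ n) ∞ M]

theorem det_metricMatrix_pos {p : M} {y : EuclideanSpace ℝ (Fin n)}
    (hy : y ∈ (extChartAt (𝓡∂ n) p).target) : 0 < (metricMatrix n M p y).det := by
  have hli : LinearIndependent ℝ (coordVector n M p y) := by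
    have h := (EuclideanSpace.basisFun (Fin n) ℝ).toBasis.linearIndependent.map'
      (chartDeriv n p y).toLinearMap (LinearMap.ker_eq_bot.2 (isInvertible_chartDeriv hy).injective)
    convert! h using 1
    ext i
    rw [Function.comp_apply, OrthonormalBasis.coe_toBasis, EuclideanSpace.basisFun_apply]
    rfl
  exact (Matrix.posDef_gram_of_linearIndependent hli).det_pos

/-- By the chain rule the Gram matrix transforms as `Lᵀ G L` under the transition map. The square
root of the determinant thus acquires the Jacobian `|det L|`, as a volume density must. -/
theorem metricMatrix_eq_of_mem_source {p q : M} {y : EuclideanSpace ℝ (Fin n)}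
    (hy : y ∈ (extChartAt (𝓡∂ n) p).target)
    (hq : (extChartAt (𝓡∂ n) p).symm y ∈ (extChartAt (𝓡∂ n) q).source) :
    ∃ L : EuclideanSpace ℝ (Fin n) →L[ℝ] EuclideanSpace ℝ (Fin n),
      HasFDerivWithinAt (extChartAt (𝓡∂ n) q ∘ (extChartAt (𝓡∂ n) p).symm) L (range (𝓡∂ n)) y ∧
      (metricMatrix n M p y).det = L.det ^ 2 *
        (metricMatrix n M q (extChartAt (𝓡∂ n) q ((extChartAt (𝓡∂ n) p).symm y))).det := by
  set x := (extChartAt (𝓡∂ n) p).symm y with hx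
  set y' := extChartAt (𝓡∂ n) q x with hy'
  have hyr := extChartAt_target_subset_range p hy
  have hU : UniqueMDiffWithinAt 𝓘(ℝ, EuclideanSpace ℝ (Fin n)) (range (𝓡∂ n)) y :=
    ((𝓡∂ n).uniqueDiffOn y hyr).uniqueMDiffWithinAt
  have hsd : MDifferentiableWithinAt 𝓘(ℝ, EuclideanSpace ℝ (Fin n)) (𝓡∂ n)
      (extChartAt (𝓡∂ n) p).symm (range (𝓡∂ n)) y := mdifferentiableWithinAt_extChartAt_symm hy
  have hqd : MDifferentiableAt (𝓡∂ n) 𝓘(ℝ, EuclideanSpace ℝ (Fin n)) (extChartAt (𝓡∂ n) q) x :=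
    mdifferentiableAt_extChartAt (by rwa [extChartAt_source] at hq)
  have hτ : MDifferentiableWithinAt 𝓘(ℝ, EuclideanSpace ℝ (Fin n))
      𝓘(ℝ, EuclideanSpace ℝ (Fin n)) (extChartAt (𝓡∂ n) q ∘ (extChartAt (𝓡∂ n) p).symm)
      (range (𝓡∂ n)) y := hqd.comp_mdifferentiableWithinAt y hsd
  have hτ' := mdifferentiableWithinAt_iff_differentiableWithinAt.1 hτ
  set L := fderivWithin ℝ (extChartAt (𝓡∂ n) q ∘ (extChartAt (𝓡∂ n) p).symm) (range (𝓡∂ n)) y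
    with hL
  have hy't : y' ∈ (extChartAt (𝓡∂ n) q).target := (extChartAt (𝓡∂ n) q).map_source hq
  have hchain : chartDeriv n p y = (chartDeriv n q y') ∘L L := by
    have h1 : mfderivWithin 𝓘(ℝ, EuclideanSpace ℝ (Fin n)) (𝓡∂ n)
        ((extChartAt (𝓡∂ n) q).symm ∘ (extChartAt (𝓡∂ n) q ∘ (extChartAt (𝓡∂ n) p).symm))
        (range (𝓡∂ n)) y = (chartDeriv n q y') ∘L L := by
      rw [mfderivWithin_comp (u := range (𝓡∂ n)) y
        (mdifferentiableWithinAt_extChartAt_symm hy't) hτ ?_ hU]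
      · rw [mfderivWithin_eq_fderivWithin]; rfl
      · intro z _
        exact mem_range_self _
    have h2 : (extChartAt (𝓡∂ n) q).symm ∘ (extChartAt (𝓡∂ n) q ∘ (extChartAt (𝓡∂ n) p).symm)
        =ᶠ[𝓝[range (𝓡∂ n)] y] (extChartAt (𝓡∂ n) p).symm := by
      have h3 := hsd.continuousWithinAt.preimage_mem_nhdsWithin
        ((isOpen_extChartAt_source (I := 𝓡∂ n) q).mem_nhds hq)
      filter_upwards [h3] with z hz
      exact (extChartAt (𝓡∂ n) q).left_inv hz
    rw [← h1]
    exact (h2.mfderivWithin_eq ((extChartAt (𝓡∂ n) q).left_inv hq)).symm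
  refine ⟨L, hτ'.hasFDerivWithinAt, ?_⟩
  have hxq : (extChartAt (𝓡∂ n) q).symm y' = x := (extChartAt (𝓡∂ n) q).left_inv hq
  have hform : (metricForm n ((extChartAt (𝓡∂ n) p).symm y)).compl₁₂
        (chartDeriv n p y).toLinearMap (chartDeriv n p y).toLinearMap =
      ((metricForm n ((extChartAt (𝓡∂ n) q).symm y')).compl₁₂
        (chartDeriv n q y').toLinearMap (chartDeriv n q y').toLinearMap).compl₁₂
          L.toLinearMap L.toLinearMap := by
    rw [hxq, hchain]
    rfl
  rw [metricMatrix_eq_toMatrix, metricMatrix_eq_toMatrix, hform,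
    LinearMap.toMatrix₂_compl₁₂ (EuclideanSpace.basisFun (Fin n) ℝ).toBasis
      (EuclideanSpace.basisFun (Fin n) ℝ).toBasis, Matrix.det_mul, Matrix.det_mul,
    Matrix.det_transpose, LinearMap.det_toMatrix]
  change _ = (LinearMap.det L.toLinearMap) ^ 2 * _
  ring

variable [IsContMDiffRiemannianBundle (𝓡∂ n) ∞ (EuclideanSpace ℝ (Fin n))
      (fun x : M ↦ TangentSpace (𝓡∂ n) x)]

theorem continuousOn_det_metricMatrix (p : M) :
    ContinuousOn (fun y ↦ (metricMatrix n M p y).det) (extChartAt (𝓡∂ n) p).target := by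
  have h : ContinuousOn (fun y ↦ metricMatrix n M p y) (extChartAt (𝓡∂ n) p).target := by
    refine continuousOn_pi.2 fun i ↦ continuousOn_pi.2 fun j ↦ ?_
    exact ((continuousOn_chartMetric p).clm_apply continuousOn_const).clm_apply continuousOn_const
  exact continuous_id.matrix_det.comp_continuousOn h

variable (n) in
/-- The density of the Riemannian volume in the chart at `p`. -/
def chartDensity (p : M) (y : EuclideanSpace ℝ (Fin n)) : ℝ≥0∞ :=
  ENNReal.ofReal (Real.sqrt (metricMatrix n M p y).det)

theorem continuousOn_chartDensity (p : M) :
    ContinuousOn (chartDensity n p) (extChartAt (𝓡∂ n) p).target :=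
  ENNReal.continuous_ofReal.comp_continuousOn
    (Real.continuous_sqrt.comp_continuousOn (continuousOn_det_metricMatrix p))

theorem aemeasurable_chartDensity (p : M) :
    AEMeasurable (chartDensity n p) (volume.restrict (extChartAt (𝓡∂ n) p).target) :=
  (continuousOn_chartDensity p).aemeasurable (measurableSet_extChartAt_target p)

variable [MeasurableSpace M] [BorelSpace M]

theorem lintegral_chartVolume (p : M) {g : M → ℝ≥0∞} (hg : Measurable g) :
    ∫⁻ x, g x ∂chartVolume n M p = ∫⁻ y in (extChartAt (𝓡∂ n) p).target,
      chartDensity n p y * g ((extChartAt (𝓡∂ n) p).symm y) := by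
  have hs := aemeasurable_extChartAt_symm p (n := n)
  rw [chartVolume, lintegral_map' hg.aemeasurable
    (hs.mono_ac (withDensity_absolutelyContinuous _ _))]
  exact lintegral_withDensity_eq_lintegral_mul₀ (aemeasurable_chartDensity p)
    (hg.comp_aemeasurable hs)

theorem chartVolume_apply (p : M) {A : Set M} (hA : MeasurableSet A) :
    chartVolume n M p A = ∫⁻ y in (extChartAt (𝓡∂ n) p).target ∩ (extChartAt (𝓡∂ n) p).symm ⁻¹' A,
      chartDensity n p y := by
  have hm := measurableSet_target_inter_preimage p hA (n := n)
  rw [← lintegral_indicator_one hA, lintegral_chartVolume p (measurable_one.indicator hA),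
    ← lintegral_indicator (measurableSet_extChartAt_target p), ← lintegral_indicator hm]
  congr 1 with y
  by_cases h1 : y ∈ (extChartAt (𝓡∂ n) p).target
  · by_cases h2 : (extChartAt (𝓡∂ n) p).symm y ∈ A <;> simp only [indicator, mem_inter_iff, h1, h2,
      mem_preimage, if_true, if_false, and_self, and_false, Pi.one_apply, mul_one, mul_zero]
  · simp only [indicator, mem_inter_iff, h1, if_false, false_and]

/-- Change of variables under the transition map; derivatives within the half-space suffice, so
boundary points need no separate treatment. There is only an inequality because `chartVolume n M q`
ignores the part of `A` outside the chart at `q`. -/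
theorem chartVolume_le_of_subset_source (p q : M) {A : Set M} (hA : MeasurableSet A)
    (hAp : A ⊆ (extChartAt (𝓡∂ n) p).source) :
    chartVolume n M q A ≤ chartVolume n M p A := by
  set τ := extChartAt (𝓡∂ n) q ∘ (extChartAt (𝓡∂ n) p).symm with hτ
  set s := (extChartAt (𝓡∂ n) p).target ∩
    (extChartAt (𝓡∂ n) p).symm ⁻¹' (A ∩ (extChartAt (𝓡∂ n) q).source) with hs
  have hsm : MeasurableSet s := measurableSet_target_inter_preimage p
    (hA.inter (isOpen_extChartAt_source q).measurableSet)
  have himage : τ '' s =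
      (extChartAt (𝓡∂ n) q).target ∩ (extChartAt (𝓡∂ n) q).symm ⁻¹' A := by
    ext z
    constructor
    · rintro ⟨y, ⟨hy, hyA, hyq⟩, rfl⟩
      refine ⟨(extChartAt (𝓡∂ n) q).map_source hyq, ?_⟩
      rw [mem_preimage, hτ, Function.comp_apply, (extChartAt (𝓡∂ n) q).left_inv hyq]
      exact hyA
    · rintro ⟨hz, hzA⟩
      have h1 := (extChartAt (𝓡∂ n) p).left_inv (hAp hzA)
      refine ⟨extChartAt (𝓡∂ n) p ((extChartAt (𝓡∂ n) q).symm z),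
        ⟨(extChartAt (𝓡∂ n) p).map_source (hAp hzA), ?_⟩, ?_⟩
      · rw [mem_preimage, h1]
        exact ⟨hzA, (extChartAt (𝓡∂ n) q).map_target hz⟩
      · rw [hτ, Function.comp_apply, h1, (extChartAt (𝓡∂ n) q).right_inv hz]
  have hinj : InjOn τ s := by
    rintro y ⟨hy, hyA, hyq⟩ z ⟨hz, hzA, hzq⟩ h
    exact (extChartAt (𝓡∂ n) p).symm.injOn hy hz ((extChartAt (𝓡∂ n) q).injOn hyq hzq h)
  have hL : ∀ y ∈ s, ∃ L : EuclideanSpace ℝ (Fin n) →L[ℝ] EuclideanSpace ℝ (Fin n),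
      HasFDerivWithinAt τ L s y ∧
      chartDensity n p y = ENNReal.ofReal |L.det| * chartDensity n q (τ y) := by
    rintro y ⟨hy, hyA, hyq⟩
    obtain ⟨L, hL, hdet⟩ := metricMatrix_eq_of_mem_source hy hyq
    refine ⟨L, hL.mono fun z hz ↦ extChartAt_target_subset_range p hz.1, ?_⟩
    rw [chartDensity, hdet, Real.sqrt_mul (sq_nonneg _), Real.sqrt_sq_eq_abs,
      ENNReal.ofReal_mul (abs_nonneg _)]
    rfl
  choose! L hL hdens using hL
  rw [chartVolume_apply q hA, ← himage,
    lintegral_image_eq_lintegral_abs_det_fderiv_mul volume hsm hL hinj,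
    chartVolume_apply p hA, ← setLIntegral_congr_fun hsm hdens]
  exact lintegral_mono_set fun y hy ↦ ⟨hy.1, hy.2.1⟩

/-- A supremum of measures is not computed set by set, so a competitor is used: the chart volume at
`p` on `A` plus the full volume on `Aᶜ` dominates every chart volume, hence also their supremum. -/
theorem restrict_riemannianVolume (p : M) {A : Set M} (hA : MeasurableSet A)
    (hAp : A ⊆ (extChartAt (𝓡∂ n) p).source) :
    (riemannianVolume n M).restrict A = (chartVolume n M p).restrict A := by
  have hle : riemannianVolume n M ≤
      (chartVolume n M p).restrict A + (riemannianVolume n M).restrict Aᶜ := by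
    refine iSup_le fun q ↦ ?_
    refine Measure.le_iff.2 fun B hB ↦ ?_
    rw [Measure.add_apply, Measure.restrict_apply hB, Measure.restrict_apply hB,
      ← measure_inter_add_sdiff B hA]
    refine add_le_add (chartVolume_le_of_subset_source p q (hB.inter hA)
      (inter_subset_right.trans hAp)) ?_
    exact (le_iSup (chartVolume n M) q : _ ≤ riemannianVolume n M) _
  refine le_antisymm ?_ (Measure.restrict_mono le_rfl (le_iSup (chartVolume n M) p))
  refine Measure.le_iff.2 fun B hB ↦ ?_
  rw [Measure.restrict_apply hB, Measure.restrict_apply hB]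
  refine (hle _).trans ?_
  rw [Measure.add_apply, Measure.restrict_apply (hB.inter hA),
    Measure.restrict_apply (hB.inter hA), inter_assoc, inter_assoc, inter_compl_self,
    inter_empty, measure_empty, add_zero, inter_self]

theorem setLIntegral_riemannianVolume (p : M) {A : Set M} (hA : MeasurableSet A)
    (hAp : A ⊆ (extChartAt (𝓡∂ n) p).source) {g : M → ℝ≥0∞} (hg : Measurable g) :
    ∫⁻ x in A, g x ∂riemannianVolume n M =
      ∫⁻ y in (extChartAt (𝓡∂ n) p).target ∩ (extChartAt (𝓡∂ n) p).symm ⁻¹' A,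
        chartDensity n p y * g ((extChartAt (𝓡∂ n) p).symm y) := by
  have hm := measurableSet_target_inter_preimage p hA (n := n)
  rw [restrict_riemannianVolume p hA hAp, ← lintegral_indicator hA,
    lintegral_chartVolume p (hg.indicator hA),
    ← lintegral_indicator (measurableSet_extChartAt_target p), ← lintegral_indicator hm]
  congr 1 with y
  by_cases h1 : y ∈ (extChartAt (𝓡∂ n) p).target
  · by_cases h2 : (extChartAt (𝓡∂ n) p).symm y ∈ A <;> simp only [indicator, mem_inter_iff, h1, h2,
      mem_preimage, if_true, if_false, and_self, and_false, mul_zero]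
  · simp only [indicator, mem_inter_iff, h1, if_false, false_and]

end Volume


/-! ### Functions in a chart, extended by zero -/

section ChartExtend

variable {n : ℕ} [NeZero n] {M : Type*} [TopologicalSpace M]
  [ChartedSpace (EuclideanHalfSpace n) M]

variable (n) in
/-- The coordinate representation of a function in the chart at `p`, extended by zero. -/
def chartExtend (p : M) (φ : M → ℝ) : EuclideanSpace ℝ (Fin n) → ℝ :=
  indicator (extChartAt (𝓡∂ n) p).target (φ ∘ (extChartAt (𝓡∂ n) p).symm)

theorem chartExtend_of_mem {p : M} {y : EuclideanSpace ℝ (Fin n)}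
    (hy : y ∈ (extChartAt (𝓡∂ n) p).target) (φ : M → ℝ) :
    chartExtend n p φ y = φ ((extChartAt (𝓡∂ n) p).symm y) := indicator_of_mem hy _

theorem chartExtend_of_notMem {p : M} {y : EuclideanSpace ℝ (Fin n)}
    (hy : y ∉ (extChartAt (𝓡∂ n) p).target) (φ : M → ℝ) :
    chartExtend n p φ y = 0 := indicator_of_notMem hy _

theorem chartExtend_sub (p : M) (φ ψ : M → ℝ) :
    chartExtend n p (φ - ψ) = chartExtend n p φ - chartExtend n p ψ :=
  indicator_sub _ _ _

theorem measurable_chartExtend (p : M) {φ : M → ℝ} (hφ : Continuous φ) :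
    Measurable (chartExtend n p φ) := by
  classical
  rw [chartExtend, ← piecewise_eq_indicator]
  exact (hφ.comp_continuousOn (continuousOn_extChartAt_symm p)).measurable_piecewise
    continuous_zero.continuousOn (measurableSet_extChartAt_target p)

theorem locallyIntegrable_chartExtend [CompactSpace M] (p : M) {φ : M → ℝ} (hφ : Continuous φ) :
    LocallyIntegrable (chartExtend n p φ) := by
  obtain ⟨b, hb⟩ := (isCompact_range hφ).isBounded.exists_norm_le
  refine (locallyIntegrable_const (max b 0)).mono
    (measurable_chartExtend p hφ).aestronglyMeasurable (ae_of_all _ fun y ↦ ?_)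
  rw [Real.norm_of_nonneg (le_max_right b 0)]
  by_cases hy : y ∈ (extChartAt (𝓡∂ n) p).target
  · rw [chartExtend_of_mem hy]
    exact (hb _ (mem_range_self _)).trans (le_max_left _ _)
  · rw [chartExtend_of_notMem hy, norm_zero]
    exact le_max_right _ _

variable (n) in
/-- The points of the chart domain with coordinates in the ball of radius `r`. -/
def chartBall (p : M) (r : ℝ) : Set M :=
  (extChartAt (𝓡∂ n) p).source ∩ extChartAt (𝓡∂ n) p ⁻¹' Metric.ball (extChartAt (𝓡∂ n) p p) r

theorem isOpen_chartBall (p : M) (r : ℝ) : IsOpen (chartBall n p r) :=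
  (continuousOn_extChartAt p).isOpen_inter_preimage (isOpen_extChartAt_source p)
    Metric.isOpen_ball

theorem mem_chartBall (p : M) {r : ℝ} (hr : 0 < r) : p ∈ chartBall n p r :=
  ⟨mem_extChartAt_source p, Metric.mem_ball_self hr⟩

theorem volume_ball_inter_range_pos {y : EuclideanSpace ℝ (Fin n)} (hy : y ∈ range (𝓡∂ n))
    {s : ℝ} (hs : 0 < s) : 0 < volume (Metric.ball y s ∩ range (𝓡∂ n)) := by
  have h := (𝓡∂ n).convex_range.closure_interior_eq_closure_of_nonempty_interior
    (𝓡∂ n).nonempty_interior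
  have hy' : y ∈ closure (interior (range (𝓡∂ n))) := h ▸ subset_closure hy
  obtain ⟨z, hz⟩ := mem_closure_iff.1 hy' _ Metric.isOpen_ball (Metric.mem_ball_self hs)
  exact ((Metric.isOpen_ball.inter isOpen_interior).measure_pos volume ⟨z, hz⟩).trans_le
    (measure_mono (inter_subset_inter_right _ interior_subset))

/-- At a boundary point every ball sticks out of the half-space. Functions extended by zero vanish
on this part, which starts the Poincaré inequality. -/
theorem volume_ball_sdiff_range_pos {y : EuclideanSpace ℝ (Fin n)}
    (hy : y ∉ interior (range (𝓡∂ n))) {s : ℝ} (hs : 0 < s) :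
    0 < volume (Metric.ball y s \ range (𝓡∂ n)) := by
  have hy' : y ∈ closure (range (𝓡∂ n))ᶜ := by rwa [closure_compl]
  obtain ⟨z, hz⟩ := mem_closure_iff.1 hy' _ Metric.isOpen_ball (Metric.mem_ball_self hs)
  exact (Metric.isOpen_ball.inter (𝓡∂ n).isClosed_range.isOpen_compl).measure_pos volume ⟨z, hz⟩

theorem symm_notMem_interior [IsManifold (𝓡∂ n) ∞ M] {p : M} {y : EuclideanSpace ℝ (Fin n)}
    (hy : y ∈ (extChartAt (𝓡∂ n) p).target) (hyr : y ∉ interior (range (𝓡∂ n))) :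
    (extChartAt (𝓡∂ n) p).symm y ∉ (𝓡∂ n).interior M := by
  intro h
  have hs : (extChartAt (𝓡∂ n) p).symm y ∈ (chartAt (EuclideanHalfSpace n) p).source := by
    rw [← extChartAt_source (𝓡∂ n)]
    exact (extChartAt (𝓡∂ n) p).map_target hy
  have h1 := ((𝓡∂ n).isInteriorPoint_iff_of_mem_atlas (n := ∞) (by simp)
    (chart_mem_atlas _ p) hs).1 h
  have h2 : (extChartAt (𝓡∂ n) p) ((extChartAt (𝓡∂ n) p).symm y) ∈
    interior (extChartAt (𝓡∂ n) p).target := h1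
  rw [(extChartAt (𝓡∂ n) p).right_inv hy] at h2
  exact hyr (interior_mono (extChartAt_target_subset_range p) h2)

/-- A function vanishing near the boundary vanishes near boundary points of a chart. -/
theorem chartExtend_eventuallyEq_zero [IsManifold (𝓡∂ n) ∞ M] {p : M} {φ : M → ℝ}
    (hφ : tsupport φ ⊆ (𝓡∂ n).interior M) {U : Set (EuclideanSpace ℝ (Fin n))}
    (hUt : U ∩ range (𝓡∂ n) ⊆ (extChartAt (𝓡∂ n) p).target) {y : EuclideanSpace ℝ (Fin n)}
    (hyU : y ∈ U) (hy : y ∉ interior (range (𝓡∂ n))) :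
    chartExtend n p φ =ᶠ[𝓝 y] 0 := by
  by_cases hyt : y ∈ (extChartAt (𝓡∂ n) p).target
  · have h1 : (extChartAt (𝓡∂ n) p).symm y ∈ (tsupport φ)ᶜ :=
      fun h ↦ symm_notMem_interior hyt hy (hφ h)
    have h2 := (continuousOn_extChartAt_symm p y hyt).preimage_mem_nhdsWithin
      ((isClosed_tsupport φ).isOpen_compl.mem_nhds h1)
    filter_upwards [mem_nhdsWithin_iff_eventually.1 h2] with z hz
    by_cases hzt : z ∈ (extChartAt (𝓡∂ n) p).target
    · rw [chartExtend_of_mem hzt]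
      exact image_eq_zero_of_notMem_tsupport (hz hzt)
    · exact chartExtend_of_notMem hzt φ
  · have hyr : y ∉ range (𝓡∂ n) := fun h ↦ hyt (hUt ⟨hyU, h⟩)
    filter_upwards [(𝓡∂ n).isClosed_range.isOpen_compl.mem_nhds hyr] with z hz
    exact chartExtend_of_notMem (fun h ↦ hz (extChartAt_target_subset_range p h)) φ

theorem chartExtend_eventuallyEq {p : M} (φ : M → ℝ) {U : Set (EuclideanSpace ℝ (Fin n))}
    (hU : IsOpen U) (hUt : U ∩ range (𝓡∂ n) ⊆ (extChartAt (𝓡∂ n) p).target)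
    {y : EuclideanSpace ℝ (Fin n)} (hyU : y ∈ U) (hy : y ∈ interior (range (𝓡∂ n))) :
    chartExtend n p φ =ᶠ[𝓝 y] φ ∘ (extChartAt (𝓡∂ n) p).symm := by
  filter_upwards [(hU.inter isOpen_interior).mem_nhds ⟨hyU, hy⟩] with z hz
  exact chartExtend_of_mem (hUt ⟨hz.1, interior_subset hz.2⟩) φ

/-- Inside the half-space the extension is the smooth coordinate representation; at all other points
of `U` it vanishes nearby, by the support condition. Estimates on full Euclidean balls thus apply
also at boundary points. -/
theorem IsTestFunction.contDiffOn_chartExtend [IsManifold (𝓡∂ n) ∞ M] {p : M} {φ : M → ℝ}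
    (hφ : IsTestFunction n φ) {U : Set (EuclideanSpace ℝ (Fin n))} (hU : IsOpen U)
    (hUt : U ∩ range (𝓡∂ n) ⊆ (extChartAt (𝓡∂ n) p).target) :
    ContDiffOn ℝ 1 (chartExtend n p φ) U := by
  intro y hyU
  refine ContDiffAt.contDiffWithinAt ?_
  by_cases hy : y ∈ interior (range (𝓡∂ n))
  · refine ContDiffAt.congr_of_eventuallyEq ?_ (chartExtend_eventuallyEq φ hU hUt hyU hy)
    have h1 : ContDiffOn ℝ 1 (φ ∘ (extChartAt (𝓡∂ n) p).symm) (extChartAt (𝓡∂ n) p).target := by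
      rw [← contMDiffOn_iff_contDiffOn]
      exact (hφ.1.of_le (by simp)).comp_contMDiffOn (contMDiffOn_extChartAt_symm p)
    refine h1.contDiffAt (mem_of_superset ((hU.inter isOpen_interior).mem_nhds ⟨hyU, hy⟩) ?_)
    exact fun z hz ↦ hUt ⟨hz.1, interior_subset hz.2⟩
  · exact contDiffAt_const.congr_of_eventuallyEq
      (chartExtend_eventuallyEq_zero hφ.2 hUt hyU hy)

variable [RiemannianBundle (fun x : M ↦ TangentSpace (𝓡∂ n) x)]

variable (n) in
/-- The squared norm of the gradient. -/
def gradientSq (φ : M → ℝ) (x : M) : ℝ :=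
  metricForm n x (gradientVector n φ x) (gradientVector n φ x)

theorem gradientSq_nonneg (φ : M → ℝ) (x : M) : 0 ≤ gradientSq n φ x :=
  real_inner_self_nonneg (F := TangentSpace (𝓡∂ n) x)

theorem modelDeriv_sq_le (φ : M → ℝ) (x : M) (v : EuclideanSpace ℝ (Fin n)) :
    modelDeriv n φ x v ^ 2 ≤ gradientSq n φ x * metricForm n x v v := by
  rw [← metricForm_gradientVector, pow_two]
  exact real_inner_mul_inner_self_le (F := TangentSpace (𝓡∂ n) x) _ _

/-- Cauchy–Schwarz, `dφ(v)² ≤ |∇φ|² g(v, v)`, combined with the comparison of `g` to the Euclidean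
metric. -/
theorem IsTestFunction.enorm_fderiv_chartExtend_sq_le [IsManifold (𝓡∂ n) ∞ M] {p : M} {φ : M → ℝ}
    (hφ : IsTestFunction n φ) {U : Set (EuclideanSpace ℝ (Fin n))} (hU : IsOpen U)
    (hUt : U ∩ range (𝓡∂ n) ⊆ (extChartAt (𝓡∂ n) p).target) {K : NNReal}
    {y : EuclideanSpace ℝ (Fin n)} (hyU : y ∈ U)
    (hK : y ∈ (extChartAt (𝓡∂ n) p).target → ∀ v, chartMetric n p y v v ≤ K * ‖v‖ ^ 2) :
    ‖fderiv ℝ (chartExtend n p φ) y‖ₑ ^ 2 ≤ K * indicator (extChartAt (𝓡∂ n) p).target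
      (fun y ↦ ENNReal.ofReal (gradientSq n φ ((extChartAt (𝓡∂ n) p).symm y))) y := by
  by_cases hy : y ∈ interior (range (𝓡∂ n))
  · have hyt := hUt ⟨hyU, interior_subset hy⟩
    have hnn := gradientSq_nonneg φ ((extChartAt (𝓡∂ n) p).symm y) (n := n)
    have h1 : ‖fderiv ℝ (chartExtend n p φ) y‖ ≤
        Real.sqrt (K * gradientSq n φ ((extChartAt (𝓡∂ n) p).symm y)) := by
      refine ContinuousLinearMap.opNorm_le_bound _ (Real.sqrt_nonneg _) fun v ↦ ?_
      rw [(chartExtend_eventuallyEq φ hU hUt hyU hy).fderiv_eq,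
        ← fderivWithin_of_mem_nhds (mem_interior_iff_mem_nhds.1 hy),
        fderivWithin_comp_extChartAt_symm hyt (hφ.1.mdifferentiable (by simp) _)]
      refine (Real.le_sqrt_of_sq_le
        (y := K * gradientSq n φ ((extChartAt (𝓡∂ n) p).symm y) * ‖v‖ ^ 2) ?_).trans_eq ?_
      · rw [Real.norm_eq_abs, sq_abs]
        refine (modelDeriv_sq_le _ _ _).trans ?_
        have := hK hyt v
        rw [chartMetric_apply] at this
        calc _ ≤ gradientSq n φ ((extChartAt (𝓡∂ n) p).symm y) * (K * ‖v‖ ^ 2) := by gcongr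
          _ = _ := by ring
      · rw [Real.sqrt_mul (by positivity), Real.sqrt_sq (norm_nonneg _)]
    rw [indicator_of_mem hyt, ← ofReal_norm, ← ENNReal.ofReal_pow (norm_nonneg _),
      ← ENNReal.ofReal_coe_nnreal, ← ENNReal.ofReal_mul (by positivity)]
    refine ENNReal.ofReal_le_ofReal ?_
    exact (Real.le_sqrt (norm_nonneg _) (by positivity)).1 h1
  · rw [(chartExtend_eventuallyEq_zero hφ.2 hUt hyU hy).fderiv_eq, fderiv_zero]
    have h0 : ‖(0 : EuclideanSpace ℝ (Fin n) →L[ℝ] ℝ)‖ₑ = 0 := by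
      rw [← ofReal_norm, norm_zero, ENNReal.ofReal_zero]
    rw [Pi.zero_apply, h0]
    simp

variable (n) in
/-- The ball of radius `r` around the image of `p` in the chart at `p` lies in the domain of the
chart, up to the boundary, and the metric is comparable to the Euclidean metric there. -/
structure IsChartBall (p : M) (r : ℝ) (K : NNReal) : Prop where
  pos : 0 < r
  inter_range_subset :
    Metric.ball (extChartAt (𝓡∂ n) p p) r ∩ range (𝓡∂ n) ⊆ (extChartAt (𝓡∂ n) p).target
  chartMetric_le : ∀ y ∈ Metric.ball (extChartAt (𝓡∂ n) p p) r ∩ (extChartAt (𝓡∂ n) p).target,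
    ∀ v, chartMetric n p y v v ≤ K * ‖v‖ ^ 2
  chartDensity_le : ∀ y ∈ Metric.ball (extChartAt (𝓡∂ n) p p) r ∩ (extChartAt (𝓡∂ n) p).target,
    chartDensity n p y ≤ K
  le_chartDensity : ∀ y ∈ Metric.ball (extChartAt (𝓡∂ n) p p) r ∩ (extChartAt (𝓡∂ n) p).target,
    1 ≤ K * chartDensity n p y

theorem IsChartBall.mono {p : M} {r : ℝ} {K : NNReal} (h : IsChartBall n p r K)
    {s : ℝ} (hs : 0 < s) (hsr : s ≤ r) :
    IsChartBall n p s K where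
  pos := hs
  inter_range_subset := (inter_subset_inter_left _ (Metric.ball_subset_ball hsr)).trans
    h.inter_range_subset
  chartMetric_le y hy := h.chartMetric_le y ⟨Metric.ball_subset_ball hsr hy.1, hy.2⟩
  chartDensity_le y hy := h.chartDensity_le y ⟨Metric.ball_subset_ball hsr hy.1, hy.2⟩
  le_chartDensity y hy := h.le_chartDensity y ⟨Metric.ball_subset_ball hsr hy.1, hy.2⟩

variable [IsManifold (𝓡∂ n) ∞ M]
  [IsContMDiffRiemannianBundle (𝓡∂ n) ∞ (EuclideanSpace ℝ (Fin n))
      (fun x : M ↦ TangentSpace (𝓡∂ n) x)]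

theorem exists_isChartBall (p : M) : ∃ r K, IsChartBall n p r K := by
  set y₀ := extChartAt (𝓡∂ n) p p with hy₀
  have hy₀t : y₀ ∈ (extChartAt (𝓡∂ n) p).target := mem_extChartAt_target p
  obtain ⟨r₁, hr₁, h₁⟩ := Metric.mem_nhdsWithin_iff.1 (extChartAt_target_mem_nhdsWithin
    (I := 𝓡∂ n) p)
  obtain ⟨r₂, hr₂, h₂⟩ := exists_chartMetric_le_mul hy₀t one_lt_two
  set d := Real.sqrt (metricMatrix n M p y₀).det with hd
  have hd0 : 0 < d := Real.sqrt_pos.2 (det_metricMatrix_pos hy₀t)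
  have hdc : ContinuousWithinAt (fun y ↦ Real.sqrt (metricMatrix n M p y).det)
      (extChartAt (𝓡∂ n) p).target y₀ :=
    (Real.continuous_sqrt.comp_continuousOn (continuousOn_det_metricMatrix p)) y₀ hy₀t
  obtain ⟨r₃, hr₃, h₃⟩ := Metric.mem_nhdsWithin_iff.1
    (hdc.tendsto.eventually (Ioo_mem_nhds (show d / 2 < d by linarith)
      (show d < 2 * d by linarith)))
  obtain ⟨C, hC⟩ : ∃ C : ℝ, ∀ v, chartMetric n p y₀ v v ≤ C * ‖v‖ ^ 2 := by
    refine ⟨‖chartMetric n p y₀‖, fun v ↦ (le_abs_self _).trans ?_⟩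
    rw [pow_two, ← mul_assoc]
    exact (chartMetric n p y₀).le_opNorm₂ v v
  -- The constant collects three bounds: `2 * C` for the metric, and `2 * d`, `2 / d` for the
  -- density, which stays between `d / 2` and `2 * d`.
  refine ⟨min r₁ (min r₂ r₃), (max (2 * C) (max (2 * d) (2 / d))).toNNReal,
    by positivity, ?_, ?_, ?_, ?_⟩
  · exact fun y hy ↦ h₁ ⟨Metric.ball_subset_ball (min_le_left _ _) hy.1, hy.2⟩
  · intro y hy v
    have hy2 : y ∈ Metric.ball y₀ r₂ := Metric.ball_subset_ball
      ((min_le_right _ _).trans (min_le_left _ _)) hy.1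
    calc chartMetric n p y v v ≤ 2 * chartMetric n p y₀ v v := (h₂ y ⟨hy2, hy.2⟩ v).1
      _ ≤ 2 * (C * ‖v‖ ^ 2) := by gcongr; exact hC v
      _ = (2 * C) * ‖v‖ ^ 2 := by ring
      _ ≤ _ := by
        gcongr
        exact (le_max_left _ _).trans (Real.le_coe_toNNReal _)
  all_goals
    intro y hy
    have hy3 : y ∈ Metric.ball y₀ r₃ := Metric.ball_subset_ball
      ((min_le_right _ _).trans (min_le_right _ _)) hy.1
    have h : Real.sqrt (metricMatrix n M p y).det ∈ Ioo (d / 2) (2 * d) := h₃ ⟨hy3, hy.2⟩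
  · rw [chartDensity, ← ENNReal.ofReal_coe_nnreal]
    refine ENNReal.ofReal_le_ofReal (h.2.le.trans ?_)
    exact (le_max_left _ _).trans ((le_max_right _ _).trans (Real.le_coe_toNNReal _))
  · rw [chartDensity, ← ENNReal.ofReal_coe_nnreal, ← ENNReal.ofReal_mul NNReal.zero_le_coe,
      ← ENNReal.ofReal_one]
    refine ENNReal.ofReal_le_ofReal ?_
    calc (1 : ℝ) = (2 / d) * (d / 2) := by field_simp
      _ ≤ _ := by
        gcongr
        · exact (le_max_right _ _).trans ((le_max_right _ _).trans (Real.le_coe_toNNReal _))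
        · exact h.1.le

namespace IsChartBall

variable [MeasurableSpace M] [BorelSpace M] {p : M} {r : ℝ} {K : NNReal}

theorem setLIntegral_le (h : IsChartBall n p r K) {g : M → ℝ≥0∞} (hg : Measurable g) :
    ∫⁻ x in chartBall n p r, g x ∂riemannianVolume n M ≤
      K * ∫⁻ y in Metric.ball (extChartAt (𝓡∂ n) p p) r ∩ (extChartAt (𝓡∂ n) p).target,
        g ((extChartAt (𝓡∂ n) p).symm y) := by
  have hm := (Metric.isOpen_ball (x := extChartAt (𝓡∂ n) p p) (ε := r)).measurableSet.inter
    (measurableSet_extChartAt_target p)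
  rw [setLIntegral_riemannianVolume p (isOpen_chartBall p r).measurableSet inter_subset_left hg,
    ← lintegral_const_mul' _ _ ENNReal.coe_ne_top]
  refine (lintegral_mono_set (t := Metric.ball (extChartAt (𝓡∂ n) p p) r ∩
    (extChartAt (𝓡∂ n) p).target) fun y hy ↦ ⟨?_, hy.1⟩).trans
    (setLIntegral_mono' hm fun y hy ↦ ?_)
  · have := hy.2.2
    rwa [mem_preimage, (extChartAt (𝓡∂ n) p).right_inv hy.1] at this
  · gcongr
    exact h.chartDensity_le y hy

theorem le_setLIntegral (h : IsChartBall n p r K) {g : M → ℝ≥0∞} (hg : Measurable g) :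
    ∫⁻ y in Metric.ball (extChartAt (𝓡∂ n) p p) r ∩ (extChartAt (𝓡∂ n) p).target,
        g ((extChartAt (𝓡∂ n) p).symm y) ≤
      K * ∫⁻ x in chartBall n p r, g x ∂riemannianVolume n M := by
  have hm := (Metric.isOpen_ball (x := extChartAt (𝓡∂ n) p p) (ε := r)).measurableSet.inter
    (measurableSet_extChartAt_target p)
  rw [setLIntegral_riemannianVolume p (isOpen_chartBall p r).measurableSet inter_subset_left hg,
    ← lintegral_const_mul' _ _ ENNReal.coe_ne_top]
  refine (setLIntegral_mono' (g := fun y ↦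
    K * (chartDensity n p y * g ((extChartAt (𝓡∂ n) p).symm y))) hm fun y hy ↦ ?_).trans
    (lintegral_mono_set fun y hy ↦ ⟨hy.2, (extChartAt (𝓡∂ n) p).map_target hy.2, ?_⟩)
  · rw [← mul_assoc]
    exact le_mul_of_one_le_left zero_le (h.le_chartDensity y hy)
  · rw [mem_preimage, (extChartAt (𝓡∂ n) p).right_inv hy.2]
    exact hy.1

theorem setLIntegral_sq_le (h : IsChartBall n p r K) {φ : M → ℝ} (hφ : Continuous φ) :
    ∫⁻ x in chartBall n p r, ‖φ x‖ₑ ^ 2 ∂riemannianVolume n M ≤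
      K * ∫⁻ y in Metric.ball (extChartAt (𝓡∂ n) p p) r, ‖chartExtend n p φ y‖ₑ ^ 2 := by
  have hm := (Metric.isOpen_ball (x := extChartAt (𝓡∂ n) p p) (ε := r)).measurableSet.inter
    (measurableSet_extChartAt_target p)
  refine (h.setLIntegral_le (hφ.measurable.enorm.pow_const 2)).trans ?_
  gcongr (K : ℝ≥0∞) * ?_
  refine (setLIntegral_mono' (g := fun y ↦ ‖chartExtend n p φ y‖ₑ ^ 2) hm fun y hy ↦ ?_).trans
    (lintegral_mono_set inter_subset_left)
  rw [chartExtend_of_mem hy.2]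

theorem le_setLIntegral_sq (h : IsChartBall n p r K) {φ : M → ℝ} (hφ : Continuous φ)
    {A : Set M} (hA : MeasurableSet A) :
    ∫⁻ y in Metric.ball (extChartAt (𝓡∂ n) p p) r ∩
      ((extChartAt (𝓡∂ n) p).target ∩ (extChartAt (𝓡∂ n) p).symm ⁻¹' A),
        ‖chartExtend n p φ y‖ₑ ^ 2 ≤
      K * ∫⁻ x in A, ‖φ x‖ₑ ^ 2 ∂riemannianVolume n M := by
  have hB := (Metric.isOpen_ball (x := extChartAt (𝓡∂ n) p p) (ε := r)).measurableSet
  have h1 := h.le_setLIntegral (g := indicator A fun x ↦ ‖φ x‖ₑ ^ 2)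
    ((hφ.measurable.enorm.pow_const 2).indicator hA)
  refine le_trans ?_ (h1.trans ?_)
  · rw [← lintegral_indicator (hB.inter (measurableSet_target_inter_preimage p hA)),
      ← lintegral_indicator (hB.inter (measurableSet_extChartAt_target p))]
    refine lintegral_mono fun y ↦ ?_
    by_cases hy : y ∈ Metric.ball (extChartAt (𝓡∂ n) p p) r ∩
      ((extChartAt (𝓡∂ n) p).target ∩ (extChartAt (𝓡∂ n) p).symm ⁻¹' A)
    · rw [indicator_of_mem hy, indicator_of_mem (show y ∈ _ ∩ _ from ⟨hy.1, hy.2.1⟩),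
        indicator_of_mem (mem_preimage.1 hy.2.2), chartExtend_of_mem hy.2.1]
    · rw [indicator_of_notMem hy]
      exact zero_le
  · rw [← lintegral_indicator hA]
    gcongr
    exact Measure.restrict_le_self

theorem le_setLIntegral_fderiv_sq (h : IsChartBall n p r K) {φ : M → ℝ} (hφ : IsTestFunction n φ) :
    ∫⁻ y in Metric.ball (extChartAt (𝓡∂ n) p p) r, ‖fderiv ℝ (chartExtend n p φ) y‖ₑ ^ 2 ≤
      K ^ 2 * ∫⁻ x, ENNReal.ofReal (gradientSq n φ x) ∂riemannianVolume n M := by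
  have hB := (Metric.isOpen_ball (x := extChartAt (𝓡∂ n) p p) (ε := r)).measurableSet
  have hg : Measurable fun x ↦ ENNReal.ofReal (gradientSq n φ x) :=
    (continuous_metricForm_gradientVector hφ.1 hφ.1).measurable.ennreal_ofReal
  calc ∫⁻ y in Metric.ball (extChartAt (𝓡∂ n) p p) r, ‖fderiv ℝ (chartExtend n p φ) y‖ₑ ^ 2
      ≤ ∫⁻ y in Metric.ball (extChartAt (𝓡∂ n) p p) r,
          K * indicator (extChartAt (𝓡∂ n) p).target
            (fun y ↦ ENNReal.ofReal (gradientSq n φ ((extChartAt (𝓡∂ n) p).symm y))) y :=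
        setLIntegral_mono' hB fun y hy ↦ hφ.enorm_fderiv_chartExtend_sq_le Metric.isOpen_ball
          h.inter_range_subset hy fun hyt ↦ h.chartMetric_le y ⟨hy, hyt⟩
    _ = K * ∫⁻ y in Metric.ball (extChartAt (𝓡∂ n) p p) r ∩ (extChartAt (𝓡∂ n) p).target,
          ENNReal.ofReal (gradientSq n φ ((extChartAt (𝓡∂ n) p).symm y)) := by
        rw [lintegral_const_mul' _ _ ENNReal.coe_ne_top,
          setLIntegral_indicator (measurableSet_extChartAt_target p), inter_comm]
    _ ≤ K * (K * ∫⁻ x in chartBall n p r,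
          ENNReal.ofReal (gradientSq n φ x) ∂riemannianVolume n M) := by
        gcongr
        exact h.le_setLIntegral hg
    _ ≤ _ := by
        rw [← mul_assoc, ← pow_two]
        gcongr
        exact Measure.restrict_le_self

end IsChartBall

end ChartExtend


/-! ### The Poincaré inequality and Rellich compactness for test functions -/

section Poincare

variable {n : ℕ} [NeZero n] {M : Type*} [TopologicalSpace M]
  [ChartedSpace (EuclideanHalfSpace n) M]

/-- The coordinates of a neighbourhood of `q` contain a small ball cut with the half-space. This has
positive volume even when `q` is a boundary point, since the half-space is the closure of its
interior. -/
theorem volume_ball_inter_preimage_pos {p q : M} {r : ℝ} (hq : q ∈ chartBall n p r) {U : Set M}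
    (hU : U ∈ 𝓝 q) : 0 < volume (Metric.ball (extChartAt (𝓡∂ n) p p) r ∩
      ((extChartAt (𝓡∂ n) p).target ∩ (extChartAt (𝓡∂ n) p).symm ⁻¹' U)) := by
  have hyt := (extChartAt (𝓡∂ n) p).map_source hq.1
  have h1 : (extChartAt (𝓡∂ n) p).symm ⁻¹' U ∈
      𝓝[(extChartAt (𝓡∂ n) p).target] (extChartAt (𝓡∂ n) p q) :=
    (continuousOn_extChartAt_symm p _ hyt).preimage_mem_nhdsWithin
      (by rwa [(extChartAt (𝓡∂ n) p).left_inv hq.1])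
  rw [nhdsWithin_extChartAt_target_eq_of_mem hyt] at h1
  have h2 := inter_mem (extChartAt_target_mem_nhdsWithin_of_mem hyt) h1
  have h3 := inter_mem (mem_nhdsWithin_of_mem_nhds (Metric.isOpen_ball.mem_nhds hq.2)) h2
  obtain ⟨s, hs, h4⟩ := Metric.mem_nhdsWithin_iff.1 h3
  exact (volume_ball_inter_range_pos (extChartAt_target_subset_range p hyt) hs).trans_le
    (measure_mono h4)

variable [RiemannianBundle (fun x : M ↦ TangentSpace (𝓡∂ n) x)]
  [MeasurableSpace M]

variable (n) in
/-- The Dirichlet energy `∫ |∇φ|² dv_g`. -/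
def energy (φ : M → ℝ) : ℝ≥0∞ :=
  ∫⁻ x, ENNReal.ofReal (gradientSq n φ x) ∂riemannianVolume n M

variable [IsManifold (𝓡∂ n) ∞ M]
  [IsContMDiffRiemannianBundle (𝓡∂ n) ∞ (EuclideanSpace ℝ (Fin n))
      (fun x : M ↦ TangentSpace (𝓡∂ n) x)] [BorelSpace M]

theorem riemannianVolume_pos_of_isOpen {U : Set M} (hU : IsOpen U) (hne : U.Nonempty) :
    0 < riemannianVolume n M U := by
  obtain ⟨p, hp⟩ := hne
  obtain ⟨r, K, h⟩ := exists_isChartBall (n := n) p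
  have h1 := h.le_setLIntegral (g := indicator U 1) (measurable_one.indicator hU.measurableSet)
  rw [lintegral_indicator_one hU.measurableSet] at h1
  have h2 : volume (Metric.ball (extChartAt (𝓡∂ n) p p) r ∩
      ((extChartAt (𝓡∂ n) p).target ∩ (extChartAt (𝓡∂ n) p).symm ⁻¹' U)) ≤
      ∫⁻ y in Metric.ball (extChartAt (𝓡∂ n) p p) r ∩ (extChartAt (𝓡∂ n) p).target,
        indicator U 1 ((extChartAt (𝓡∂ n) p).symm y) := by
    have hB := (Metric.isOpen_ball (x := extChartAt (𝓡∂ n) p p) (ε := r)).measurableSet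
    rw [← lintegral_indicator_one
      (hB.inter (measurableSet_target_inter_preimage p hU.measurableSet)),
      ← lintegral_indicator (hB.inter (measurableSet_extChartAt_target p))]
    refine lintegral_mono fun y ↦ ?_
    by_cases hy : y ∈ Metric.ball (extChartAt (𝓡∂ n) p p) r ∩
      ((extChartAt (𝓡∂ n) p).target ∩ (extChartAt (𝓡∂ n) p).symm ⁻¹' U)
    · rw [indicator_of_mem hy, indicator_of_mem (show y ∈ _ ∩ _ from ⟨hy.1, hy.2.1⟩),
        indicator_of_mem (mem_preimage.1 hy.2.2), Pi.one_apply, Pi.one_apply]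
    · rw [indicator_of_notMem hy]
      exact zero_le
  have h3 := (volume_ball_inter_preimage_pos (n := n) (mem_chartBall p h.pos)
    (hU.mem_nhds hp)).trans_le (h2.trans h1)
  have h4 := (CanonicallyOrderedAdd.mul_pos.1 h3).2
  exact h4.trans_le (Measure.restrict_apply_le _ _)

theorem isFiniteMeasure_riemannianVolume [CompactSpace M] :
    IsFiniteMeasure (riemannianVolume n M) := by
  have : IsLocallyFiniteMeasure (riemannianVolume n M) := by
    refine ⟨fun p ↦ ?_⟩
    obtain ⟨r, K, h⟩ := exists_isChartBall (n := n) p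
    refine ⟨chartBall n p r, (isOpen_chartBall p r).mem_nhds (mem_chartBall p h.pos), ?_⟩
    have h1 := h.setLIntegral_le (g := 1) measurable_one
    simp only [Pi.one_apply, lintegral_one, Measure.restrict_apply_univ] at h1
    refine h1.trans_lt (ENNReal.mul_lt_top ENNReal.coe_lt_top ?_)
    exact (measure_mono inter_subset_left).trans_lt measure_ball_lt_top
  infer_instance

/-- A Poincaré inequality near `p` follows from one on a subset of a chart ball at `p`. -/
theorem exists_local_poincare {p : M} {r : ℝ} {K : NNReal} (hr : 0 < r)
    (h : IsChartBall n p (3 * r) K)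
    {W : Set (EuclideanSpace ℝ (Fin n))} (hWr : W ⊆ Metric.ball (extChartAt (𝓡∂ n) p p) r)
    (hW0 : 0 < volume W) {C : NNReal}
    (hC : ∀ φ : M → ℝ, IsTestFunction n φ →
      ∫⁻ y in W, ‖chartExtend n p φ y‖ₑ ^ 2 ≤ C * energy n φ) :
    ∃ C' : NNReal, ∀ φ : M → ℝ, IsTestFunction n φ →
      ∫⁻ x in chartBall n p r, ‖φ x‖ₑ ^ 2 ∂riemannianVolume n M ≤ C' * energy n φ := by
  set B := Metric.ball (extChartAt (𝓡∂ n) p p) r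
  set D : ℝ≥0∞ := K * ((volume W)⁻¹ * (2 * volume B * C +
    2 * (volume (Metric.ball (0 : EuclideanSpace ℝ (Fin n)) (2 * r)) *
      ENNReal.ofReal (2 * r) ^ 2 * K ^ 2))) with hD
  have hWt : volume W ≠ ⊤ := ((measure_mono hWr).trans_lt measure_ball_lt_top).ne
  have hDt : D ≠ ⊤ := by
    have h1 : volume B ≠ ⊤ := measure_ball_lt_top.ne
    have h2 : volume (Metric.ball (0 : EuclideanSpace ℝ (Fin n)) (2 * r)) ≠ ⊤ :=
      measure_ball_lt_top.ne
    have h3 : (volume W)⁻¹ ≠ ⊤ := ENNReal.inv_ne_top.2 hW0.ne'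
    finiteness
  refine ⟨D.toNNReal, fun φ hφ ↦ ?_⟩
  rw [ENNReal.coe_toNNReal hDt]
  have hfm := measurable_chartExtend (n := n) p hφ.1.continuous
  have h1 := measure_mul_lintegral_ball_sq_le volume hfm hWr
  have h2 := lintegral_ball_sub_sq_le volume hfm
    (hφ.contDiffOn_chartExtend Metric.isOpen_ball h.inter_range_subset)
  have h3 := h.le_setLIntegral_fderiv_sq hφ
  have h4 : ∫⁻ y in B, ‖chartExtend n p φ y‖ₑ ^ 2 ≤ (volume W)⁻¹ *
      (2 * volume B * (C * energy n φ) +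
        2 * (volume (Metric.ball (0 : EuclideanSpace ℝ (Fin n)) (2 * r)) *
      ENNReal.ofReal (2 * r) ^ 2 * (K ^ 2 * energy n φ))) := by
    refine (ENNReal.mul_le_iff_le_inv hW0.ne' hWt).1 (h1.trans ?_)
    refine add_le_add (mul_le_mul_right (hC φ hφ) _) (mul_le_mul_right (h2.trans ?_) _)
    exact mul_le_mul_right h3 _
  refine ((h.mono hr (by linarith)).setLIntegral_sq_le hφ.1.continuous).trans ?_
  refine (mul_le_mul_right h4 _).trans_eq ?_
  rw [hD]
  ring

/-- The points near which the inequality holds form an open set. The set is closed, because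
`exists_local_poincare` carries the inequality from a small open set to a whole chart ball; it
contains the boundary points, so by connectedness it is everything. Finitely many neighbourhoods
cover `M`, and their constants add up. -/
theorem exists_poincare [CompactSpace M] [PreconnectedSpace M]
    (hM : ((𝓡∂ n).boundary M).Nonempty) :
    ∃ C : NNReal, ∀ φ : M → ℝ, IsTestFunction n φ →
      ∫⁻ x, ‖φ x‖ₑ ^ 2 ∂riemannianVolume n M ≤ C * energy n φ := by
  set P : Set M → Prop := fun U ↦ ∃ C : NNReal, ∀ φ : M → ℝ, IsTestFunction n φ →
      ∫⁻ x in U, ‖φ x‖ₑ ^ 2 ∂riemannianVolume n M ≤ C * energy n φ with hP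
  have hmono : ∀ U V : Set M, U ⊆ V → P V → P U := fun U V hUV ⟨C, hC⟩ ↦
    ⟨C, fun φ hφ ↦ (lintegral_mono_set hUV).trans (hC φ hφ)⟩
  set G : Set M := {p | ∃ U ∈ 𝓝 p, P U} with hG
  have hball : ∀ p : M, ∃ r K, 0 < r ∧ IsChartBall n p (3 * r) K := fun p ↦ by
    obtain ⟨r, K, h⟩ := exists_isChartBall (n := n) p
    exact ⟨r / 3, K, by have := h.pos; positivity, by rwa [mul_div_cancel₀ _ three_ne_zero]⟩
  have hGopen : IsOpen G := by
    refine isOpen_iff_mem_nhds.2 fun p ⟨U, hU, hPU⟩ ↦ ?_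
    filter_upwards [eventually_mem_nhds_iff.2 hU] with q hq
    exact ⟨U, hq, hPU⟩
  have hGclosed : IsClosed G := by
    refine isClosed_of_closure_subset fun p hp ↦ ?_
    obtain ⟨r, K, hr, h⟩ := hball p
    have hUp := (isOpen_chartBall (n := n) p r).mem_nhds (mem_chartBall p hr)
    obtain ⟨q, hq, V, hV, hPV⟩ := mem_closure_iff_nhds.1 hp _ hUp
    obtain ⟨V', hV'V, hV'o, hqV'⟩ := mem_nhds_iff.1 hV
    obtain ⟨C, hC⟩ := hmono _ _ hV'V hPV
    refine ⟨_, hUp, exists_local_poincare hr h inter_subset_left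
      (volume_ball_inter_preimage_pos hq (hV'o.mem_nhds hqV')) (C := K * C) fun φ hφ ↦ ?_⟩
    refine ((h.mono hr (by linarith)).le_setLIntegral_sq hφ.1.continuous
      hV'o.measurableSet).trans ?_
    rw [ENNReal.coe_mul, mul_assoc]
    gcongr
    exact hC φ hφ
  have hGne : G.Nonempty := by
    obtain ⟨p, hp⟩ := hM
    obtain ⟨r, K, hr, h⟩ := hball p
    -- At a boundary point take `W` to be the part of the ball outside the half-space. The extension
    -- is zero there, so the inequality on `W` holds with constant `0`.
    have hp' : extChartAt (𝓡∂ n) p p ∉ interior (range (𝓡∂ n)) := fun hi ↦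
      ((𝓡∂ n).isInteriorPoint_iff_not_isBoundaryPoint p).1 hi hp
    refine ⟨p, _, (isOpen_chartBall (n := n) p r).mem_nhds (mem_chartBall p hr),
      exists_local_poincare hr h sdiff_subset (volume_ball_sdiff_range_pos hp' hr) (C := 0)
      fun φ hφ ↦ ?_⟩
    rw [setLIntegral_congr_fun (g := 0) (Metric.isOpen_ball.measurableSet.diff
      (𝓡∂ n).isClosed_range.measurableSet)]
    · simp
    · intro y hy
      simp only [chartExtend_of_notMem (fun hyt ↦ hy.2 (extChartAt_target_subset_range p hyt)) φ,
        enorm_zero, Pi.zero_apply]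
      simp
  have hGuniv : G = univ := IsClopen.eq_univ ⟨hGclosed, hGopen⟩ hGne
  have hfinal : P univ := by
    refine isCompact_univ.induction_on (p := P) ⟨0, fun φ _ ↦ by simp⟩ (fun U V hUV ↦ hmono U V hUV)
      ?_ ?_
    · rintro U V ⟨C, hC⟩ ⟨C', hC'⟩
      refine ⟨C + C', fun φ hφ ↦ (lintegral_union_le _ _ _).trans ?_⟩
      rw [ENNReal.coe_add, add_mul]
      exact add_le_add (hC φ hφ) (hC' φ hφ)
    · intro p _
      have hp : p ∈ G := hGuniv ▸ mem_univ p
      rw [nhdsWithin_univ]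
      exact hp
  obtain ⟨C, hC⟩ := hfinal
  exact ⟨C, fun φ hφ ↦ by simpa using hC φ hφ⟩

/-- The functionals are the averages of the chart representation over the balls of a finite
`δ`-cover. The energy term of `lintegral_ball_sq_le_sum_average` carries the factor `δ ^ 2`, so a
fine cover makes it small. -/
theorem exists_local_sq_le_energy_add_sum [CompactSpace M] {p : M} {r : ℝ} {K : NNReal}
    (hr : 0 < r) (h : IsChartBall n p (3 * r) K) {ε : NNReal} (hε : 0 < ε) :
    ∃ (ι : Type) (_ : Fintype ι) (ℓ : ι → (M → ℝ) → ℝ) (C : NNReal),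
      (∀ i φ, IsTestFunction n φ →
        ‖ℓ i φ‖ₑ ^ 2 ≤ C * ∫⁻ x, ‖φ x‖ₑ ^ 2 ∂riemannianVolume n M) ∧
      (∀ i φ ψ, IsTestFunction n φ → IsTestFunction n ψ → ℓ i (φ - ψ) = ℓ i φ - ℓ i ψ) ∧
      ∀ φ : M → ℝ, IsTestFunction n φ →
        ∫⁻ x in chartBall n p r, ‖φ x‖ₑ ^ 2 ∂riemannianVolume n M ≤
          ε * energy n φ + C * ∑ i, ‖ℓ i φ‖ₑ ^ 2 := by
  set E := EuclideanSpace ℝ (Fin n) with hE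
  set y₀ := extChartAt (𝓡∂ n) p p with hy₀
  -- The energy coefficient will be `A * δ ^ 2`: one factor `K` from comparing `L²` norms and `K ^
  -- 2` from comparing energies. The choice of `δ` makes it at most `ε`.
  set A : ℝ := K * 8 * 2 ^ Module.finrank ℝ E * K ^ 2 with hA
  have hA0 : 0 ≤ A := by positivity
  set δ : ℝ := min r (Real.sqrt (ε / (A + 1))) with hδ
  have hδ0 : 0 < δ := lt_min hr (Real.sqrt_pos.2 (by positivity))
  have hδr : δ ≤ r := min_le_left _ _
  have hAδ : A * δ ^ 2 ≤ ε := by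
    have h1 : δ ^ 2 ≤ ε / (A + 1) := by
      rw [← Real.sq_sqrt (show (0 : ℝ) ≤ ε / (A + 1) by positivity)]
      gcongr
      exact min_le_right _ _
    calc A * δ ^ 2 ≤ (A + 1) * (ε / (A + 1)) := by gcongr; linarith
      _ = ε := by field_simp
  obtain ⟨t, htB, htf, hcov⟩ := Metric.finite_approx_of_totallyBounded
    ((isCompact_closedBall y₀ r).totallyBounded.subset Metric.ball_subset_closedBall) δ hδ0
  set V := volume (Metric.ball (0 : E) δ) with hV
  have hV0 : V ≠ 0 := (Metric.measure_ball_pos volume _ hδ0).ne'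
  have hVt : V ≠ ⊤ := measure_ball_lt_top.ne
  have hVc : ∀ c : E, volume (Metric.ball c δ) = V := fun c ↦ Measure.addHaar_ball_center _ c δ
  have hBt : volume (Metric.ball y₀ r) ≠ ⊤ := measure_ball_lt_top.ne
  -- One constant for two purposes: the first summand multiplies the averages in the estimate, the
  -- second bounds each average by the `L²` norm.
  set C : ℝ≥0∞ := K * (2 * volume (Metric.ball y₀ r)) + V⁻¹ * K with hC
  have hCt : C ≠ ⊤ := by
    have : V⁻¹ ≠ ⊤ := ENNReal.inv_ne_top.2 hV0
    finiteness
  have hsub : ∀ c ∈ htf.toFinset, Metric.ball c δ ⊆ Metric.ball y₀ (3 * r) := fun c hc ↦ by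
    have := Metric.mem_ball.1 (htB (htf.mem_toFinset.1 hc))
    exact Metric.ball_subset_ball' (by linarith)
  have hint : ∀ φ : M → ℝ, IsTestFunction n φ →
      IntegrableOn (chartExtend n p φ) (Metric.ball y₀ (3 * r)) := fun φ hφ ↦
    ((locallyIntegrable_chartExtend p hφ.1.continuous).integrableOn_isCompact
      (isCompact_closedBall _ _)).mono_set Metric.ball_subset_closedBall
  -- the functionals are indexed by a type in the lowest universe
  let e := htf.toFinset.equivFin
  refine ⟨Fin htf.toFinset.card, inferInstance,
    fun i φ ↦ ⨍ y in Metric.ball (e.symm i : E) δ, chartExtend n p φ y, C.toNNReal, ?_, ?_, ?_⟩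
  · intro i φ hφ
    have hi := (e.symm i).2
    have hfm := measurable_chartExtend (n := n) p hφ.1.continuous
    refine (enorm_setAverage_sq_le volume (by rwa [hVc]) (by rwa [hVc]) hfm.aemeasurable).trans ?_
    have h1 := h.le_setLIntegral_sq hφ.1.continuous MeasurableSet.univ
    rw [Measure.restrict_univ, preimage_univ, inter_univ] at h1
    have h2 : ∫⁻ y in Metric.ball (e.symm i : E) δ, ‖chartExtend n p φ y‖ₑ ^ 2 ≤
        ∫⁻ y in Metric.ball y₀ (3 * r) ∩ (extChartAt (𝓡∂ n) p).target,
          ‖chartExtend n p φ y‖ₑ ^ 2 := by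
      rw [inter_comm, ← setLIntegral_indicator (measurableSet_extChartAt_target p)]
      refine (lintegral_mono_set (hsub _ hi)).trans (lintegral_mono fun y ↦ ?_)
      by_cases hy : y ∈ (extChartAt (𝓡∂ n) p).target
      · rw [indicator_of_mem hy]
      · rw [chartExtend_of_notMem hy, enorm_zero]
        simp
    rw [hVc, ENNReal.coe_toNNReal hCt]
    calc V⁻¹ * ∫⁻ y in Metric.ball (e.symm i : E) δ, ‖chartExtend n p φ y‖ₑ ^ 2
        ≤ V⁻¹ * (K * ∫⁻ x, ‖φ x‖ₑ ^ 2 ∂riemannianVolume n M) :=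
          mul_le_mul_right (h2.trans h1) _
      _ ≤ C * ∫⁻ x, ‖φ x‖ₑ ^ 2 ∂riemannianVolume n M := by
          rw [← mul_assoc]
          exact mul_le_mul_left le_add_self _
  · intro i φ ψ hφ hψ
    have hi := (e.symm i).2
    simp only [chartExtend_sub, Pi.sub_apply, setAverage_eq]
    rw [integral_sub ((hint φ hφ).mono_set (hsub _ hi)) ((hint ψ hψ).mono_set (hsub _ hi)),
      smul_sub]
  · intro φ hφ
    have hfm := measurable_chartExtend (n := n) p hφ.1.continuous
    have h1 := lintegral_ball_sq_le_sum_average volume hfm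
      (hφ.contDiffOn_chartExtend Metric.isOpen_ball h.inter_range_subset) (hint φ hφ) hδ0 hδr
      htf.toFinset (fun c hc ↦ htB (htf.mem_toFinset.1 hc))
      (by simpa only [htf.mem_toFinset] using hcov)
    have h2 := h.le_setLIntegral_fderiv_sq hφ
    have h3 := (h.mono hr (by linarith)).setLIntegral_sq_le hφ.1.continuous
    have hsum : ∑ c ∈ htf.toFinset, ‖⨍ y in Metric.ball c δ, chartExtend n p φ y‖ₑ ^ 2 =
        ∑ i, ‖⨍ y in Metric.ball (e.symm i : E) δ, chartExtend n p φ y‖ₑ ^ 2 := by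
      rw [← Finset.sum_coe_sort]
      exact (Equiv.sum_comp e.symm (fun c : htf.toFinset ↦
        ‖⨍ y in Metric.ball (c : E) δ, chartExtend n p φ y‖ₑ ^ 2)).symm
    rw [hsum] at h1
    set S := ∑ i, ‖⨍ y in Metric.ball (e.symm i : E) δ, chartExtend n p φ y‖ₑ ^ 2
    have hKA : (K : ℝ≥0∞) * (ENNReal.ofReal (8 * 2 ^ Module.finrank ℝ E * δ ^ 2) * K ^ 2) ≤ ε := by
      have hK : (K : ℝ≥0∞) = ENNReal.ofReal K := (ENNReal.ofReal_coe_nnreal).symm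
      have hε' : (ε : ℝ≥0∞) = ENNReal.ofReal ε := (ENNReal.ofReal_coe_nnreal).symm
      rw [hK, hε', ← ENNReal.ofReal_pow (by positivity), ← ENNReal.ofReal_mul (by positivity),
        ← ENNReal.ofReal_mul (by positivity)]
      refine ENNReal.ofReal_le_ofReal (le_of_eq_of_le ?_ hAδ)
      rw [hA]
      ring
    rw [ENNReal.coe_toNNReal hCt]
    calc _ ≤ (K : ℝ≥0∞) * (2 * volume (Metric.ball y₀ r) * S +
          ENNReal.ofReal (8 * 2 ^ Module.finrank ℝ E * δ ^ 2) * (K ^ 2 * energy n φ)) :=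
        h3.trans (mul_le_mul_right (h1.trans (add_le_add le_rfl (mul_le_mul_right h2 _))) _)
      _ = K * (ENNReal.ofReal (8 * 2 ^ Module.finrank ℝ E * δ ^ 2) * K ^ 2) * energy n φ +
          K * (2 * volume (Metric.ball y₀ r)) * S := by ring
      _ ≤ _ := add_le_add (mul_le_mul_left hKA _) (mul_le_mul_left le_self_add _)

/-- The `L²` norm of test functions is controlled by finitely many bounded additive functionals
and a small multiple of the energy. -/
theorem exists_sq_le_energy_add_sum [CompactSpace M] {ε : NNReal} (hε : 0 < ε) :
    ∃ (ι : Type) (_ : Fintype ι) (ℓ : ι → (M → ℝ) → ℝ) (C : NNReal),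
      (∀ i φ, IsTestFunction n φ →
        ‖ℓ i φ‖ₑ ^ 2 ≤ C * ∫⁻ x, ‖φ x‖ₑ ^ 2 ∂riemannianVolume n M) ∧
      (∀ i φ ψ, IsTestFunction n φ → IsTestFunction n ψ → ℓ i (φ - ψ) = ℓ i φ - ℓ i ψ) ∧
      ∀ φ : M → ℝ, IsTestFunction n φ → ∫⁻ x, ‖φ x‖ₑ ^ 2 ∂riemannianVolume n M ≤
        ε * energy n φ + C * ∑ i, ‖ℓ i φ‖ₑ ^ 2 := by
  -- The induction over compact sets carries all `ε` at once, because a union spends `ε / 2` on each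
  -- of its two sets.
  suffices H : ∀ ε : NNReal, 0 < ε →
      ∃ (ι : Type) (_ : Fintype ι) (ℓ : ι → (M → ℝ) → ℝ) (C : NNReal),
      (∀ i φ, IsTestFunction n φ →
        ‖ℓ i φ‖ₑ ^ 2 ≤ C * ∫⁻ x, ‖φ x‖ₑ ^ 2 ∂riemannianVolume n M) ∧
      (∀ i φ ψ, IsTestFunction n φ → IsTestFunction n ψ → ℓ i (φ - ψ) = ℓ i φ - ℓ i ψ) ∧
      ∀ φ : M → ℝ, IsTestFunction n φ → ∫⁻ x in univ, ‖φ x‖ₑ ^ 2 ∂riemannianVolume n M ≤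
        ε * energy n φ + C * ∑ i, ‖ℓ i φ‖ₑ ^ 2 by
    simpa only [Measure.restrict_univ] using H ε hε
  refine isCompact_univ.induction_on (p := fun S : Set M ↦ ∀ ε : NNReal, 0 < ε →
      ∃ (ι : Type) (_ : Fintype ι) (ℓ : ι → (M → ℝ) → ℝ) (C : NNReal),
      (∀ i φ, IsTestFunction n φ →
        ‖ℓ i φ‖ₑ ^ 2 ≤ C * ∫⁻ x, ‖φ x‖ₑ ^ 2 ∂riemannianVolume n M) ∧
      (∀ i φ ψ, IsTestFunction n φ → IsTestFunction n ψ → ℓ i (φ - ψ) = ℓ i φ - ℓ i ψ) ∧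
      ∀ φ : M → ℝ, IsTestFunction n φ → ∫⁻ x in S, ‖φ x‖ₑ ^ 2 ∂riemannianVolume n M ≤
        ε * energy n φ + C * ∑ i, ‖ℓ i φ‖ₑ ^ 2) ?_ ?_ ?_ ?_
  · exact fun ε _ ↦ ⟨Empty, inferInstance, fun i ↦ i.elim, 0, fun i ↦ i.elim, fun i ↦ i.elim,
      fun φ _ ↦ by simp⟩
  · intro S T hST hT ε hε
    obtain ⟨ι, hι, ℓ, C, h1, h2, h3⟩ := hT ε hε
    exact ⟨ι, hι, ℓ, C, h1, h2, fun φ hφ ↦ (lintegral_mono_set hST).trans (h3 φ hφ)⟩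
  · intro S T hS hT ε hε
    obtain ⟨ι, hι, ℓ, C, h1, h2, h3⟩ := hS (ε / 2) (half_pos hε)
    obtain ⟨ι', hι', ℓ', C', h1', h2', h3'⟩ := hT (ε / 2) (half_pos hε)
    refine ⟨ι ⊕ ι', inferInstance, Sum.elim ℓ ℓ', C + C', ?_, ?_, fun φ hφ ↦ ?_⟩
    · rintro (i | i) φ hφ
      · exact (h1 i φ hφ).trans (mul_le_mul_left (by simp) _)
      · exact (h1' i φ hφ).trans (mul_le_mul_left (by simp) _)
    · rintro (i | i) φ ψ hφ hψ
      · exact h2 i φ ψ hφ hψ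
      · exact h2' i φ ψ hφ hψ
    · refine (lintegral_union_le _ _ _).trans ((add_le_add (h3 φ hφ) (h3' φ hφ)).trans ?_)
      have hε2 : (ε : ℝ≥0∞) = (ε / 2 : NNReal) + (ε / 2 : NNReal) := by
        rw [← ENNReal.coe_add, add_halves]
      rw [Fintype.sum_sum_type, hε2, ENNReal.coe_add]
      simp only [Sum.elim_inl, Sum.elim_inr]
      set a := ∑ i, ‖ℓ i φ‖ₑ ^ 2
      set b := ∑ i, ‖ℓ' i φ‖ₑ ^ 2
      rw [add_mul, add_add_add_comm, mul_add]
      exact add_le_add le_rfl (add_le_add (mul_le_mul_left le_self_add _)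
        (mul_le_mul_left le_add_self _))
  · intro p _
    obtain ⟨r, K, h⟩ := exists_isChartBall (n := n) p
    have hr : 0 < r / 3 := by have := h.pos; positivity
    refine ⟨chartBall n p (r / 3), ?_, fun ε hε ↦
      exists_local_sq_le_energy_add_sum hr (by rwa [mul_div_cancel₀ _ three_ne_zero]) hε⟩
    rw [nhdsWithin_univ]
    exact (isOpen_chartBall p _).mem_nhds (mem_chartBall p hr)

end Poincare


/-! ### Compactness from finitely many functionals -/

/-- If the norm of `H` is controlled by finitely many functionals up to a small multiple of the
form `Q`, then bounded sequences for `Q` have subsequences that converge in `H`. -/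
theorem exists_tendsto_subseq_of_functionals {V H : Type*} [AddCommGroup V] [Module ℝ V]
    [NormedAddCommGroup H] [InnerProductSpace ℝ H] [CompleteSpace H] {Q : LinearMap.BilinForm ℝ V}
    {ι : V →ₗ[ℝ] H} (hnonneg : ∀ a, 0 ≤ Q a a)
    (hfun : ∀ ε : ℝ, 0 < ε → ∃ (J : Type) (_ : Fintype J) (ℓ : J → V → ℝ) (C : ℝ), 0 ≤ C ∧
      (∀ i v, ℓ i v ^ 2 ≤ C * ‖ι v‖ ^ 2) ∧ (∀ i a b, ℓ i (a - b) = ℓ i a - ℓ i b) ∧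
      ∀ v, ‖ι v‖ ^ 2 ≤ ε * Q v v + C * ∑ i, ℓ i v ^ 2)
    (B : ℝ) (φ : ℕ → V) (hφ : ∀ k, ‖ι (φ k)‖ ≤ B ∧ Q (φ k) (φ k) ≤ B) :
    ∃ (s : ℕ → ℕ) (u : H), StrictMono s ∧ Tendsto (fun k ↦ ι (φ (s k))) atTop (𝓝 u) := by
  have hB : 0 ≤ B := (norm_nonneg _).trans (hφ 0).1
  have hpar : ∀ a b, Q a a ≤ B → Q b b ≤ B → Q (a - b) (a - b) ≤ 4 * B := by
    intro a b ha hb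
    have := hnonneg (a + b)
    simp only [map_add, map_sub, LinearMap.add_apply, LinearMap.sub_apply] at this ⊢
    linarith
  set S := range fun k ↦ ι (φ k) with hS
  have htb : TotallyBounded S := by
    refine Metric.totallyBounded_of_finite_discretization fun ε hε ↦ ?_
    -- Differences satisfy `Q ≤ 4 * B`, so the energy contributes at most `ε ^ 2 / 2`. Members with
    -- the same net point in `J → ℝ` have functionals within `2 * δ`, and `δ` is such that these
    -- contribute at most `ε ^ 2 / 4`.
    obtain ⟨J, _, ℓ, C, hC, hℓb, hℓs, hℓ⟩ := hfun (ε ^ 2 / (2 * (4 * B + 1))) (by positivity)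
    set A : ℝ := C * Fintype.card J with hA
    have hA0 : 0 ≤ A := by positivity
    set δ : ℝ := ε / (4 * (A + 1)) with hδ
    have hδ0 : 0 < δ := by positivity
    set T : V → J → ℝ := fun v i ↦ ℓ i v with hT
    have hTb : Bornology.IsBounded (range fun k ↦ T (φ k)) := by
      refine isBounded_iff_forall_norm_le.2 ⟨Real.sqrt (C * B ^ 2), ?_⟩
      rintro _ ⟨k, rfl⟩
      refine (pi_norm_le_iff_of_nonneg (Real.sqrt_nonneg _)).2 fun i ↦ Real.abs_le_sqrt ?_
      refine (hℓb i _).trans ?_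
      gcongr
      exact (hφ k).1
    obtain ⟨t, htf, ht⟩ := Metric.totallyBounded_iff.1
      (hTb.isCompact_closure.totallyBounded.subset subset_closure) δ hδ0
    have hch : ∀ x : S, ∃ k, ι (φ k) = x := fun x ↦ x.2
    choose k hk using hch
    have hct : ∀ x : S, ∃ c : t, dist (T (φ (k x))) c < δ := fun x ↦ by
      obtain ⟨c, hc, hxc⟩ := mem_iUnion₂.1 (ht ⟨k x, rfl⟩)
      exact ⟨⟨c, hc⟩, hxc⟩
    choose c hc using hct
    have := htf.fintype
    refine ⟨ULift t, inferInstance, fun x ↦ ⟨c x⟩, fun x y hxy ↦ ?_⟩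
    have hxy' : c x = c y := congrArg ULift.down hxy
    have h1 : ∀ i, ℓ i (φ (k x) - φ (k y)) ^ 2 ≤ (2 * δ) ^ 2 := fun i ↦ by
      rw [hℓs, sq_le_sq, abs_of_pos (show 0 < 2 * δ by positivity)]
      have h2 := dist_triangle_right (T (φ (k x))) (T (φ (k y))) (c x)
      have h3 := hc y
      rw [← hxy'] at h3
      have h4 := dist_le_pi_dist (T (φ (k x))) (T (φ (k y))) i
      rw [Real.dist_eq] at h4
      linarith [hc x]
    have h2 := hℓ (φ (k x) - φ (k y))
    have h3 := hpar _ _ (hφ (k x)).2 (hφ (k y)).2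
    rw [dist_eq_norm, ← hk x, ← hk y, ← map_sub]
    refine lt_of_pow_lt_pow_left₀ 2 hε.le (h2.trans_lt ?_)
    have h4 : C * ∑ i, ℓ i (φ (k x) - φ (k y)) ^ 2 ≤ A * (2 * δ) ^ 2 := by
      rw [hA, mul_assoc]
      gcongr
      calc _ ≤ ∑ _i : J, (2 * δ) ^ 2 := Finset.sum_le_sum fun i _ ↦ h1 i
        _ = _ := by simp
    have h5 : ε ^ 2 / (2 * (4 * B + 1)) * Q (φ (k x) - φ (k y)) (φ (k x) - φ (k y)) ≤
        ε ^ 2 / 2 := by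
      calc _ ≤ ε ^ 2 / (2 * (4 * B + 1)) * (4 * B + 1) := by gcongr; linarith
        _ = _ := by field_simp
    have h6 : A * (2 * δ) ^ 2 ≤ ε ^ 2 / 4 := by
      have : A * (2 * δ) ^ 2 = ε ^ 2 / 4 * (A / (A + 1) ^ 2) := by rw [hδ]; field_simp; ring
      rw [this]
      refine mul_le_of_le_one_right (by positivity) ?_
      rw [div_le_one (by positivity)]
      nlinarith
    have : 0 < ε ^ 2 := by positivity
    linarith
  obtain ⟨u, -, s, hs, hu⟩ := (htb.closure.isCompact_of_isClosed
    isClosed_closure).tendsto_subseq (x := fun k ↦ ι (φ k)) fun k ↦ subset_closure ⟨k, rfl⟩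
  exact ⟨s, u, hs, hu⟩

/-! ### The first Dirichlet eigenvalue -/

section Eigenvalue

variable (n : ℕ) [NeZero n] (M : Type*) [TopologicalSpace M]
  [ChartedSpace (EuclideanHalfSpace n) M]

/-- The vector space of test functions. -/
def testFunctions : Submodule ℝ (M → ℝ) where
  carrier := {φ | IsTestFunction n φ}
  add_mem' hφ hψ := ⟨hφ.1.add hψ.1, (tsupport_add _ _).trans (union_subset hφ.2 hψ.2)⟩
  zero_mem' := ⟨contMDiff_const, by simp⟩
  smul_mem' c φ hφ := ⟨(contMDiff_const : ContMDiff (𝓡∂ n) 𝓘(ℝ, ℝ) ∞ fun _ : M ↦ c).smul hφ.1,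
    (tsupport_smul_subset_right (fun _ ↦ c) φ).trans hφ.2⟩

variable {n M}

theorem IsTestFunction.mdifferentiableAt {φ : M → ℝ} (hφ : IsTestFunction n φ) (x : M) :
    MDifferentiableAt (𝓡∂ n) 𝓘(ℝ, ℝ) φ x :=
  hφ.1.mdifferentiable (by simp) x

/-- A chart reaches an interior point, and a bump function there serves. The Rayleigh quotient thus
has something to be minimized over. -/
theorem exists_isTestFunction_ne_zero [IsManifold (𝓡∂ n) ∞ M] [T2Space M] [Nonempty M] :
    ∃ φ : M → ℝ, IsTestFunction n φ ∧ ∃ x, φ x ≠ 0 := by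
  obtain ⟨p⟩ := ‹Nonempty M›
  obtain ⟨r, hr, h⟩ := Metric.mem_nhdsWithin_iff.1 (extChartAt_target_mem_nhdsWithin
    (I := 𝓡∂ n) p)
  have h1 := (𝓡∂ n).convex_range.closure_interior_eq_closure_of_nonempty_interior
    (𝓡∂ n).nonempty_interior
  have h2 : extChartAt (𝓡∂ n) p p ∈ closure (interior (range (𝓡∂ n))) :=
    h1 ▸ subset_closure (mem_range_self _)
  obtain ⟨y, hyB, hyi⟩ := mem_closure_iff.1 h2 _ Metric.isOpen_ball (Metric.mem_ball_self hr)
  have hyt : y ∈ (extChartAt (𝓡∂ n) p).target := h ⟨hyB, interior_subset hyi⟩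
  set x := (extChartAt (𝓡∂ n) p).symm y with hx
  have hxs : x ∈ (chartAt (EuclideanHalfSpace n) p).source := by
    rw [← extChartAt_source (𝓡∂ n)]
    exact (extChartAt (𝓡∂ n) p).map_target hyt
  have hxi : x ∈ (𝓡∂ n).interior M := by
    refine ((𝓡∂ n).isInteriorPoint_iff_of_mem_atlas (n := ∞) (by simp)
      (chart_mem_atlas _ p) hxs).2 ?_
    change extChartAt (𝓡∂ n) p x ∈ interior (extChartAt (𝓡∂ n) p).target
    rw [hx, (extChartAt (𝓡∂ n) p).right_inv hyt]
    exact interior_maximal (inter_subset_inter_right _ interior_subset |>.trans h)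
      (Metric.isOpen_ball.inter isOpen_interior) ⟨hyB, hyi⟩
  obtain ⟨f, -, hf⟩ := (SmoothBumpFunction.nhds_basis_tsupport (I := 𝓡∂ n) x).mem_iff.1
    (((𝓡∂ n).isOpen_interior (n := ∞) (by simp)).mem_nhds hxi)
  exact ⟨f, ⟨f.contMDiff, hf⟩, x, by simp⟩

theorem modelDeriv_add {φ ψ : M → ℝ} {x : M} (hφ : MDifferentiableAt (𝓡∂ n) 𝓘(ℝ, ℝ) φ x)
    (hψ : MDifferentiableAt (𝓡∂ n) 𝓘(ℝ, ℝ) ψ x) :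
    modelDeriv n (φ + ψ) x = modelDeriv n φ x + modelDeriv n ψ x :=
  mfderiv_add hφ hψ

theorem modelDeriv_smul {φ : M → ℝ} {x : M} (hφ : MDifferentiableAt (𝓡∂ n) 𝓘(ℝ, ℝ) φ x) (c : ℝ) :
    modelDeriv n (c • φ) x = c • modelDeriv n φ x :=
  const_smul_mfderiv hφ c

variable [RiemannianBundle (fun x : M ↦ TangentSpace (𝓡∂ n) x)] [MeasurableSpace M]

theorem dirichletForm_eq_integral_metricForm (φ ψ : M → ℝ) :
    dirichletForm n φ ψ =
      ∫ x, metricForm n x (gradientVector n φ x) (gradientVector n ψ x) ∂riemannianVolume n M :=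
  rfl

theorem dirichletForm_comm (φ ψ : M → ℝ) : dirichletForm n φ ψ = dirichletForm n ψ φ := by
  simp only [dirichletForm_eq_integral_metricForm,
    metricForm_comm _ (gradientVector n φ _) (gradientVector n ψ _)]

theorem dirichletForm_self_nonneg (φ : M → ℝ) : 0 ≤ dirichletForm n φ φ :=
  integral_nonneg fun x ↦ gradientSq_nonneg φ x

variable [IsManifold (𝓡∂ n) ∞ M]
  [IsContMDiffRiemannianBundle (𝓡∂ n) ∞ (EuclideanSpace ℝ (Fin n))
      (fun x : M ↦ TangentSpace (𝓡∂ n) x)] [BorelSpace M] [CompactSpace M]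

theorem IsTestFunction.integrable_metricForm {φ ψ : M → ℝ} (hφ : IsTestFunction n φ)
    (hψ : IsTestFunction n ψ) :
    Integrable (fun x ↦ metricForm n x (gradientVector n φ x) (gradientVector n ψ x))
      (riemannianVolume n M) := by
  have := isFiniteMeasure_riemannianVolume (n := n) (M := M)
  exact (continuous_metricForm_gradientVector hφ.1 hψ.1).integrable_of_hasCompactSupport
    (HasCompactSupport.of_compactSpace _)

theorem energy_eq_ofReal_dirichletForm {φ : M → ℝ} (hφ : IsTestFunction n φ) :
    energy n φ = ENNReal.ofReal (dirichletForm n φ φ) :=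
  (ofReal_integral_eq_lintegral_ofReal (hφ.integrable_metricForm hφ)
    (ae_of_all _ fun x ↦ gradientSq_nonneg φ x)).symm

theorem IsTestFunction.memLp {φ : M → ℝ} (hφ : IsTestFunction n φ) :
    MemLp φ 2 (riemannianVolume n M) := by
  have := isFiniteMeasure_riemannianVolume (n := n) (M := M)
  exact hφ.1.continuous.memLp_of_hasCompactSupport (HasCompactSupport.of_compactSpace _)

theorem dirichletForm_add_left {φ₁ φ₂ ψ : M → ℝ} (hφ₁ : IsTestFunction n φ₁)
    (hφ₂ : IsTestFunction n φ₂) (hψ : IsTestFunction n ψ) :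
    dirichletForm n (φ₁ + φ₂) ψ = dirichletForm n φ₁ ψ + dirichletForm n φ₂ ψ := by
  simp only [dirichletForm_eq_integral_metricForm]
  rw [← integral_add (hφ₁.integrable_metricForm hψ) (hφ₂.integrable_metricForm hψ)]
  congr 1 with x
  rw [metricForm_gradientVector, metricForm_gradientVector, metricForm_gradientVector,
    modelDeriv_add (hφ₁.mdifferentiableAt x) (hφ₂.mdifferentiableAt x)]
  rfl

omit [IsContMDiffRiemannianBundle (𝓡∂ n) ∞ (EuclideanSpace ℝ (Fin n))
  (fun x : M ↦ TangentSpace (𝓡∂ n) x)] [BorelSpace M] [CompactSpace M] [IsManifold (𝓡∂ n) ∞ M] in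
theorem dirichletForm_smul_left {φ : M → ℝ} (hφ : IsTestFunction n φ) (c : ℝ) (ψ : M → ℝ) :
    dirichletForm n (c • φ) ψ = c * dirichletForm n φ ψ := by
  simp only [dirichletForm_eq_integral_metricForm]
  rw [← integral_const_mul]
  congr 1 with x
  rw [metricForm_gradientVector, metricForm_gradientVector,
    modelDeriv_smul (hφ.mdifferentiableAt x)]
  rfl

variable (n M)

/-- The Dirichlet form on test functions. -/
def dirichletBilinForm : LinearMap.BilinForm ℝ (testFunctions n M) :=
  LinearMap.mk₂ ℝ (fun φ ψ ↦ dirichletForm n (φ : M → ℝ) ψ)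
    (fun φ₁ φ₂ ψ ↦ dirichletForm_add_left φ₁.2 φ₂.2 ψ.2)
    (fun c φ ψ ↦ dirichletForm_smul_left φ.2 c ψ)
    (fun φ ψ₁ ψ₂ ↦ by
      rw [dirichletForm_comm, dirichletForm_comm _ (ψ₁ : M → ℝ), dirichletForm_comm _ (ψ₂ : M → ℝ)]
      exact dirichletForm_add_left ψ₁.2 ψ₂.2 φ.2)
    (fun c φ ψ ↦ by
      rw [dirichletForm_comm, dirichletForm_comm _ (ψ : M → ℝ)]
      exact dirichletForm_smul_left ψ.2 c φ)

/-- The inclusion of the test functions into `L²`. -/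
def testFunctionsToLp : testFunctions n M →ₗ[ℝ] Lp ℝ 2 (riemannianVolume n M) where
  toFun φ := φ.2.memLp.toLp φ
  map_add' φ ψ := MemLp.toLp_add φ.2.memLp ψ.2.memLp
  map_smul' c φ := MemLp.toLp_const_smul c φ.2.memLp

variable {n M}

theorem lintegral_enorm_sq_eq_ofReal_norm_sq (φ : testFunctions n M) :
    ∫⁻ x, ‖(φ : M → ℝ) x‖ₑ ^ 2 ∂riemannianVolume n M =
      ENNReal.ofReal (‖testFunctionsToLp n M φ‖ ^ 2) := by
  have h : ‖testFunctionsToLp n M φ‖ = (eLpNorm (φ : M → ℝ) 2 (riemannianVolume n M)).toReal :=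
    Lp.norm_toLp _ φ.2.memLp
  rw [h, ENNReal.ofReal_pow ENNReal.toReal_nonneg, ENNReal.ofReal_toReal φ.2.memLp.eLpNorm_ne_top]
  have := eLpNorm_nnreal_pow_eq_lintegral (p := 2) (f := (φ : M → ℝ))
    (μ := riemannianVolume n M) two_ne_zero
  simpa using this.symm

theorem norm_testFunctionsToLp_sq (φ : testFunctions n M) :
    ‖testFunctionsToLp n M φ‖ ^ 2 = ∫ x, (φ : M → ℝ) x ^ 2 ∂riemannianVolume n M := by
  rw [integral_eq_lintegral_of_nonneg_ae (ae_of_all _ fun x ↦ sq_nonneg _)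
    (φ.2.1.continuous.pow 2).aestronglyMeasurable]
  have h := lintegral_enorm_sq_eq_ofReal_norm_sq φ
  rw [← ENNReal.toReal_ofReal (sq_nonneg ‖testFunctionsToLp n M φ‖), ← h]
  congr 2 with x
  rw [Real.enorm_eq_ofReal_abs, ← ENNReal.ofReal_pow (abs_nonneg _), sq_abs]

theorem inner_testFunctionsToLp (u : Lp ℝ 2 (riemannianVolume n M)) (ψ : testFunctions n M) :
    inner ℝ u (testFunctionsToLp n M ψ) =
      ∫ x, u x * (ψ : M → ℝ) x ∂riemannianVolume n M := by
  rw [L2.inner_def]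
  refine integral_congr_ae ?_
  filter_upwards [MemLp.coeFn_toLp ψ.2.memLp] with x hx
  rw [show (testFunctionsToLp n M ψ : M → ℝ) x = (ψ : M → ℝ) x from hx]
  simp [mul_comm]

theorem exists_tendsto_subseq_testFunctions (B : ℝ) (φ : ℕ → testFunctions n M)
    (hφ : ∀ k, ‖testFunctionsToLp n M (φ k)‖ ≤ B ∧ dirichletBilinForm n M (φ k) (φ k) ≤ B) :
    ∃ (s : ℕ → ℕ) (u : Lp ℝ 2 (riemannianVolume n M)), StrictMono s ∧
      Tendsto (fun k ↦ testFunctionsToLp n M (φ (s k))) atTop (𝓝 u) := by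
  refine exists_tendsto_subseq_of_functionals (fun φ ↦ dirichletForm_self_nonneg _) ?_ B φ hφ
  intro ε hε
  lift ε to NNReal using hε.le
  obtain ⟨J, _, ℓ, C, h1, h2, h3⟩ := exists_sq_le_energy_add_sum (n := n) (M := M)
    (NNReal.coe_pos.1 hε)
  have hsq : ∀ a : ℝ, ‖a‖ₑ ^ 2 = ENNReal.ofReal (a ^ 2) := fun a ↦ by
    rw [Real.enorm_eq_ofReal_abs, ← ENNReal.ofReal_pow (abs_nonneg _), sq_abs]
  have hCr : (C : ℝ≥0∞) = ENNReal.ofReal C := (ENNReal.ofReal_coe_nnreal).symm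
  refine ⟨J, inferInstance, fun i v ↦ ℓ i v, C, C.coe_nonneg,
    fun i v ↦ ?_, fun i a b ↦ h2 i a b a.2 b.2,
    fun v ↦ ?_⟩
  · have := h1 i v v.2
    rwa [lintegral_enorm_sq_eq_ofReal_norm_sq, hsq, hCr, ← ENNReal.ofReal_mul C.coe_nonneg,
      ENNReal.ofReal_le_ofReal_iff (by positivity)] at this
  · have := h3 v v.2
    have hεr : (ε : ℝ≥0∞) = ENNReal.ofReal ε := (ENNReal.ofReal_coe_nnreal).symm
    have hD := dirichletForm_self_nonneg (n := n) (v : M → ℝ)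
    rw [lintegral_enorm_sq_eq_ofReal_norm_sq] at this
    simp only [hsq] at this
    rw [← ENNReal.ofReal_sum_of_nonneg fun i _ ↦ sq_nonneg _, hεr, hCr,
      energy_eq_ofReal_dirichletForm v.2, ← ENNReal.ofReal_mul hε.le,
      ← ENNReal.ofReal_mul C.coe_nonneg,
      ← ENNReal.ofReal_add (by positivity) (by positivity),
      ENNReal.ofReal_le_ofReal_iff (by positivity)] at this
    exact this

variable (n M)

/-- The first Dirichlet eigenvalue is the minimum of the Rayleigh quotient, and it is positive. -/
theorem firstDirichletEigenvalue_pos_and_mul_integral_sq_le [T2Space M] [PreconnectedSpace M]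
    (hM : ((𝓡∂ n).boundary M).Nonempty) :
    0 < firstDirichletEigenvalue n M ∧ ∀ φ : M → ℝ, IsTestFunction n φ →
      firstDirichletEigenvalue n M * ∫ x, φ x ^ 2 ∂riemannianVolume n M ≤ dirichletForm n φ φ := by
  have : Nonempty M := hM.to_type
  obtain ⟨φ₀, hφ₀, x₀, hx₀⟩ := exists_isTestFunction_ne_zero (n := n) (M := M)
  have hne : ∃ v, testFunctionsToLp n M v ≠ 0 := by
    refine ⟨⟨φ₀, hφ₀⟩, fun h ↦ ?_⟩
    have h1 : φ₀ =ᵐ[riemannianVolume n M] 0 := (MemLp.coeFn_toLp hφ₀.memLp).symm.trans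
      (Lp.eq_zero_iff_ae_eq_zero.1 h)
    have h2 : IsOpen {x | φ₀ x ≠ 0} := isOpen_ne_fun hφ₀.1.continuous continuous_const
    exact (riemannianVolume_pos_of_isOpen h2 ⟨x₀, hx₀⟩).ne' h1
  obtain ⟨R, u, φ, hu1, hφu, hφR, hφc, hweak, hray⟩ := exists_rayleigh_minimizer
    (Q := dirichletBilinForm n M) (ι := testFunctionsToLp n M)
    (fun φ ψ ↦ dirichletForm_comm _ _) (fun φ ↦ dirichletForm_self_nonneg _)
    exists_tendsto_subseq_testFunctions hne
  -- The minimizer shows that `R` is itself a weak eigenvalue, and no weak eigenvalue lies below it.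
  -- The infimum in the definition is therefore `R`.
  have hleast : IsLeast {Λ : ℝ | ∃ u : M → ℝ, IsDirichletEigenfunction n Λ u} R := by
    constructor
    · refine ⟨u, fun h0 ↦ ?_, fun k ↦ φ k, ⟨fun k ↦ (φ k).2, Lp.memLp u, ?_, hφc⟩, fun ψ hψ ↦ ?_⟩
      · rw [(Lp.eq_zero_iff_ae_eq_zero).2 h0, norm_zero] at hu1
        exact zero_ne_one hu1
      · refine (Lp.tendsto_Lp_iff_tendsto_eLpNorm'' _ (fun k ↦ (φ k).2.memLp) u (Lp.memLp u)).1 ?_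
        rw [Lp.toLp_coeFn]
        exact hφu
      · have := hweak ⟨ψ, hψ⟩
        rw [inner_testFunctionsToLp] at this
        exact this
    · rintro Λ ⟨w, hw0, χ, hχ, hχw⟩
      refine le_of_weak_eigenvector (Q := dirichletBilinForm n M) (ι := testFunctionsToLp n M)
        (fun φ ψ ↦ dirichletForm_comm _ _) hray (u := hχ.memLp.toLp w) (fun h ↦ hw0 ?_)
        (φ := fun k ↦ ⟨χ k, hχ.isTestFunction k⟩) ?_ hχ.cauchy_energy fun ψ ↦ ?_
      · exact hχ.memLp.coeFn_toLp.symm.trans (Lp.eq_zero_iff_ae_eq_zero.1 h)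
      · exact (Lp.tendsto_Lp_iff_tendsto_eLpNorm'' _ (fun k ↦ (hχ.isTestFunction k).memLp) w
          hχ.memLp).2 hχ.tendsto_L2
      · rw [inner_testFunctionsToLp]
        have h1 : ∫ x, hχ.memLp.toLp w x * (ψ : M → ℝ) x ∂riemannianVolume n M =
            ∫ x, w x * (ψ : M → ℝ) x ∂riemannianVolume n M := by
          refine integral_congr_ae ?_
          filter_upwards [hχ.memLp.coeFn_toLp] with x hx
          rw [hx]
        rw [h1]
        exact hχw ψ ψ.2
  have hR : firstDirichletEigenvalue n M = R := hleast.csInf_eq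
  refine ⟨?_, fun φ hφ ↦ ?_⟩
  -- Along the minimizing sequence the Poincaré inequality passes to the limit as `1 ≤ C * R`.
  · obtain ⟨C, hC⟩ := exists_poincare (n := n) hM
    have h1 : ∀ k, ‖testFunctionsToLp n M (φ k)‖ ^ 2 ≤
        C * dirichletBilinForm n M (φ k) (φ k) := fun k ↦ by
      have h2 := hC (φ k) (φ k).2
      have hD := dirichletForm_self_nonneg (n := n) (φ k : M → ℝ)
      rwa [lintegral_enorm_sq_eq_ofReal_norm_sq, energy_eq_ofReal_dirichletForm (φ k).2,
        ← ENNReal.ofReal_coe_nnreal, ← ENNReal.ofReal_mul C.coe_nonneg,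
        ENNReal.ofReal_le_ofReal_iff (mul_nonneg C.coe_nonneg hD)] at h2
    have h3 := le_of_tendsto_of_tendsto' (hφu.norm.pow 2) (hφR.const_mul (C : ℝ)) h1
    rw [hu1, one_pow] at h3
    rw [hR]
    exact pos_of_mul_pos_right (zero_lt_one.trans_le h3) C.coe_nonneg
  · have := hray ⟨φ, hφ⟩
    rw [norm_testFunctionsToLp_sq, ← hR] at this
    exact this

end Eigenvalue


/-! ### Smooth approximation of Lipschitz functions -/

/-- A function that is locally controlled by an increment function `N` has smooth approximations
that are controlled by `N` as well. -/
theorem exists_contDiff_abs_sub_le {E : Type*} [NormedAddCommGroup E] [NormedSpace ℝ E]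
    [FiniteDimensional ℝ E] [MeasurableSpace E] [BorelSpace E] (μ : Measure E) [μ.IsAddHaarMeasure]
    {f : E → ℝ} (hf : LocallyIntegrable f μ) {N : E → ℝ} (hN : Continuous N) (hN0 : N 0 = 0)
    {y₀ : E} {r : ℝ} (hr : 0 < r)
    (hfN : ∀ y ∈ Metric.ball y₀ (2 * r), ∀ z ∈ Metric.ball y₀ (2 * r), |f y - f z| ≤ N (y - z))
    {ε : ℝ} (hε : 0 < ε) :
    ∃ g : E → ℝ, ContDiff ℝ ∞ g ∧ (∀ y ∈ Metric.ball y₀ r, |g y - f y| ≤ ε) ∧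
      ∀ y ∈ Metric.ball y₀ r, ∀ z ∈ Metric.ball y₀ r, |g y - g z| ≤ N (y - z) := by
  obtain ⟨s, hs, hsN⟩ := Metric.continuousAt_iff.1 (hN.continuousAt (x := 0)) ε hε
  set δ := min r s with hδ
  have hδ0 : 0 < δ := lt_min hr hs
  -- Radius at most `r` keeps the translates in the ball where `f` is controlled; radius at most `s`
  -- makes `N` smaller than `ε` on the support.
  let b : ContDiffBump (0 : E) := ⟨δ / 2, δ, half_pos hδ0, half_lt_self hδ0⟩
  have hb2 : b.rOut = δ := rfl
  set k := b.normed μ with hk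
  have hconv : ∀ y, ConvolutionExistsAt k f y (ContinuousLinearMap.lsmul ℝ ℝ) μ := fun y ↦
    b.hasCompactSupport_normed.convolutionExists_left _ b.continuous_normed hf y
  have hbt : ∀ t, k t ≠ 0 → ‖t‖ < δ := fun t ht ↦ by
    have : t ∈ Function.support k := ht
    rw [hk, b.support_normed_eq] at this
    simpa using this
  refine ⟨convolution k f (ContinuousLinearMap.lsmul ℝ ℝ) μ,
    b.hasCompactSupport_normed.contDiff_convolution_left _ b.contDiff_normed hf, ?_, ?_⟩
  · intro y hy
    rw [← Real.dist_eq]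
    refine b.dist_normed_convolution_le hf.aestronglyMeasurable fun x hx ↦ ?_
    rw [hb2, Metric.mem_ball] at hx
    rw [Metric.mem_ball] at hy
    have hx2 : x ∈ Metric.ball y₀ (2 * r) := by
      rw [Metric.mem_ball]
      linarith [dist_triangle x y y₀, min_le_left r s]
    rw [Real.dist_eq]
    refine (hfN x hx2 y (Metric.ball_subset_ball (by linarith) (Metric.mem_ball.2 hy))).trans ?_
    have := hsN (x := x - y) (by
      rw [dist_zero_right, ← dist_eq_norm]
      exact hx.trans_le (min_le_right _ _))
    rw [hN0, dist_zero_right] at this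
    exact (le_abs_self _).trans this.le
  · intro y hy z hz
    -- The convolution averages `f (y - t) - f (z - t)` against a probability density, and each such
    -- increment has the same bound `N (y - z)`.
    rw [convolution_def, convolution_def, ← integral_sub (hconv y) (hconv z), ← Real.norm_eq_abs]
    refine (norm_integral_le_of_norm_le (b.integrable_normed.mul_const (N (y - z)))
      (ae_of_all _ fun t ↦ ?_)).trans_eq ?_
    · rw [ContinuousLinearMap.lsmul_apply, ContinuousLinearMap.lsmul_apply, ← smul_sub, norm_smul,
        Real.norm_of_nonneg (b.nonneg_normed t)]
      by_cases ht : k t = 0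
      · rw [← hk, ht, zero_mul, zero_mul]
      · have htδ := (hbt t ht).trans_le (min_le_left _ _)
        have hmem : ∀ w ∈ Metric.ball y₀ r, w - t ∈ Metric.ball y₀ (2 * r) := fun w hw ↦ by
          rw [Metric.mem_ball, dist_eq_norm] at hw ⊢
          calc ‖w - t - y₀‖ = ‖(w - y₀) - t‖ := by congr 1; abel
            _ ≤ ‖w - y₀‖ + ‖t‖ := norm_sub_le _ _
            _ < 2 * r := by linarith
        refine mul_le_mul_of_nonneg_left ?_ (b.nonneg_normed t)
        have := hfN _ (hmem y hy) _ (hmem z hz)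
        rwa [sub_sub_sub_cancel_right] at this
    · rw [integral_mul_const, b.integral_normed, one_mul]

theorem abs_fderiv_apply_le_of_abs_sub_le {E : Type*} [NormedAddCommGroup E] [NormedSpace ℝ E]
    {g : E → ℝ} {y : E} (hg : DifferentiableAt ℝ g y) {N : E → ℝ}
    (hN : ∀ (t : ℝ) v, N (t • v) = |t| * N v) (h : ∀ᶠ z in 𝓝 y, |g z - g y| ≤ N (z - y)) (v : E)
    (hv : 0 ≤ N v) : |fderiv ℝ g y v| ≤ N v := by
  have hl : HasDerivAt (fun t : ℝ ↦ y + t • v) v 0 := by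
    simpa using ((hasDerivAt_id (0 : ℝ)).smul_const v).const_add y
  have h1 : HasDerivAt (fun t : ℝ ↦ g (y + t • v)) (fderiv ℝ g y v) 0 := by
    have h2 : HasFDerivAt g (fderiv ℝ g y) (y + (0 : ℝ) • v) := by simpa using hg.hasFDerivAt
    exact h2.comp_hasDerivAt (0 : ℝ) hl
  refine h1.le_of_lip' hv ?_
  have hc : Tendsto (fun t : ℝ ↦ y + t • v) (𝓝 0) (𝓝 y) := by
    simpa using hl.continuousAt.tendsto
  filter_upwards [hc.eventually h] with t ht
  simp only [zero_smul, add_zero, sub_zero, Real.norm_eq_abs]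
  rw [add_sub_cancel_left, hN] at ht
  linarith [mul_comm |t| (N v)]

/-! ### The Riemannian distance in a chart. -/

section Approximation

variable {n : ℕ} [NeZero n] {M : Type*} [EMetricSpace M]
  [ChartedSpace (EuclideanHalfSpace n) M]
  [RiemannianBundle (fun x : M ↦ TangentSpace (𝓡∂ n) x)]

theorem enorm_eq_ofReal_sqrt_metricForm {x : M} (v : TangentSpace (𝓡∂ n) x) :
    ‖v‖ₑ = ENNReal.ofReal (Real.sqrt (metricForm n x v v)) := by
  rw [metricForm_eq_inner, ← norm_eq_sqrt_real_inner, ofReal_norm]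

variable [IsManifold (𝓡∂ n) ∞ M]

/-- The Riemannian distance is bounded by the distance in a chart. -/
theorem edist_extChartAt_symm_le [IsRiemannianManifold (𝓡∂ n) M] {p : M}
    {S : Set (EuclideanSpace ℝ (Fin n))} (hS : Convex ℝ S) (hSt : S ⊆ (extChartAt (𝓡∂ n) p).target)
    {N : EuclideanSpace ℝ (Fin n) → ℝ}
    (hG : ∀ y ∈ S, ∀ v, Real.sqrt (chartMetric n p y v v) ≤ N v)
    {y z : EuclideanSpace ℝ (Fin n)} (hy : y ∈ S) (hz : z ∈ S) :
    edist ((extChartAt (𝓡∂ n) p).symm y) ((extChartAt (𝓡∂ n) p).symm z) ≤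
      ENNReal.ofReal (N (z - y)) := by
  let η := ContinuousAffineMap.lineMap (R := ℝ) y z
  set γ := (extChartAt (𝓡∂ n) p).symm ∘ η with hγ
  have hη : Icc 0 1 ⊆ ⇑η ⁻¹' S := by
    simp only [← image_subset_iff, ContinuousAffineMap.coe_lineMap_eq,
      ← segment_eq_image_lineMap, η]
    exact hS.segment_subset hy hz
  have η_smooth : ContMDiffOn 𝓘(ℝ, ℝ) 𝓘(ℝ, EuclideanSpace ℝ (Fin n)) 1 η (Icc 0 1) := by
    apply ContMDiff.contMDiffOn
    rw [contMDiff_iff_contDiff]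
    exact ContinuousAffineMap.contDiff _
  rw [IsRiemannianManifold.out (I := 𝓡∂ n)]
  have h1 : Manifold.riemannianEDist (𝓡∂ n) ((extChartAt (𝓡∂ n) p).symm y)
      ((extChartAt (𝓡∂ n) p).symm z) ≤ Manifold.pathELength (𝓡∂ n) γ 0 1 := by
    apply Manifold.riemannianEDist_le_pathELength _ _ _ zero_le_one
    · exact (contMDiffOn_extChartAt_symm p).comp η_smooth (hη.trans (preimage_mono hSt))
    · simp [γ, η, ContinuousAffineMap.coe_lineMap_eq]
    · simp [γ, η, ContinuousAffineMap.coe_lineMap_eq]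
  refine h1.trans ?_
  rw [Manifold.pathELength_eq_lintegral_mfderivWithin_Icc]
  have h2 : ∀ t ∈ Icc (0 : ℝ) 1, ‖mfderivWithin 𝓘(ℝ, ℝ) (𝓡∂ n) γ (Icc 0 1) t 1‖ₑ ≤
      ENNReal.ofReal (N (z - y)) := by
    intro t ht
    have h3 : mfderivWithin 𝓘(ℝ, ℝ) (𝓡∂ n) γ (Icc 0 1) t =
        (mfderivWithin 𝓘(ℝ, EuclideanSpace ℝ (Fin n)) (𝓡∂ n) (extChartAt (𝓡∂ n) p).symm
          (range (𝓡∂ n)) (η t)) ∘L (mfderivWithin 𝓘(ℝ, ℝ) 𝓘(ℝ, EuclideanSpace ℝ (Fin n)) η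
            (Icc 0 1) t) := by
      apply mfderivWithin_comp
      · exact mdifferentiableWithinAt_extChartAt_symm (hSt (hη ht))
      · exact η_smooth.mdifferentiableOn one_ne_zero t ht
      · exact hη.trans (preimage_mono (hSt.trans (extChartAt_target_subset_range p)))
      · rw [uniqueMDiffWithinAt_iff_uniqueDiffWithinAt]
        exact uniqueDiffOn_Icc zero_lt_one t ht
    have h4 : mfderivWithin 𝓘(ℝ, ℝ) 𝓘(ℝ, EuclideanSpace ℝ (Fin n)) η (Icc 0 1) t (1 : ℝ) =
        z - y := by
      rw [mfderivWithin_eq_fderivWithin]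
      have h5 : HasDerivWithinAt η (z - y) (Icc 0 1) t := by
        simp only [η, ContinuousAffineMap.coe_lineMap_eq]
        exact AffineMap.hasDerivWithinAt_lineMap
      exact h5.derivWithin (uniqueDiffOn_Icc zero_lt_one t ht)
    have h5 : mfderivWithin 𝓘(ℝ, ℝ) (𝓡∂ n) γ (Icc 0 1) t (1 : ℝ) =
        chartDeriv n p (η t) (z - y) := by
      rw [h3, ← h4]
      rfl
    refine (enorm_eq_ofReal_sqrt_metricForm _).trans_le (ENNReal.ofReal_le_ofReal ?_)
    refine le_trans (le_of_eq ?_) (hG (η t) (hη ht) (z - y))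
    rw [chartMetric_apply, ← h5]
    rfl
  calc ∫⁻ t in Icc (0 : ℝ) 1, ‖mfderivWithin 𝓘(ℝ, ℝ) (𝓡∂ n) γ (Icc 0 1) t 1‖ₑ
      ≤ ∫⁻ t in Icc (0 : ℝ) 1, ENNReal.ofReal (N (z - y)) := setLIntegral_mono' measurableSet_Icc h2
    _ = ENNReal.ofReal (N (z - y)) := by simp

end Approximation


/-! ### Local mollification and gluing by a partition of unity. -/

section Gluing

variable {n : ℕ} [NeZero n] {M : Type*} [EMetricSpace M]
  [ChartedSpace (EuclideanHalfSpace n) M]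

theorem modelDeriv_const (c : ℝ) (x : M) : modelDeriv n (fun _ ↦ c) x = 0 :=
  mfderiv_const

theorem modelDeriv_congr {φ ψ : M → ℝ} {x : M} (h : φ =ᶠ[𝓝 x] ψ) :
    modelDeriv n φ x = modelDeriv n ψ x :=
  h.mfderiv_eq

theorem modelDeriv_mul {φ ψ : M → ℝ} {x : M} (hφ : MDifferentiableAt (𝓡∂ n) 𝓘(ℝ, ℝ) φ x)
    (hψ : MDifferentiableAt (𝓡∂ n) 𝓘(ℝ, ℝ) ψ x) :
    modelDeriv n (φ * ψ) x = φ x • modelDeriv n ψ x + ψ x • modelDeriv n φ x :=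
  (hφ.hasMFDerivAt.mul hψ.hasMFDerivAt).mfderiv

theorem mdifferentiableAt_sum_and_modelDeriv_sum {ι : Type*} {s : Finset ι} {u : ι → M → ℝ} {x : M}
    (hu : ∀ i ∈ s, MDifferentiableAt (𝓡∂ n) 𝓘(ℝ, ℝ) (u i) x) :
    MDifferentiableAt (𝓡∂ n) 𝓘(ℝ, ℝ) (∑ i ∈ s, u i) x ∧
      modelDeriv n (∑ i ∈ s, u i) x = ∑ i ∈ s, modelDeriv n (u i) x := by
  classical
  induction s using Finset.induction_on with
  | empty => exact ⟨mdifferentiableAt_const, modelDeriv_const 0 x⟩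
  | insert i s hi ih =>
    obtain ⟨h1, h2⟩ := ih fun j hj ↦ hu j (Finset.mem_insert_of_mem hj)
    have h3 := hu i (Finset.mem_insert_self i s)
    rw [Finset.sum_insert hi, Finset.sum_insert hi, modelDeriv_add h3 h1, h2]
    exact ⟨h3.add h1, rfl⟩

variable [RiemannianBundle (fun x : M ↦ TangentSpace (𝓡∂ n) x)]

theorem abs_modelDeriv_le (φ : M → ℝ) (x : M) (v : EuclideanSpace ℝ (Fin n)) :
    |modelDeriv n φ x v| ≤ Real.sqrt (gradientSq n φ x) * Real.sqrt (metricForm n x v v) := by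
  rw [← Real.sqrt_mul (gradientSq_nonneg φ x)]
  exact Real.abs_le_sqrt (modelDeriv_sq_le φ x v)

/-- Test the bound on the gradient itself: `|∇φ|² ≤ c |∇φ|`. -/
theorem gradientSq_le_sq_of_abs_modelDeriv_le {φ : M → ℝ} {x : M} {c : ℝ}
    (h : ∀ v, |modelDeriv n φ x v| ≤ c * Real.sqrt (metricForm n x v v)) :
    gradientSq n φ x ≤ c ^ 2 := by
  have h1 := h (gradientVector n φ x)
  rw [← metricForm_gradientVector] at h1
  change |gradientSq n φ x| ≤ c * Real.sqrt (gradientSq n φ x) at h1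
  have h0 := gradientSq_nonneg (n := n) φ x
  rw [abs_of_nonneg h0] at h1
  by_cases hz : gradientSq n φ x = 0
  · rw [hz]; positivity
  · have hpos : 0 < Real.sqrt (gradientSq n φ x) := Real.sqrt_pos.2 (h0.lt_of_ne' hz)
    have h2 : Real.sqrt (gradientSq n φ x) ≤ c := by
      refine le_of_mul_le_mul_right ?_ hpos
      rwa [Real.mul_self_sqrt h0]
    rw [← Real.sq_sqrt h0]
    gcongr

variable [IsManifold (𝓡∂ n) ∞ M]
  [IsContMDiffRiemannianBundle (𝓡∂ n) ∞ (EuclideanSpace ℝ (Fin n))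
      (fun x : M ↦ TangentSpace (𝓡∂ n) x)]
  [IsRiemannianManifold (𝓡∂ n) M] [CompactSpace M]

/-- Lipschitz functions have local smooth approximations with almost the same Lipschitz constant
near interior points. -/
theorem LipschitzWith.exists_local_smooth_approx {f : M → ℝ} (hf : LipschitzWith 1 f) {p : M}
    (hp : p ∈ (𝓡∂ n).interior M) {κ : ℝ} (hκ : 1 < κ) :
    ∃ U : Set M, IsOpen U ∧ p ∈ U ∧ ∀ ε > 0, ∃ g : M → ℝ, ContMDiffOn (𝓡∂ n) 𝓘(ℝ, ℝ) ∞ g U ∧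
      (∀ x ∈ U, |g x - f x| ≤ ε) ∧
      ∀ x ∈ U, ∀ v, |modelDeriv n g x v| ≤ κ * Real.sqrt (metricForm n x v v) := by
  set y₀ := extChartAt (𝓡∂ n) p p with hy₀
  have hy₀t : y₀ ∈ (extChartAt (𝓡∂ n) p).target := mem_extChartAt_target p
  obtain ⟨r₁, hr₁, h₁⟩ := exists_chartMetric_le_mul hy₀t hκ
  obtain ⟨r₂, hr₂, h₂⟩ := Metric.mem_nhds_iff.1 (mem_interior_iff_mem_nhds.1
    ((𝓡∂ n).isInteriorPoint_iff.1 hp))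
  set r := min r₁ r₂ / 2 with hr
  have hr0 : 0 < r := by positivity
  have hB : Metric.ball y₀ (2 * r) ⊆ (extChartAt (𝓡∂ n) p).target :=
    (Metric.ball_subset_ball (by rw [hr]; linarith [min_le_right r₁ r₂])).trans h₂
  have hB1 : ∀ y ∈ Metric.ball y₀ (2 * r), y ∈ Metric.ball y₀ r₁ ∩ (extChartAt (𝓡∂ n) p).target :=
    fun y hy ↦ ⟨Metric.ball_subset_ball (by rw [hr]; linarith [min_le_left r₁ r₂]) hy, hB hy⟩
  -- The norm of `κ g` frozen at `p`, which mollification preserves as an increment bound. Passing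
  -- from the varying metric to `N` costs a factor `√κ`, included in `N`, and returning at the end
  -- costs another `√κ`, hence `κ` in all.
  set N : EuclideanSpace ℝ (Fin n) → ℝ := fun v ↦ Real.sqrt (κ * chartMetric n p y₀ v v) with hN
  have hNc : Continuous N := by
    have : Continuous fun v ↦ chartMetric n p y₀ v v :=
      (chartMetric n p y₀).continuous.clm_apply continuous_id
    exact (this.const_mul κ).sqrt
  have hN0 : N 0 = 0 := by simp [hN]
  have hNs : ∀ (t : ℝ) v, N (t • v) = |t| * N v := fun t v ↦ by
    simp only [hN, map_smul, _root_.smul_apply, smul_eq_mul]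
    rw [← Real.sqrt_sq_eq_abs, ← Real.sqrt_mul (sq_nonneg t)]
    congr 1
    ring
  have hfN : ∀ y ∈ Metric.ball y₀ (2 * r), ∀ z ∈ Metric.ball y₀ (2 * r),
      |chartExtend n p f y - chartExtend n p f z| ≤ N (y - z) := fun y hy z hz ↦ by
    have h3 := edist_extChartAt_symm_le (convex_ball _ _) hB (N := N)
      (fun y hy v ↦ Real.sqrt_le_sqrt (h₁ y (hB1 y hy) v).1) hz hy
    have h4 := hf ((extChartAt (𝓡∂ n) p).symm z) ((extChartAt (𝓡∂ n) p).symm y)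
    rw [ENNReal.coe_one, one_mul] at h4
    replace h4 := h4.trans h3
    rw [chartExtend_of_mem (hB hy), chartExtend_of_mem (hB hz), abs_sub_comm, ← Real.dist_eq]
    rwa [edist_dist, ENNReal.ofReal_le_ofReal_iff (Real.sqrt_nonneg _)] at h4
  refine ⟨chartBall n p r, isOpen_chartBall p r, mem_chartBall p hr0, fun ε hε ↦ ?_⟩
  obtain ⟨g, hg, hgf, hgN⟩ := exists_contDiff_abs_sub_le volume
    (locallyIntegrable_chartExtend p hf.continuous) hNc hN0 hr0 hfN hε
  have hsm : ContMDiffOn (𝓡∂ n) 𝓘(ℝ, ℝ) ∞ (g ∘ extChartAt (𝓡∂ n) p) (chartBall n p r) := by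
    refine (hg.contMDiff.comp_contMDiffOn contMDiffOn_extChartAt).mono fun x hx ↦ ?_
    rw [← extChartAt_source (𝓡∂ n)]
    exact hx.1
  refine ⟨g ∘ extChartAt (𝓡∂ n) p, hsm, fun x hx ↦ ?_, fun x hx v ↦ ?_⟩
  · have h3 := hgf _ hx.2
    rwa [chartExtend_of_mem ((extChartAt (𝓡∂ n) p).map_source hx.1),
      (extChartAt (𝓡∂ n) p).left_inv hx.1] at h3
  · set y := extChartAt (𝓡∂ n) p x with hy
    have hyt : y ∈ (extChartAt (𝓡∂ n) p).target := (extChartAt (𝓡∂ n) p).map_source hx.1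
    have hyB : y ∈ Metric.ball y₀ r := hx.2
    have hyB2 : y ∈ Metric.ball y₀ (2 * r) := Metric.ball_subset_ball (by linarith) hyB
    have hxy : (extChartAt (𝓡∂ n) p).symm y = x := (extChartAt (𝓡∂ n) p).left_inv hx.1
    obtain ⟨w, hw⟩ := (isInvertible_chartDeriv hyt).surjective v
    have hmd : MDifferentiableAt (𝓡∂ n) 𝓘(ℝ, ℝ) (g ∘ extChartAt (𝓡∂ n) p) x :=
      (hsm.contMDiffAt ((isOpen_chartBall p r).mem_nhds hx)).mdifferentiableAt (by simp)
    have h3 := fderivWithin_comp_extChartAt_symm hyt (by rwa [hxy]) w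
    have hev : (g ∘ extChartAt (𝓡∂ n) p) ∘ (extChartAt (𝓡∂ n) p).symm =ᶠ[𝓝 y] g := by
      filter_upwards [Metric.isOpen_ball.mem_nhds hyB2] with z hz
      rw [Function.comp_apply, Function.comp_apply, (extChartAt (𝓡∂ n) p).right_inv (hB hz)]
    rw [fderivWithin_of_mem_nhds (mem_of_superset (Metric.isOpen_ball.mem_nhds hyB2)
      (hB.trans (extChartAt_target_subset_range p))), hev.fderiv_eq, hw, hxy] at h3
    rw [← h3]
    refine (abs_fderiv_apply_le_of_abs_sub_le (hg.differentiable (by simp) y) hNs ?_ w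
      (Real.sqrt_nonneg _)).trans ?_
    · filter_upwards [Metric.isOpen_ball.mem_nhds hyB] with z hz
      exact hgN z hz y hyB
    · have h4 := (h₁ y (hB1 y hyB2) w).2
      have hκ0 : 0 ≤ κ := by linarith
      rw [chartMetric_apply p y, hw, hxy] at h4
      calc N w ≤ Real.sqrt (κ ^ 2 * metricForm n x v v) := by
            refine Real.sqrt_le_sqrt ?_
            rw [pow_two, mul_assoc]
            gcongr
        _ = κ * Real.sqrt (metricForm n x v v) := by
            rw [Real.sqrt_mul (sq_nonneg κ), Real.sqrt_sq hκ0]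

/-- Lipschitz functions vanishing near the boundary have smooth approximations with almost the same
Lipschitz constant. -/
theorem LipschitzWith.exists_smooth_approx {f : M → ℝ} (hf : LipschitzWith 1 f) {V : Set M}
    (hV : IsOpen V) (hbV : (𝓡∂ n).boundary M ⊆ V) (hfV : ∀ x ∈ V, f x = 0) {κ : ℝ} (hκ : 1 < κ)
    {ε : ℝ} (hε : 0 < ε) :
    ∃ h : M → ℝ, ContMDiff (𝓡∂ n) 𝓘(ℝ, ℝ) ∞ h ∧ (∀ x, |h x - f x| ≤ ε) ∧
      ∀ x, gradientSq n h x ≤ κ ^ 2 := by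
  set κ₁ := (1 + κ) / 2 with hκ₁
  have hκ₁1 : 1 < κ₁ := by rw [hκ₁]; linarith
  have hloc : ∀ p : M, ∃ U : Set M, IsOpen U ∧ p ∈ U ∧ ∀ ε > 0, ∃ g : M → ℝ,
      ContMDiffOn (𝓡∂ n) 𝓘(ℝ, ℝ) ∞ g U ∧ (∀ x ∈ U, |g x - f x| ≤ ε) ∧
      ∀ x ∈ U, ∀ v, |modelDeriv n g x v| ≤ κ₁ * Real.sqrt (metricForm n x v v) := by
    intro p
    by_cases hp : p ∈ V
    -- On `V` the function is already zero, so mollification is needed only at points outside `V`,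
    -- all of them interior.
    · refine ⟨V, hV, hp, fun ε hε ↦ ⟨fun _ ↦ 0, contMDiffOn_const, fun x hx ↦ ?_, fun x hx v ↦ ?_⟩⟩
      · simpa [hfV x hx] using hε.le
      · rw [modelDeriv_const]
        simpa using by positivity
    · refine hf.exists_local_smooth_approx ?_ hκ₁1
      by_contra h
      exact hp (hbV (((𝓡∂ n).compl_interior (M := M)) ▸ h))
  choose U hUo hpU hU using hloc
  obtain ⟨t, -, ht⟩ := isCompact_univ.elim_nhds_subcover U fun p _ ↦ (hUo p).mem_nhds (hpU p)
  obtain ⟨ρ, hρ⟩ := SmoothPartitionOfUnity.exists_isSubordinate (𝓡∂ n) isClosed_univ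
    (fun i : t ↦ U i) (fun i ↦ hUo i) (by simpa [iUnion_subtype] using ht)
  have hρd : ∀ i x, MDifferentiableAt (𝓡∂ n) 𝓘(ℝ, ℝ) (ρ i) x := fun i x ↦
    (ρ i).contMDiff.mdifferentiable (by simp) x
  obtain ⟨C, hC0, hC⟩ : ∃ C : ℝ, 0 ≤ C ∧ ∀ i x v,
      |modelDeriv n (ρ i) x v| ≤ C * Real.sqrt (metricForm n x v v) := by
    have h1 : ∀ i, ∃ c : ℝ, ∀ x, gradientSq n (ρ i) x ≤ c := fun i ↦ by
      obtain ⟨c, hc⟩ := (isCompact_range (continuous_metricForm_gradientVector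
        (ρ i).contMDiff (ρ i).contMDiff)).bddAbove
      exact ⟨c, fun x ↦ hc ⟨x, rfl⟩⟩
    choose c hc using h1
    refine ⟨∑ i, Real.sqrt (c i), Finset.sum_nonneg fun i _ ↦ Real.sqrt_nonneg _, fun i x v ↦ ?_⟩
    refine (abs_modelDeriv_le _ _ _).trans ?_
    gcongr
    exact (Real.sqrt_le_sqrt (hc i x)).trans (Finset.single_le_sum
      (f := fun i ↦ Real.sqrt (c i)) (fun _ _ ↦ Real.sqrt_nonneg _) (Finset.mem_univ i))
  -- The derivatives of the partition of unity add at most `card t * ε' * C` to the slope, which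
  -- must fit in the gap between `κ₁` and `κ`.
  set ε' := min ε ((κ - κ₁) / (Fintype.card t * C + 1)) with hε'
  have hκκ : 0 < κ - κ₁ := by rw [hκ₁]; linarith
  have hε'0 : 0 < ε' := lt_min hε (by positivity)
  have hε'C : Fintype.card t * (ε' * C) ≤ κ - κ₁ := by
    calc Fintype.card t * (ε' * C) = ε' * (Fintype.card t * C) := by ring
      _ ≤ ((κ - κ₁) / (Fintype.card t * C + 1)) * (Fintype.card t * C + 1) := by
          gcongr
          · exact min_le_right _ _
          · linarith
      _ = κ - κ₁ := by field_simp
  choose g hgs hgf hgd using fun i : t ↦ hU i ε' hε'0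
  have hsum : ∀ x, ∑ i, ρ i x = 1 := fun x ↦ by
    rw [← finsum_eq_sum_of_fintype]
    exact ρ.sum_eq_one (mem_univ x)
  have hρ0 : ∀ (i : t) (x : M), x ∉ U i → ρ i x = 0 := fun i x hx ↦
    image_eq_zero_of_notMem_tsupport fun h ↦ hx (hρ i h)
  have hterm : ∀ i x, ρ i x * |g i x - f x| ≤ ρ i x * ε' := fun i x ↦ by
    by_cases hx : x ∈ U i
    · exact mul_le_mul_of_nonneg_left (hgf i x hx) (ρ.nonneg i x)
    · rw [hρ0 i x hx, zero_mul, zero_mul]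
  set h : M → ℝ := fun x ↦ ∑ i, ρ i x * g i x with hh
  refine ⟨h, ?_, fun x ↦ ?_, fun x ↦ gradientSq_le_sq_of_abs_modelDeriv_le fun v ↦ ?_⟩
  · have := hρ.contMDiff_finsum_smul (fun i ↦ hUo i) hgs
    simpa only [finsum_eq_sum_of_fintype, smul_eq_mul] using this
  · have h1 : h x - f x = ∑ i, ρ i x * (g i x - f x) := by
      simp only [mul_sub, Finset.sum_sub_distrib, ← Finset.sum_mul, hsum, one_mul, hh]
    rw [h1]
    calc |∑ i, ρ i x * (g i x - f x)| ≤ ∑ i, |ρ i x * (g i x - f x)| :=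
          Finset.abs_sum_le_sum_abs _ _
      _ ≤ ∑ i, ρ i x * ε' := Finset.sum_le_sum fun i _ ↦ by
          rw [abs_mul, abs_of_nonneg (ρ.nonneg i x)]
          exact hterm i x
      _ = ε' := by rw [← Finset.sum_mul, hsum, one_mul]
      _ ≤ ε := min_le_left _ _
  -- Since the `ρ i` sum to `1`, `h` equals `∑ u i` plus the constant `f x`, frozen at the point
  -- considered. No derivative of `f` appears, and each derivative of `ρ i` is multiplied by the
  -- small number `g i x - f x`.
  · set u : t → M → ℝ := fun i ↦ (ρ i : M → ℝ) * (g i + fun _ ↦ -f x) with hu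
    set s := Real.sqrt (metricForm n x v v) with hs
    have hs0 : 0 ≤ s := Real.sqrt_nonneg _
    have hud : ∀ i, MDifferentiableAt (𝓡∂ n) 𝓘(ℝ, ℝ) (u i) x ∧
        |modelDeriv n (u i) x v| ≤ ρ i x * (κ₁ * s) + ε' * C * s := by
      intro i
      by_cases hx : x ∈ U i
      · have hgx : MDifferentiableAt (𝓡∂ n) 𝓘(ℝ, ℝ) (g i) x :=
          ((hgs i).contMDiffAt ((hUo i).mem_nhds hx)).mdifferentiableAt (by simp)
        have hgx' := hgx.add (mdifferentiableAt_const (c := -f x) (I := 𝓡∂ n) (I' := 𝓘(ℝ, ℝ)))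
        refine ⟨(hρd i x).mul hgx', ?_⟩
        rw [hu, modelDeriv_mul (hρd i x) hgx', modelDeriv_add hgx mdifferentiableAt_const,
          modelDeriv_const, add_zero, add_apply, _root_.smul_apply, _root_.smul_apply, smul_eq_mul,
          smul_eq_mul, Pi.add_apply, ← sub_eq_add_neg]
        refine (abs_add_le _ _).trans (add_le_add ?_ ?_)
        · rw [abs_mul, abs_of_nonneg (ρ.nonneg i x)]
          exact mul_le_mul_of_nonneg_left (hgd i x hx v) (ρ.nonneg i x)
        · rw [abs_mul, mul_assoc]
          exact mul_le_mul (hgf i x hx) (hC i x v) (abs_nonneg _) hε'0.le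
      · have hev : u i =ᶠ[𝓝 x] fun _ ↦ 0 := by
          have h1 : x ∈ (tsupport (ρ i))ᶜ := fun h ↦ hx (hρ i h)
          filter_upwards [(isClosed_tsupport (ρ i)).isOpen_compl.mem_nhds h1] with z hz
          simp only [hu, Pi.mul_apply, image_eq_zero_of_notMem_tsupport hz, zero_mul]
        refine ⟨mdifferentiableAt_const.congr_of_eventuallyEq hev, ?_⟩
        rw [modelDeriv_congr hev, modelDeriv_const, hρ0 i x hx, zero_mul, zero_add]
        simpa using by positivity
    obtain ⟨hd, hD⟩ := mdifferentiableAt_sum_and_modelDeriv_sum (s := Finset.univ)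
      fun i _ ↦ (hud i).1
    have heq : h = (∑ i, u i) + fun _ ↦ f x := by
      ext z
      simp only [hh, hu, Pi.add_apply, Finset.sum_apply, Pi.mul_apply, mul_add,
        Finset.sum_add_distrib, ← Finset.sum_mul, hsum]
      ring
    rw [heq, modelDeriv_add hd mdifferentiableAt_const, modelDeriv_const, add_zero, hD,
      sum_apply]
    calc |∑ i, modelDeriv n (u i) x v| ≤ ∑ i, |modelDeriv n (u i) x v| :=
          Finset.abs_sum_le_sum_abs _ _
      _ ≤ ∑ i, (ρ i x * (κ₁ * s) + ε' * C * s) := Finset.sum_le_sum fun i _ ↦ (hud i).2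
      _ = (κ₁ + Fintype.card t * (ε' * C)) * s := by
          rw [Finset.sum_add_distrib, ← Finset.sum_mul, hsum]
          simp only [Finset.sum_const, Finset.card_univ, nsmul_eq_mul]
          ring
      _ ≤ κ * s := by
          gcongr
          linarith

end Gluing


/-! ### The boundary separation inequality -/

/-- A smooth function of slope at most `1` that is constant near `(-∞, 0]` and `[D, ∞)`, and that
increases by almost `D`. -/
theorem exists_contDiff_cutoff {D ε : ℝ} (hε : 0 < ε) (hD : 6 * ε < D) :
    ∃ σ : ℝ → ℝ, ContDiff ℝ ∞ σ ∧ (∀ t, 0 ≤ deriv σ t ∧ deriv σ t ≤ 1) ∧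
      (∀ t ≤ 2 * ε, σ t = 0) ∧ ∀ t, D - 2 * ε ≤ t → deriv σ t = 0 ∧ D - 6 * ε ≤ σ t := by
  -- The derivative of `σ`: equal to `1` on `[3ε, D - 3ε]`, an interval of length `D - 6ε`, and zero
  -- outside `(2ε, D - 2ε)`.
  let b : ContDiffBump (D / 2) := ⟨D / 2 - 3 * ε, D / 2 - 2 * ε, by linarith, by linarith⟩
  have hb2 : b.rOut = D / 2 - 2 * ε := rfl
  have hb1 : b.rIn = D / 2 - 3 * ε := rfl
  have hbc : Continuous b := b.continuous
  set σ : ℝ → ℝ := fun t ↦ ∫ s in (0 : ℝ)..t, b s with hσ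
  have hd : ∀ t, HasDerivAt σ (b t) t := fun t ↦
    intervalIntegral.integral_hasDerivAt_right (hbc.intervalIntegrable _ _)
      (hbc.stronglyMeasurableAtFilter _ _) hbc.continuousAt
  have hderiv : deriv σ = b := funext fun t ↦ (hd t).deriv
  have hmono : Monotone σ := monotone_of_deriv_nonneg (fun t ↦ (hd t).differentiableAt)
    fun t ↦ by rw [hderiv]; exact b.nonneg
  have hzero : ∀ t ≤ 2 * ε, σ t = 0 := fun t ht ↦ by
    refine intervalIntegral.integral_zero_ae (ae_of_all _ fun s hs ↦ ?_)
    have hs2 : s ≤ 2 * ε := by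
      have h1 : s ≤ max 0 t := (uIoc_subset_uIcc hs).2
      exact h1.trans (max_le (by linarith) ht)
    refine b.zero_of_le_dist ?_
    rw [Real.dist_eq, hb2, abs_sub_comm]
    exact (by linarith : D / 2 - 2 * ε ≤ D / 2 - s).trans (le_abs_self _)
  refine ⟨σ, contDiff_infty_iff_deriv.2 ⟨fun t ↦ (hd t).differentiableAt, hderiv ▸ b.contDiff⟩,
    fun t ↦ by rw [hderiv]; exact ⟨b.nonneg, b.le_one⟩, hzero, fun t ht ↦ ⟨?_, ?_⟩⟩
  · rw [hderiv]
    refine b.zero_of_le_dist ?_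
    rw [Real.dist_eq, hb2]
    exact (by linarith : D / 2 - 2 * ε ≤ t - D / 2).trans (le_abs_self _)
  · have h1 : σ (3 * ε) + ∫ s in (3 * ε)..(D - 3 * ε), b s = σ (D - 3 * ε) :=
      intervalIntegral.integral_add_adjacent_intervals (hbc.intervalIntegrable _ _)
        (hbc.intervalIntegrable _ _)
    have h2 : ∫ s in (3 * ε)..(D - 3 * ε), b s = D - 6 * ε := by
      rw [intervalIntegral.integral_congr (g := fun _ ↦ 1), intervalIntegral.integral_const,
        smul_eq_mul]
      · ring
      · intro s hs
        rw [uIcc_of_le (by linarith)] at hs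
        refine b.one_of_mem_closedBall ?_
        rw [Metric.mem_closedBall, Real.dist_eq, hb1, abs_le]
        constructor <;> linarith [hs.1, hs.2]
    have h3 : 0 ≤ σ (3 * ε) := by
      rw [← hzero 0 (by linarith)]
      exact hmono (by linarith)
    have h4 := hmono (show D - 3 * ε ≤ t by linarith)
    linarith

/-- The distance to a set, truncated at `D`, is Lipschitz. -/
theorem lipschitzWith_toReal_min_infEDist {X : Type*}
    [PseudoEMetricSpace X] (s : Set X) (D : NNReal) :
    LipschitzWith 1 fun x ↦ (min (Metric.infEDist x s) D).toReal := by
  have hle : ∀ x y, (min (Metric.infEDist x s) D).toReal ≤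
      (min (Metric.infEDist y s) D).toReal + (min (edist x y) D).toReal := fun x y ↦ by
    have ht : ∀ a : ℝ≥0∞, min a (D : ℝ≥0∞) ≠ ⊤ := fun a ↦
      ((min_le_right _ _).trans_lt ENNReal.coe_lt_top).ne
    rw [← ENNReal.toReal_add (ht _) (ht _)]
    refine ENNReal.toReal_mono (ENNReal.add_ne_top.2 ⟨ht _, ht _⟩) ?_
    have h := Metric.infEDist_le_infEDist_add_edist (s := s) (x := x) (y := y)
    rcases le_total (D : ℝ≥0∞) (Metric.infEDist y s) with h1 | h1
    · rw [min_eq_right h1]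
      exact (min_le_right _ _).trans le_self_add
    rcases le_total (D : ℝ≥0∞) (edist x y) with h2 | h2
    · rw [min_eq_right h2]
      exact (min_le_right _ _).trans le_add_self
    rw [min_eq_left h1, min_eq_left h2]
    exact (min_le_left _ _).trans h
  intro x y
  rw [ENNReal.coe_one, one_mul, edist_dist, Real.dist_eq]
  have h : |(min (Metric.infEDist x s) D).toReal - (min (Metric.infEDist y s) D).toReal| ≤
      (min (edist x y) D).toReal := by
    rw [abs_le]
    have h1 := hle x y
    have h2 := hle y x
    rw [edist_comm y x] at h2
    constructor <;> linarith
  refine (ENNReal.ofReal_le_ofReal h).trans ?_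
  exact ENNReal.ofReal_toReal_le.trans (min_le_left _ _)

/-! ### The `sinh` test function and concentration near the boundary. -/

section Main

variable {n : ℕ} [NeZero n] {M : Type*} [EMetricSpace M]
  [ChartedSpace (EuclideanHalfSpace n) M]

theorem modelDeriv_comp {F : ℝ → ℝ} {h : M → ℝ} {x : M} (hF : DifferentiableAt ℝ F (h x))
    (hh : MDifferentiableAt (𝓡∂ n) 𝓘(ℝ, ℝ) h x) (v : EuclideanSpace ℝ (Fin n)) :
    modelDeriv n (F ∘ h) x v = deriv F (h x) * modelDeriv n h x v := by
  have h1 : modelDeriv n (F ∘ h) x = (fderiv ℝ F (h x)).comp (modelDeriv n h x) :=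
    (hF.hasFDerivAt.hasMFDerivAt.comp x hh.hasMFDerivAt).mfderiv
  rw [h1, ContinuousLinearMap.comp_apply, fderiv_eq_smul_deriv, smul_eq_mul, mul_comm]

variable [RiemannianBundle (fun x : M ↦ TangentSpace (𝓡∂ n) x)]

theorem gradientSq_comp_le {F : ℝ → ℝ} {h : M → ℝ} {x : M} (hF : DifferentiableAt ℝ F (h x))
    (hh : MDifferentiableAt (𝓡∂ n) 𝓘(ℝ, ℝ) h x) :
    gradientSq n (F ∘ h) x ≤ deriv F (h x) ^ 2 * gradientSq n h x := by
  refine (gradientSq_le_sq_of_abs_modelDeriv_le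
    (c := |deriv F (h x)| * Real.sqrt (gradientSq n h x)) fun v ↦ ?_).trans_eq ?_
  · rw [modelDeriv_comp hF hh, abs_mul, mul_assoc]
    exact mul_le_mul_of_nonneg_left (abs_modelDeriv_le _ _ _) (abs_nonneg _)
  · rw [mul_pow, sq_abs, Real.sq_sqrt (gradientSq_nonneg _ _)]

variable [IsManifold (𝓡∂ n) ∞ M]
  [IsContMDiffRiemannianBundle (𝓡∂ n) ∞ (EuclideanSpace ℝ (Fin n))
      (fun x : M ↦ TangentSpace (𝓡∂ n) x)]
  [IsRiemannianManifold (𝓡∂ n) M] [CompactSpace M]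

/-- There is a test function that is large far away from the boundary, and whose gradient is
controlled by the function itself, and vanishes far away from the boundary. -/
theorem exists_isTestFunction_gradientSq_le {D : NNReal} {ε κ a : ℝ} (hε : 0 < ε) (hD : 6 * ε < D)
    (hκ : 1 < κ) (ha : 0 ≤ a) : ∃ φ : M → ℝ, IsTestFunction n φ ∧
      (∀ x, gradientSq n φ x ≤ (a * κ) ^ 2 * (1 + φ x ^ 2)) ∧
      ∀ x, (D : ℝ≥0∞) ≤ Metric.infEDist x ((𝓡∂ n).boundary M) →
        gradientSq n φ x ≤ 0 ∧ Real.sinh (a * (D - 6 * ε)) ^ 2 ≤ φ x ^ 2 := by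
  set bd := (𝓡∂ n).boundary M with hbd
  obtain ⟨σ, hσ, hσ', hσ0, hσ1⟩ := exists_contDiff_cutoff hε hD
  set V : Set M := {x | Metric.infEDist x bd < ENNReal.ofReal ε} with hV
  have hVo : IsOpen V := isOpen_lt Metric.continuous_infEDist continuous_const
  have hbV : bd ⊆ V := fun x hx ↦ by
    rw [hV, mem_ofPred_eq, Metric.infEDist_zero_of_mem hx]
    exact ENNReal.ofReal_pos.2 hε
  -- Lowering the truncated distance by `ε` makes it vanish on the neighbourhood `V` of the
  -- boundary, as the smoothing requires.
  set f : M → ℝ := fun x ↦ max ((min (Metric.infEDist x bd) D).toReal + -ε) 0 with hf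
  have hfL : LipschitzWith 1 f := by
    have h1 := (lipschitzWith_toReal_min_infEDist bd D).add (LipschitzWith.const (-ε))
    rw [add_zero] at h1
    exact h1.max_const 0
  have hfV : ∀ x ∈ V, f x = 0 := fun x hx ↦ by
    refine max_eq_right ?_
    have : (min (Metric.infEDist x bd) D).toReal ≤ ε :=
      ENNReal.toReal_le_of_le_ofReal hε.le ((min_le_left _ _).trans (le_of_lt hx))
    linarith
  obtain ⟨h, hh, hhf, hhg⟩ := hfL.exists_smooth_approx (n := n) hVo hbV hfV hκ hε
  have hhd : ∀ x, MDifferentiableAt (𝓡∂ n) 𝓘(ℝ, ℝ) h x := fun x ↦ hh.mdifferentiable (by simp) x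
  -- The identity `cosh² = 1 + sinh²` bounds the squared gradient of `F ∘ h` by the function itself.
  set F : ℝ → ℝ := fun t ↦ Real.sinh (a * σ t) with hF
  have hFs : ContDiff ℝ ∞ F := Real.contDiff_sinh.comp (contDiff_const.mul hσ)
  have hσd : ∀ t, HasDerivAt σ (deriv σ t) t := fun t ↦
    (hσ.differentiable (by simp) t).hasDerivAt
  have hFd : ∀ t, deriv F t = Real.cosh (a * σ t) * (a * deriv σ t) := fun t ↦
    ((hσd t).const_mul a).sinh.deriv
  have hcosh : ∀ t, Real.cosh (a * σ t) ^ 2 = 1 + F t ^ 2 := fun t ↦ by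
    rw [Real.cosh_sq, add_comm]
  have hbase : ∀ x, gradientSq n (F ∘ h) x ≤ deriv F (h x) ^ 2 * gradientSq n h x := fun x ↦
    gradientSq_comp_le (hFs.differentiable (by simp) _) (hhd x)
  refine ⟨F ∘ h, ⟨hFs.contMDiff.comp hh, ?_⟩, fun x ↦ ?_, fun x hx ↦ ?_⟩
  -- On the boundary `f = 0`, so `h ≤ ε < 2 * ε` there and the closed support avoids it.
  · have h1 : tsupport (F ∘ h) ⊆ {x | 2 * ε ≤ h x} := by
      refine closure_minimal (fun x hx ↦ ?_) (isClosed_le continuous_const hh.continuous)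
      by_contra hlt
      exact hx (by simp [hF, hσ0 _ (not_le.1 hlt).le])
    intro x hx
    by_contra hxi
    have hxb : x ∈ bd := by
      rw [hbd, ← (𝓡∂ n).compl_interior]
      exact hxi
    have h2 := hhf x
    rw [hfV x (hbV hxb), sub_zero] at h2
    linarith [h1 hx, le_abs_self (h x), show 2 * ε ≤ h x from h1 hx]
  · refine (hbase x).trans ?_
    rw [hFd, Function.comp_apply, ← hcosh]
    have h1 : deriv σ (h x) ^ 2 ≤ 1 := pow_le_one₀ (hσ' _).1 (hσ' _).2
    calc (Real.cosh (a * σ (h x)) * (a * deriv σ (h x))) ^ 2 * gradientSq n h x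
        = (Real.cosh (a * σ (h x)) * a) ^ 2 * (deriv σ (h x) ^ 2 * gradientSq n h x) := by ring
      _ ≤ (Real.cosh (a * σ (h x)) * a) ^ 2 * (1 * κ ^ 2) := by
          gcongr
          · exact gradientSq_nonneg _ _
          · exact hhg x
      _ = (a * κ) ^ 2 * Real.cosh (a * σ (h x)) ^ 2 := by ring
  · have hfx : f x = D - ε := by
      simp only [hf, min_eq_right hx, ENNReal.coe_toReal]
      rw [max_eq_left (by linarith)]
      ring
    -- One `ε` was subtracted in `f`, another is the approximation error. This is exactly where `σ`
    -- has become flat.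
    have hhx : D - 2 * ε ≤ h x := by
      have := (abs_le.1 (hhf x)).1
      linarith
    obtain ⟨h1, h2⟩ := hσ1 _ hhx
    constructor
    · refine (hbase x).trans_eq ?_
      rw [hFd, h1]
      ring
    · have h3 : 0 ≤ a * (D - 6 * ε) := mul_nonneg ha (by linarith)
      refine pow_le_pow_left₀ (Real.sinh_nonneg_iff.2 h3) ?_ 2
      exact Real.sinh_le_sinh.2 (mul_le_mul_of_nonneg_left h2 ha)

variable [PreconnectedSpace M] [MeasurableSpace M] [BorelSpace M]

/-- Concentration of the volume near the boundary. -/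
theorem cosh_sq_mul_volume_le (hM : ((𝓡∂ n).boundary M).Nonempty) {Ω : Set M}
    (hΩ : MeasurableSet Ω) {D : NNReal}
    (hΩD : ∀ x ∈ Ω, (D : ℝ≥0∞) ≤ Metric.infEDist x ((𝓡∂ n).boundary M)) {ε κ : ℝ} (hε : 0 < ε)
    (hD : 6 * ε < D) (hκ : 1 < κ) :
    Real.cosh (Real.sqrt (firstDirichletEigenvalue n M) / κ * (D - 6 * ε)) ^ 2 *
      (riemannianVolume n M).real Ω ≤ (riemannianVolume n M).real univ := by
  have := isFiniteMeasure_riemannianVolume (n := n) (M := M)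
  obtain ⟨hpos, hray⟩ := firstDirichletEigenvalue_pos_and_mul_integral_sq_le n M hM
  set Λ := firstDirichletEigenvalue n M with hΛ
  set v := riemannianVolume n M with hv
  have hκ0 : 0 < κ := by linarith
  obtain ⟨φ, hφ, hφg, hφΩ⟩ := exists_isTestFunction_gradientSq_le (n := n) (M := M) hε hD hκ
    (a := Real.sqrt Λ / κ) (by positivity)
  set S := Real.sinh (Real.sqrt Λ / κ * (D - 6 * ε)) with hS
  rw [div_mul_cancel₀ _ hκ0.ne', Real.sq_sqrt hpos.le] at hφg
  have hi : Integrable (fun x ↦ φ x ^ 2) v :=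
    (hφ.1.continuous.pow 2).integrable_of_hasCompactSupport (HasCompactSupport.of_compactSpace _)
  have hgi : Integrable (fun x ↦ gradientSq n φ x) v := hφ.integrable_metricForm hφ
  have hE : dirichletForm n φ φ ≤ Λ * (v.real Ωᶜ + ∫ x in Ωᶜ, φ x ^ 2 ∂v) := by
    change ∫ x, gradientSq n φ x ∂v ≤ _
    rw [← integral_add_compl hΩ hgi]
    have h1 : ∫ x in Ω, gradientSq n φ x ∂v ≤ 0 :=
      setIntegral_nonpos hΩ fun x hx ↦ (hφΩ x (hΩD x hx)).1
    have h2 : ∫ x in Ωᶜ, gradientSq n φ x ∂v ≤ ∫ x in Ωᶜ, Λ * (1 + φ x ^ 2) ∂v :=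
      setIntegral_mono hgi.integrableOn
        ((((integrable_const 1).add hi).const_mul Λ).integrableOn) hφg
    have h3 : ∫ x in Ωᶜ, Λ * (1 + φ x ^ 2) ∂v = Λ * (v.real Ωᶜ + ∫ x in Ωᶜ, φ x ^ 2 ∂v) := by
      rw [integral_const_mul, integral_add (integrable_const 1) hi.integrableOn]
      simp
    linarith
  have h1 := (hray φ hφ).trans hE
  rw [← integral_add_compl hΩ hi] at h1
  -- Dividing by the positive eigenvalue, the integral of `φ ^ 2` over `Ωᶜ` cancels from both sides.
  have h2 : ∫ x in Ω, φ x ^ 2 ∂v ≤ v.real Ωᶜ := by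
    have := le_of_mul_le_mul_left h1 hpos
    linarith
  have h3 : S ^ 2 * v.real Ω ≤ ∫ x in Ω, φ x ^ 2 ∂v := by
    calc S ^ 2 * v.real Ω = ∫ x in Ω, S ^ 2 ∂v := by simp [mul_comm]
      _ ≤ _ := setIntegral_mono_on (integrable_const _).integrableOn hi.integrableOn hΩ
        fun x hx ↦ (hφΩ x (hΩD x hx)).2
  have h4 : v.real Ω + v.real Ωᶜ = v.real univ := measureReal_add_measureReal_compl hΩ
  rw [Real.cosh_sq]
  linarith

/-- The concentration inequality gives `cosh² w * η ≤ 1`, hence `2 * w ≤ 2 * log 2 - log η` with `w`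
close to `√λ D`. Here `η ≤ 1`, because the normalized volume of `Ω` is at most `1`. -/
theorem sqrt_firstDirichletEigenvalue_mul_le_log (hM : ((𝓡∂ n).boundary M).Nonempty) {Ω : Set M}
    (hΩ : MeasurableSet Ω) {D : NNReal} (hD : 0 < D)
    (hΩD : ∀ x ∈ Ω, (D : ℝ≥0∞) ≤ Metric.infEDist x ((𝓡∂ n).boundary M)) {η : ℝ} (hη : 0 < η)
    (hΩη : ENNReal.ofReal η ≤ normalizedVolume n M Ω) :
    Real.sqrt (firstDirichletEigenvalue n M) * D ≤ Real.log (Real.exp 1 / η) := by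
  have := isFiniteMeasure_riemannianVolume (n := n) (M := M)
  have hne : Nonempty M := hM.to_type
  set v := riemannianVolume n M with hv
  have hv0 : 0 < v univ := riemannianVolume_pos_of_isOpen isOpen_univ univ_nonempty
  have hvr : 0 < v.real univ := ENNReal.toReal_pos hv0.ne' (measure_ne_top _ _)
  have hηv : η * v.real univ ≤ v.real Ω := by
    rw [normalizedVolume, Measure.smul_apply, smul_eq_mul] at hΩη
    have h1 : ENNReal.ofReal η * v univ ≤ v Ω := by
      calc ENNReal.ofReal η * v univ ≤ (v univ)⁻¹ * v Ω * v univ := by gcongr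
        _ = v Ω * ((v univ)⁻¹ * v univ) := by ring
        _ = v Ω := by rw [ENNReal.inv_mul_cancel hv0.ne' (measure_ne_top _ _), mul_one]
    have h2 := ENNReal.toReal_mono (measure_ne_top _ _) h1
    rwa [ENNReal.toReal_mul, ENNReal.toReal_ofReal hη.le] at h2
  have hη1 : η ≤ 1 := by
    have h1 : v.real Ω ≤ v.real univ := measureReal_mono (subset_univ _)
    refine le_of_mul_le_mul_right ?_ hvr
    linarith
  have hD' : (0 : ℝ) < D := hD
  -- No limit in `ε` and `κ` is needed: these values give `w = (18 / 25) √λ D`, and `(25 / 18) log 2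
  -- < 1` together with `log η ≤ 0` leaves enough room.
  have h1 := cosh_sq_mul_volume_le hM hΩ hΩD (ε := D / 60) (κ := 5 / 4) (by positivity)
    (by linarith) (by norm_num)
  set s := Real.sqrt (firstDirichletEigenvalue n M) with hs
  set w := s / (5 / 4) * (D - 6 * (D / 60)) with hw
  have hw' : w = 18 / 25 * (s * D) := by rw [hw]; ring
  have h2 : Real.cosh w ^ 2 * η ≤ 1 := by
    refine le_of_mul_le_mul_right ?_ hvr
    calc Real.cosh w ^ 2 * η * v.real univ = Real.cosh w ^ 2 * (η * v.real univ) := by ring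
      _ ≤ Real.cosh w ^ 2 * v.real Ω := by gcongr
      _ ≤ 1 * v.real univ := by linarith
  have h3 : Real.exp w / 2 ≤ Real.cosh w := by
    rw [Real.cosh_eq]
    linarith [Real.exp_pos (-w)]
  have h4 : (Real.exp w / 2) ^ 2 * η ≤ 1 :=
    (mul_le_mul_of_nonneg_right (pow_le_pow_left₀ (by positivity) h3 2) hη.le).trans h2
  have h5 := Real.log_le_log (by positivity) h4
  rw [Real.log_one, Real.log_mul (by positivity) hη.ne', Real.log_pow,
    Real.log_div (Real.exp_ne_zero _) two_ne_zero, Real.log_exp] at h5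
  rw [Real.log_div (Real.exp_ne_zero _) hη.ne', Real.log_exp]
  have h6 := Real.log_nonpos hη.le hη1
  have h7 := Real.log_two_lt_d9
  push_cast at h5
  linarith

end Main

end

theorem theorem2p3 (n : ℕ) [NeZero n] (M : Type*) [EMetricSpace M]
    [ChartedSpace (EuclideanHalfSpace n) M] [IsManifold (𝓡∂ n) ∞ M]
    [RiemannianBundle (fun x : M ↦ TangentSpace (𝓡∂ n) x)]
    [IsContMDiffRiemannianBundle (𝓡∂ n) ∞ (EuclideanSpace ℝ (Fin n))
      (fun x : M ↦ TangentSpace (𝓡∂ n) x)]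
    [IsRiemannianManifold (𝓡∂ n) M]
    [CompactSpace M] [ConnectedSpace M] [MeasurableSpace M] [BorelSpace M]
    (hM : ((𝓡∂ n).boundary M).Nonempty)
    (η : ℝ) (hη : 0 < η) (hη' : η ≤ Real.exp 1) :
    boundarySeparationDistance (normalizedVolume n M) ((𝓡∂ n).boundary M) (fun _ : Fin 1 ↦ η) ≤
      ENNReal.ofReal
        (1 / Real.sqrt (firstDirichletEigenvalue n M) * Real.log (Real.exp 1 / η)) := by
  refine iSup₂_le fun Ω hΩ ↦ (min_le_right _ _).trans ((iInf_le _ 0).trans ?_)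
  by_contra! hlt
  -- A finite `D` strictly between the claimed bound and the distance; `hD₁` will contradict the
  -- logarithmic estimate at this `D`.
  obtain ⟨D, hD₁, hD₂⟩ := ENNReal.lt_iff_exists_nnreal_btwn.1 hlt
  have hD : 0 < D := ENNReal.coe_pos.1 (zero_le.trans_lt hD₁)
  have hpos := (firstDirichletEigenvalue_pos_and_mul_integral_sq_le n M hM).1
  have h := sqrt_firstDirichletEigenvalue_mul_le_log hM (hΩ 0).1 hD
    (fun x hx ↦ hD₂.le.trans (iInf₂_le x hx)) hη (hΩ 0).2
  rw [← ENNReal.ofReal_coe_nnreal, ENNReal.ofReal_lt_ofReal_iff (NNReal.coe_pos.2 hD), one_div,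
    inv_mul_lt_iff₀ (Real.sqrt_pos.2 hpos)] at hD₁
  exact hD₁.not_ge h
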